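/- A straight-line drawing $\Gamma$ of a graph maps the vertices to distinct points of the plane and the edges to the segments between them; it is monotone if every two vertices are joined by a path for which there is a line such that the projections of the vertices of the path onto the line appear in the same order as on the path. Let $T$ be a tree rooted at $r$, with edges directed away from $r$, and let $T_u$ be the subtree rooted at $u$. The slope of an edge $(u,v)$ is the counterclockwise angle from the direction of the positive $x$-axis to the direction from $u$ to $v$. A drawing of $T$ is non-strictly slope-disjoint if for every vertex $u$ there are angles $0\le a_1(u)<a_2(u)\le\pi$ such that (1) every edge $e$ that is in $T_u$ or enters $u$ from its parent satisfies $a_1(u)<\mathrm{slope}(e)<a_2(u)$; (2) if $v$ is a child of $u$, then $a_1(u)\le a_1(v)<a_2(v)\le a_2(u)$; (3) if $u_1\ne u_2$ have the same parent, then $a_2(u_1)\le a_1(u_2)$ or $a_2(u_2)\le a_1(u_1)$. The tree is ordered if the cyclic order of the edges incident to each vertex is fixed. A drawing of an ordered rooted tree is near-convex monotone if it is monotone, the edges around each vertex appear counterclockwise in the given cyclic order, and any two consecutive edges incident to a vertex, with the possible exception of a single pair of consecutive edges incident to $r$, form an angle $\theta$ with $0<\theta\le\pi$. Theorem. There is an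 algorithm that, given an $n$-vertex ordered tree $T$ (as adjacency lists) and a root $r$ of $T$, produces in $O(n)$ time (on a unit-cost RAM with words of $O(\log n)$ bits) a monotone drawing of $T$ such that: (i) $r$ is drawn at $(0,0)$; (ii) the drawing is non-strictly slope-disjoint; (iii) the drawing is near-convex monotone; (iv) the drawing is contained in the second octant $\{(x,y): 0\le x\le y\}$, which is bounded by the half-lines from the origin with slopes $\pi/4$ and $\pi/2$; (v) the drawing fits in a $2n\times 2n$ grid, i.e. all vertices are at integer points $(x,y)$ with $0\le x,y\le 2n-1$. -/

import Mathlib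

namespace TreeDrawing

/-! ## A unit-cost word RAM

Programs act on registers and on a random-access memory, both holding natural numbers.
Each elementary instruction and each evaluated test costs one step, and no instruction may
produce a number `≥ W`, where `W` is the word bound. -/

/-- Arithmetic operations on words (`sub` is truncated at `0`, `div` rounds down). -/
inductive Op where
  | add | sub | mul | div

/-- Value of an arithmetic operation. -/
def Op.eval : Op → ℕ → ℕ → ℕ
  | .add, a, b => a + b
  | .sub, a, b => a - b
  | .mul, a, b => a * b
  | .div, a, b => a / b

/-- Programs. Registers are named by natural numbers; a program mentions finitely many. -/
inductive Program where
  /-- do nothing -/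
  | skip : Program
  /-- `R[d] := c` -/
  | const (d c : ℕ) : Program
  /-- `R[d] := R[a] o R[b]` -/
  | arith (o : Op) (d a b : ℕ) : Program
  /-- `R[d] := M[R[a]]` -/
  | load (d a : ℕ) : Program
  /-- `M[R[a]] := R[b]` -/
  | store (a b : ℕ) : Program
  /-- `p; q` -/
  | seq (p q : Program) : Program
  /-- `if R[a] < R[b] then p else q` -/
  | ifLt (a b : ℕ) (p q : Program) : Program
  /-- `while R[a] < R[b] do p` -/
  | whileLt (a b : ℕ) (p : Program) : Program

/-- A configuration: the contents of the registers and of the memory. -/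
structure Config where
  reg : ℕ → ℕ
  mem : ℕ → ℕ

/-- Overwrite register `d`. -/
def Config.setReg (s : Config) (d x : ℕ) : Config :=
  { s with reg := Function.update s.reg d x }

/-- Overwrite memory cell `a`. -/
def Config.setMem (s : Config) (a x : ℕ) : Config :=
  { s with mem := Function.update s.mem a x }

/-- `Runs W p s t s'`: with word bound `W`, program `p` started in configuration `s` halts
after exactly `t` steps in configuration `s'`, without ever producing a number `≥ W`. -/
inductive Runs (W : ℕ) : Program → Config → ℕ → Config → Prop
  | skip (s : Config) : Runs W .skip s 1 s
  | const (s : Config) (d c : ℕ) (h : c < W) : Runs W (.const d c) s 1 (s.setReg d c)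
  | arith (s : Config) (o : Op) (d a b : ℕ) (h : o.eval (s.reg a) (s.reg b) < W) :
      Runs W (.arith o d a b) s 1 (s.setReg d (o.eval (s.reg a) (s.reg b)))
  | load (s : Config) (d a : ℕ) (h : s.mem (s.reg a) < W) :
      Runs W (.load d a) s 1 (s.setReg d (s.mem (s.reg a)))
  | store (s : Config) (a b : ℕ) (h : s.reg b < W) :
      Runs W (.store a b) s 1 (s.setMem (s.reg a) (s.reg b))
  | seq {p q : Program} {s₁ s₂ s₃ : Config} {t₁ t₂ : ℕ}
      (h₁ : Runs W p s₁ t₁ s₂) (h₂ : Runs W q s₂ t₂ s₃) :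
      Runs W (.seq p q) s₁ (t₁ + t₂) s₃
  | ifTrue {a b : ℕ} {p q : Program} {s s' : Config} {t : ℕ}
      (h : s.reg a < s.reg b) (hp : Runs W p s t s') :
      Runs W (.ifLt a b p q) s (t + 1) s'
  | ifFalse {a b : ℕ} {p q : Program} {s s' : Config} {t : ℕ}
      (h : ¬ s.reg a < s.reg b) (hq : Runs W q s t s') :
      Runs W (.ifLt a b p q) s (t + 1) s'
  | whileTrue {a b : ℕ} {p : Program} {s s' s'' : Config} {t t' : ℕ}
      (h : s.reg a < s.reg b) (hp : Runs W p s t s')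
      (hw : Runs W (.whileLt a b p) s' t' s'') :
      Runs W (.whileLt a b p) s (t + t' + 1) s''
  | whileFalse {a b : ℕ} {p : Program} {s : Config} (h : ¬ s.reg a < s.reg b) :
      Runs W (.whileLt a b p) s 1 s

/-! ## Ordered trees and their encoding -/

section Graph

variable {V : Type*}

/-- `ord v` lists every neighbour of `v` exactly once. Read cyclically, it fixes the order of
the edges incident to `v`. -/
def IsEdgeOrder (G : SimpleGraph V) (ord : V → List V) : Prop :=
  ∀ v, (ord v).Nodup ∧ ∀ w, w ∈ ord v ↔ G.Adj v w

/-- `v` is a child of `u` in the tree `G` rooted at `r`. -/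
def IsChild (G : SimpleGraph V) (r u v : V) : Prop :=
  G.Adj u v ∧ G.dist r v = G.dist r u + 1

/-- `v` is a vertex of the subtree rooted at `u`, in the tree `G` rooted at `r`. -/
def InSubtree (G : SimpleGraph V) (r u v : V) : Prop :=
  Relation.ReflTransGen (IsChild G r) u v

/-! ## Drawings

The plane is `ℂ`, the point `(x, y)` being `x + y i`. A straight-line drawing is given by the
positions of the vertices. -/

/-- Distinct vertices have distinct positions. -/
def IsStraightLineDrawing (Γ : V → ℂ) : Prop :=
  Function.Injective Γ

/-- The path `p` is drawn monotonically: there is a line, with direction vector `d`, on which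
the projections of the vertices appear in the same order as on `p`. -/
def IsMonotonePath {G : SimpleGraph V} (Γ : V → ℂ) {u v : V} (p : G.Walk u v) : Prop :=
  ∃ d : ℂ, d ≠ 0 ∧ (p.support.map fun w => inner ℝ d (Γ w)).Pairwise (· < ·)

/-- Monotone straight-line drawings of a graph. -/
def IsMonotoneDrawing (G : SimpleGraph V) (Γ : V → ℂ) : Prop :=
  IsStraightLineDrawing Γ ∧
    ∀ u v : V, ∃ p : G.Walk u v, p.IsPath ∧ IsMonotonePath Γ p

/-- The slope, in `[0, 2π)`, of the edge directed from `u` to `v`. -/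
noncomputable def slope (Γ : V → ℂ) (u v : V) : ℝ :=
  toIcoMod Real.two_pi_pos 0 (Γ v - Γ u).arg

/-- The angle in `[0, 2π)` of the counterclockwise rotation around `v` that takes the
direction of the edge `vw` to that of the edge `vw'`. -/
noncomputable def ccwAngle (Γ : V → ℂ) (v w w' : V) : ℝ :=
  toIcoMod Real.two_pi_pos 0 ((Γ w' - Γ v).arg - (Γ w - Γ v).arg)

/-- Non-strictly slope-disjoint drawings of the tree `G` rooted at `r`, with edges directed
away from the root. -/
def IsNonStrictlySlopeDisjoint (G : SimpleGraph V) (r : V) (Γ : V → ℂ) : Prop :=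
  ∃ a₁ a₂ : V → ℝ,
    (∀ u, 0 ≤ a₁ u ∧ a₁ u < a₂ u ∧ a₂ u ≤ Real.pi ∧
      (∀ w z, InSubtree G r u w → IsChild G r w z → slope Γ w z ∈ Set.Ioo (a₁ u) (a₂ u)) ∧
      (∀ p, IsChild G r p u → slope Γ p u ∈ Set.Ioo (a₁ u) (a₂ u))) ∧
    (∀ u v, IsChild G r u v → a₁ u ≤ a₁ v ∧ a₁ v < a₂ v ∧ a₂ v ≤ a₂ u) ∧
    (∀ p u₁ u₂, IsChild G r p u₁ → IsChild G r p u₂ → u₁ ≠ u₂ →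
      (a₁ u₁ < a₂ u₁ ∧ a₂ u₁ ≤ a₁ u₂ ∧ a₁ u₂ < a₂ u₂) ∨
      (a₁ u₂ < a₂ u₂ ∧ a₂ u₂ ≤ a₁ u₁ ∧ a₁ u₁ < a₂ u₁))

/-- The drawing respects the order of the edges: around each vertex `v`, the edges appear
counterclockwise in the cyclic order given by `ord v`. -/
def RespectsOrder (ord : V → List V) (Γ : V → ℂ) : Prop :=
  ∀ v w₀ l, ord v = w₀ :: l →
    (w₀ :: l).Pairwise fun w w' => ccwAngle Γ v w₀ w < ccwAngle Γ v w₀ w'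

/-- `w'` follows `w` in the cyclic order given by the list `l`, which has at least two
elements. -/
def CyclicSucc (l : List V) (w w' : V) : Prop :=
  2 ≤ l.length ∧ (w, w') ∈ l.zip (l.rotate 1)

/-- Near-convex monotone drawings of an ordered tree rooted at `r`: all pairs of consecutive
edges at a vertex, except possibly one pair at `r`, form an angle in `(0, π]`. -/
def IsNearConvexMonotone (G : SimpleGraph V) (r : V) (ord : V → List V) (Γ : V → ℂ) : Prop :=
  IsMonotoneDrawing G Γ ∧ RespectsOrder ord Γ ∧
    ∃ e : V × V, ∀ v w w', CyclicSucc (ord v) w w' →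
      (v = r ∧ (w, w') = e) ∨ ccwAngle Γ v w w' ∈ Set.Ioc 0 Real.pi

/-- The set of points of the plane covered by the drawing. -/
def drawnSet (G : SimpleGraph V) (Γ : V → ℂ) : Set ℂ :=
  Set.range Γ ∪ ⋃ (u : V) (v : V) (_ : G.Adj u v), segment ℝ (Γ u) (Γ v)

end Graph

/-- The closed second octant. -/
def secondOctant : Set ℂ := {z | 0 ≤ z.re ∧ z.re ≤ z.im}

/-- All vertices lie on the points `(x, y)` of the integer grid with `0 ≤ x, y < N`, which
has `N` columns and `N` rows. -/
def FitsInGrid {V : Type*} (Γ : V → ℂ) (N : ℕ) : Prop :=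
  ∀ v, ∃ x y : ℕ, x < N ∧ y < N ∧ Γ v = ⟨x, y⟩

/-! ## Input and output -/

/-- Address at which the adjacency list of vertex `i` starts. -/
def listAddr {n : ℕ} (ord : Fin n → List (Fin n)) (i : ℕ) : ℕ :=
  n + 1 + (((List.finRange n).take i).map fun v => (ord v).length).sum

/-- Adjacency arrays: the addresses at which the lists of the vertices `0, …, n - 1` start and
the address at which the last list ends (`n + 1` words), followed by the lists. -/
def inputWords {n : ℕ} (ord : Fin n → List (Fin n)) : List ℕ :=
  ((List.range (n + 1)).map (listAddr ord)) ++
    ((List.finRange n).flatMap fun v => (ord v).map fun w => (w : ℕ))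

/-- Initial configuration: `n` and `r` are in registers `0` and `1`, the adjacency arrays
are at the beginning of the memory, everything else is `0`. -/
def inputConfig {n : ℕ} (r : Fin n) (ord : Fin n → List (Fin n)) : Config where
  reg := fun i => if i = 0 then n else if i = 1 then (r : ℕ) else 0
  mem := fun i => (inputWords ord).getD i 0

/-- The drawing computed by a halted machine: registers `0` and `1` contain the addresses of
the arrays of the x-coordinates and of the y-coordinates of the vertices. -/
def outputDrawing (n : ℕ) (s : Config) : Fin n → ℂ :=
  fun v => ⟨(s.mem (s.reg 0 + v) : ℝ), (s.mem (s.reg 1 + v) : ℝ)⟩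

end TreeDrawing

/-!
Let `N = n ^ 3 + 1`. The root receives the interval `[0, N)`, and the children of a vertex receive
consecutive parts of the interval of that vertex, of lengths proportional to the sizes of their
subtrees. If `v` receives `[lo, hi)`, then the edge entering `v` is drawn as a vector `(k - j, k)`
with `j / k` in `[lo / N, hi / N)`. The angle of `(1 - t, 1)` increases with `t`, so nested
intervals make the drawing slope-disjoint. A slope-disjoint drawing is monotone: the slopes on the
two branches of a path are separated by an angle, and both branches project in order onto the normal
of the line at this angle. If the interval of a child contains the fraction `j / k` of its parent,
the child uses it too. Hence the slope of the edge entering a vertex lies between those of the edges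
to its first and its last child, which makes the drawing near-convex.

An interval of length `w` contains `j / k` with `k = ⌈N / w⌉`. For a vertex of height `y` whose
subtree has `s` vertices, `y + 2 N (s - 1) / (w - s ^ 2)` does not increase from parent to child,
and at the root it is less than `2 n`; so all heights are less than `2 n`.

The algorithm lists the vertices by breadth-first search, adds up the sizes of the subtrees in the
reverse order, and places the vertices in the order of the search.
-/

namespace TreeDrawing

/-! ### Rooted trees -/

section RootedTree

variable {V : Type*} {G : SimpleGraph V} {r u v w : V}

theorem IsChild.ne_root (h : IsChild G r u v) : v ≠ r := by
  rintro rfl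
  simpa using h.2

theorem IsChild.asymm (h : IsChild G r u v) : ¬ IsChild G r v u := by
  intro h'
  have := h.2
  have := h'.2
  omega

theorem exists_isChild (hG : G.Connected) (hv : v ≠ r) : ∃ u, IsChild G r u v := by
  obtain ⟨p, hp⟩ := hG.exists_walk_length_eq_dist r v
  have hnil : ¬ p.Nil := SimpleGraph.Walk.not_nil_of_ne hv.symm
  have hadj := p.adj_penultimate hnil
  refine ⟨p.penultimate, hadj, ?_⟩
  have h₁ := SimpleGraph.dist_le p.dropLast
  have h₂ : p.dropLast.length + 1 = p.length := SimpleGraph.Walk.length_dropLast_add_one hnil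
  have h₃ := hG.dist_triangle (u := r) (v := p.penultimate) (w := v)
  rw [SimpleGraph.dist_eq_one_iff_adj.2 hadj] at h₃
  omega

theorem IsChild.unique (hG : G.IsTree) (hu : IsChild G r u v) (hw : IsChild G r w v) : u = w := by
  obtain ⟨p, hp, -⟩ := hG.connected.exists_path_of_dist r v
  have eq_penultimate : ∀ x, IsChild G r x v → x = p.penultimate := by
    intro x hx
    obtain ⟨q, hq, hlen⟩ := hG.connected.exists_path_of_dist r x
    have hv : v ∉ q.support := by
      classical
      intro hmem
      have h₁ := SimpleGraph.dist_le (q.takeUntil v hmem)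
      have h₂ := q.length_takeUntil_le_length hmem
      have h₃ := hx.2
      omega
    have hqp : q.concat hx.1 = p :=
      congrArg Subtype.val
        ((hG.isAcyclic.subsingleton_path r v).elim ⟨_, hq.concat hv hx.1⟩ ⟨p, hp⟩)
    rw [← hqp, SimpleGraph.Walk.penultimate_concat]
  rw [eq_penultimate u hu, eq_penultimate w hw]

theorem adj_iff_isChild_or (hG : G.IsTree) : G.Adj u v ↔ IsChild G r u v ∨ IsChild G r v u :=
  ⟨fun h => (hG.dist_eq_dist_add_one_of_adj r h).symm.imp (⟨h, ·⟩) (⟨h.symm, ·⟩),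
    fun h => h.elim (·.1) (·.1.symm)⟩

theorem inSubtree_root (hG : G.Connected) (v : V) : InSubtree G r r v := by
  induction hd : G.dist r v generalizing v with
  | zero => exact (hG.dist_eq_zero_iff.1 hd) ▸ .refl
  | succ d ih =>
    have hv : v ≠ r := by
      rintro rfl
      simp at hd
    obtain ⟨u, hu⟩ := exists_isChild hG hv
    exact (ih u (by have := hu.2; omega)).tail hu

theorem InSubtree.eq_or_dist_lt (h : InSubtree G r u v) : u = v ∨ G.dist r u < G.dist r v := by
  induction h with
  | refl => exact .inl rfl
  | tail _ hc ih =>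
    have := hc.2
    rcases ih with rfl | ih <;> omega

theorem inSubtree_total (hG : G.IsTree) (hu : InSubtree G r u w) (hv : InSubtree G r v w) :
    InSubtree G r u v ∨ InSubtree G r v u := by
  have hunique : Relator.RightUnique (Function.swap (IsChild G r)) :=
    fun _ _ _ h h' => h.unique hG h'
  have hswap := Relation.ReflTransGen.total_of_right_unique hunique
    (Relation.reflTransGen_swap.2 hu) (Relation.reflTransGen_swap.2 hv)
  exact hswap.symm.imp Relation.reflTransGen_swap.1 Relation.reflTransGen_swap.1

theorem IsChild.eq_of_inSubtree (hG : G.IsTree) {c c' : V} (hc : IsChild G r u c)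
    (hc' : IsChild G r u c') (h : InSubtree G r c w) (h' : InSubtree G r c' w) : c = c' := by
  have := hc.2
  have := hc'.2
  rcases inSubtree_total hG h h' with h | h
  · exact h.eq_or_dist_lt.resolve_right (by omega)
  · exact (h.eq_or_dist_lt.resolve_right (by omega)).symm

theorem inSubtree_or_exists_branching (hG : G.Connected) (r u v : V) :
    InSubtree G r u v ∨ InSubtree G r v u ∨ ∃ w c₁ c₂, c₁ ≠ c₂ ∧ IsChild G r w c₁ ∧
      IsChild G r w c₂ ∧ InSubtree G r c₁ u ∧ InSubtree G r c₂ v := by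
  induction inSubtree_root (r := r) hG v with
  | refl => exact .inr (.inl (inSubtree_root hG u))
  | @tail p x _ hx ih =>
    rcases ih with h | h | ⟨w, c₁, c₂, hne, h₁, h₂, hu, hp⟩
    · exact .inl (h.tail hx)
    · rcases Relation.ReflTransGen.cases_head h with rfl | ⟨c, hc, hcu⟩
      · exact .inl (.single hx)
      · by_cases hcx : c = x
        · exact .inr (.inl (hcx ▸ hcu))
        · exact .inr (.inr ⟨p, c, x, hcx, hc, hx, hcu, .refl⟩)
    · exact .inr (.inr ⟨w, c₁, c₂, hne, h₁, h₂, hu, hp.tail hx⟩)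

open Classical in
/-- The parent of `v` in the tree `G` rooted at `r`. By convention the root is its own parent. -/
noncomputable def parent (G : SimpleGraph V) (r v : V) : V :=
  if h : ∃ u, IsChild G r u v then h.choose else v

theorem parent_root : parent G r r = r :=
  dif_neg fun ⟨_, h⟩ => h.ne_root rfl

theorem isChild_parent (hG : G.Connected) (hv : v ≠ r) : IsChild G r (parent G r v) v := by
  rw [parent, dif_pos (exists_isChild hG hv)]
  exact (exists_isChild hG hv).choose_spec

theorem IsChild.parent_eq (hG : G.IsTree) (h : IsChild G r u v) : parent G r v = u :=
  (isChild_parent hG.connected h.ne_root).unique hG h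

theorem induction_on_isChild {P : V → Prop} (hG : G.Connected) (root : P r)
    (child : ∀ u v, IsChild G r u v → P u → P v) (v : V) : P v := by
  induction inSubtree_root (r := r) hG v with
  | refl => exact root
  | tail _ hc ih => exact child _ _ hc ih

end RootedTree

section OrderedTree

variable {V : Type*} {G : SimpleGraph V} {r u v w : V} {ord : V → List V}

/-- `G` is a tree and `ord` makes it an ordered tree. -/
structure IsOrderedTree (G : SimpleGraph V) (ord : V → List V) : Prop where
  isTree : G.IsTree
  isEdgeOrder : IsEdgeOrder G ord

theorem IsOrderedTree.mem_ord (hT : IsOrderedTree G ord) :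
    w ∈ ord u ↔ IsChild G r u w ∨ IsChild G r w u :=
  ((hT.isEdgeOrder u).2 w).trans (adj_iff_isChild_or hT.isTree)

theorem IsOrderedTree.parent_mem_ord_iff (hT : IsOrderedTree G ord) :
    parent G r u ∈ ord u ↔ u ≠ r := by
  refine ⟨?_, fun hu => hT.mem_ord.2 (.inr (isChild_parent hT.isTree.connected hu))⟩
  rintro h rfl
  rw [parent_root, (hT.isEdgeOrder u).2] at h
  exact G.irrefl h

theorem IsOrderedTree.sum_length_ord [Fintype V] (hT : IsOrderedTree G ord) :
    ∑ u, (ord u).length + 2 = 2 * Fintype.card V := by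
  classical
  have hdeg : ∀ u, (ord u).length = G.degree u := by
    intro u
    rw [← SimpleGraph.card_neighborFinset_eq_degree,
      ← List.toFinset_card_of_nodup (hT.isEdgeOrder u).1]
    congr 1
    ext w
    simp [(hT.isEdgeOrder u).2]
  simp only [hdeg, G.sum_degrees_eq_twice_card_edges]
  have := hT.isTree.card_edgeFinset
  omega

open Classical in
/-- The number of vertices of the subtree of `G` rooted at `v`, when `G` is rooted at `r`. -/
noncomputable def subtreeSize [Fintype V] (G : SimpleGraph V) (r v : V) : ℕ :=
  Finset.card {w | InSubtree G r v w}

theorem subtreeSize_root [Fintype V] (hG : G.Connected) : subtreeSize G r r = Fintype.card V := by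
  simp [subtreeSize, inSubtree_root hG]

theorem subtreeSize_le [Fintype V] (G : SimpleGraph V) (r v : V) :
    subtreeSize G r v ≤ Fintype.card V :=
  Finset.card_le_univ _

variable [DecidableEq V]

/-- The children of `u` in counterclockwise order: the neighbours of a vertex `u ≠ r` are listed
from the one after the parent on. The list of the neighbours of the root does not contain its
`parent`, so it is kept as it is. -/
noncomputable def childList (G : SimpleGraph V) (r : V) (ord : V → List V) (u : V) : List V :=
  (ord u).drop ((ord u).idxOf (parent G r u) + 1) ++ (ord u).take ((ord u).idxOf (parent G r u))

theorem childList_perm (G : SimpleGraph V) (r : V) (ord : V → List V) (u : V) :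
    (childList G r ord u).Perm ((ord u).erase (parent G r u)) := by
  rw [List.erase_eq_eraseIdx_of_idxOf rfl, List.eraseIdx_eq_take_drop_succ]
  exact List.perm_append_comm

namespace IsOrderedTree

theorem nodup_childList (hT : IsOrderedTree G ord) : (childList G r ord u).Nodup :=
  (childList_perm G r ord u).nodup_iff.2 ((hT.isEdgeOrder u).1.erase _)

theorem mem_childList (hT : IsOrderedTree G ord) :
    w ∈ childList G r ord u ↔ IsChild G r u w := by
  rw [(childList_perm G r ord u).mem_iff, (hT.isEdgeOrder u).1.mem_erase_iff, hT.mem_ord (r := r)]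
  constructor
  · rintro ⟨hne, h | h⟩
    · exact h
    · exact absurd (h.parent_eq hT.isTree).symm hne
  · intro h
    refine ⟨?_, .inl h⟩
    rintro rfl
    by_cases hu : u = r
    · exact h.ne_root (hu ▸ parent_root)
    · exact (isChild_parent hT.isTree.connected hu).asymm h

theorem childList_root (hT : IsOrderedTree G ord) : childList G r ord r = ord r := by
  have h : parent G r r ∉ ord r := by simp [hT.parent_mem_ord_iff]
  simp [childList, List.idxOf_eq_length h]

theorem isRotated_ord (hT : IsOrderedTree G ord) (hu : u ≠ r) :
    (parent G r u :: childList G r ord u) ~r ord u := by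
  have hlt := List.idxOf_lt_length_of_mem (hT.parent_mem_ord_iff.2 hu)
  conv_rhs => rw [← List.take_append_drop ((ord u).idxOf (parent G r u)) (ord u),
    List.drop_eq_getElem_cons hlt, List.getElem_idxOf]
  exact List.isRotated_append (l := parent G r u :: _)

theorem subtreeSize_eq [Fintype V] (hT : IsOrderedTree G ord) (r u : V) :
    subtreeSize G r u = 1 + ((childList G r ord u).map (subtreeSize G r)).sum := by
  classical
  rw [← List.sum_toFinset _ hT.nodup_childList]
  unfold subtreeSize
  rw [← Finset.card_biUnion]
  · rw [add_comm, ← Finset.card_insert_of_notMem (a := u)]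
    · congr 1
      ext w
      have hcases : InSubtree G r u w ↔ w = u ∨ ∃ c, IsChild G r u c ∧ InSubtree G r c w := by
        rw [eq_comm]
        exact Relation.ReflTransGen.cases_head_iff
      simpa [hT.mem_childList] using hcases
    · simp only [Finset.mem_biUnion, List.mem_toFinset, Finset.mem_filter, Finset.mem_univ,
        true_and, not_exists, not_and, hT.mem_childList]
      intro c hc hcu
      have := hc.2
      rcases hcu.eq_or_dist_lt with rfl | _ <;> omega
  · intro c hc c' hc' hne
    simp only [List.coe_toFinset, Set.mem_ofPred_eq, hT.mem_childList] at hc hc'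
    refine Finset.disjoint_left.2 fun w hw hw' => hne ?_
    exact hc.eq_of_inSubtree (w := w) hT.isTree hc' (by simpa using hw) (by simpa using hw')

end IsOrderedTree

end OrderedTree

/-! ### Slopes and cyclic orders -/

section SlopeAngle

open Real

/-- The angle of the vectors `κ (1 - t, 1)` with `κ > 0`. As `t` runs through the reals, it
increases from `0` to `π`. -/
noncomputable def slopeAngle (t : ℝ) : ℝ := π / 2 + arctan (t - 1)

theorem slopeAngle_strictMono : StrictMono slopeAngle := fun _ _ h =>
  add_lt_add_right (arctan_strictMono (sub_lt_sub_right h 1)) _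

theorem slopeAngle_mem_Ioo (t : ℝ) : slopeAngle t ∈ Set.Ioo 0 π := by
  have h₁ := neg_pi_div_two_lt_arctan (t - 1)
  have h₂ := arctan_lt_pi_div_two (t - 1)
  constructor <;> unfold slopeAngle <;> linarith

theorem arg_eq_slopeAngle {κ : ℝ} (hκ : 0 < κ) (t : ℝ) :
    ((κ : ℂ) * ⟨1 - t, 1⟩).arg = slopeAngle t := by
  obtain ⟨hpos, hlt⟩ := slopeAngle_mem_Ioo t
  have hs : 0 < √(1 + (1 - t) ^ 2) := Real.sqrt_pos.2 (by positivity)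
  have hpolar : (⟨1 - t, 1⟩ : ℂ) = (√(1 + (1 - t) ^ 2) : ℝ) *
      (Complex.cos (slopeAngle t : ℝ) + Complex.sin (slopeAngle t : ℝ) * Complex.I) := by
    have hangle : slopeAngle t = π / 2 - arctan (1 - t) := by
      rw [slopeAngle, ← neg_sub 1 t, arctan_neg, ← sub_eq_add_neg]
    rw [hangle, ← Complex.ofReal_cos, ← Complex.ofReal_sin, cos_pi_div_two_sub,
      sin_pi_div_two_sub, sin_arctan, cos_arctan]
    apply Complex.ext <;> simp <;> field_simp
  rw [Complex.arg_real_mul _ hκ, hpolar, Complex.arg_mul_cos_add_sin_mul_I hs]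
  exact ⟨by linarith, hlt.le⟩

end SlopeAngle

section CyclicOrder

variable {V : Type*} {Γ : V → ℂ} {v a b c : V} {l l' : List V}

theorem ccwAngle_mem_Ico (Γ : V → ℂ) (v a b : V) :
    ccwAngle Γ v a b ∈ Set.Ico 0 (2 * Real.pi) := by
  simpa [ccwAngle] using toIcoMod_mem_Ico Real.two_pi_pos 0 ((Γ b - Γ v).arg - (Γ a - Γ v).arg)

theorem ccwAngle_eq_of_eq_add {x : ℝ} (hx : x ∈ Set.Ico 0 (2 * Real.pi)) (k : ℤ)
    (h : (Γ b - Γ v).arg - (Γ a - Γ v).arg = x + k * (2 * Real.pi)) : ccwAngle Γ v a b = x := by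
  rw [ccwAngle, toIcoMod_eq_iff, zero_add]
  exact ⟨hx, k, by simpa using h⟩

theorem exists_eq_ccwAngle_add (Γ : V → ℂ) (v a b : V) :
    ∃ k : ℤ, (Γ b - Γ v).arg - (Γ a - Γ v).arg = ccwAngle Γ v a b + k * (2 * Real.pi) := by
  refine ⟨toIcoDiv Real.two_pi_pos 0 ((Γ b - Γ v).arg - (Γ a - Γ v).arg), ?_⟩
  rw [← zsmul_eq_mul]
  exact (toIcoMod_add_toIcoDiv_zsmul _ _ _).symm

theorem ccwAngle_self (Γ : V → ℂ) (v a : V) : ccwAngle Γ v a a = 0 :=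
  ccwAngle_eq_of_eq_add ⟨le_rfl, Real.two_pi_pos⟩ 0 (by simp)

theorem ccwAngle_eq_sub (h : ccwAngle Γ v a b ≤ ccwAngle Γ v a c) :
    ccwAngle Γ v b c = ccwAngle Γ v a c - ccwAngle Γ v a b := by
  obtain ⟨k, hk⟩ := exists_eq_ccwAngle_add Γ v a b
  obtain ⟨m, hm⟩ := exists_eq_ccwAngle_add Γ v a c
  have h₁ := (ccwAngle_mem_Ico Γ v a b).1
  have h₂ := (ccwAngle_mem_Ico Γ v a c).2
  refine ccwAngle_eq_of_eq_add ⟨by linarith, by linarith⟩ (m - k) ?_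
  push_cast
  linarith

theorem ccwAngle_swap (h : 0 < ccwAngle Γ v a b) :
    ccwAngle Γ v b a = 2 * Real.pi - ccwAngle Γ v a b := by
  obtain ⟨k, hk⟩ := exists_eq_ccwAngle_add Γ v a b
  have h₂ := (ccwAngle_mem_Ico Γ v a b).2
  refine ccwAngle_eq_of_eq_add ⟨by linarith, by linarith⟩ (-1 - k) ?_
  push_cast
  linarith

/-- The entries of the list appear counterclockwise around `v`, starting from the first one.
This is the condition that `RespectsOrder` imposes at `v`. -/
def CcwSorted (Γ : V → ℂ) (v : V) : List V → Prop
  | [] => True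
  | a :: l => (a :: l).Pairwise fun w w' => ccwAngle Γ v a w < ccwAngle Γ v a w'

theorem CcwSorted.concat (h : CcwSorted Γ v (a :: l)) : CcwSorted Γ v (l ++ [a]) := by
  rcases l with _ | ⟨c, l⟩
  · simp [CcwSorted]
  obtain ⟨hfirst, hsorted⟩ := List.pairwise_cons.1 h
  have hle : ∀ w ∈ c :: l, ccwAngle Γ v a c ≤ ccwAngle Γ v a w :=
    List.forall_mem_cons.2 ⟨le_rfl, fun w hw => ((List.pairwise_cons.1 hsorted).1 w hw).le⟩
  have hpos : 0 < ccwAngle Γ v a c := by simpa [ccwAngle_self] using hfirst c (by simp)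
  refine List.pairwise_append.2 ⟨hsorted.imp_of_mem fun hx hy hxy => ?_, by simp, ?_⟩
  · rw [ccwAngle_eq_sub (hle _ hx), ccwAngle_eq_sub (hle _ hy)]
    linarith
  · intro x hx y hy
    rw [List.mem_singleton.1 hy, ccwAngle_eq_sub (hle x hx), ccwAngle_swap hpos]
    linarith [(ccwAngle_mem_Ico Γ v a x).2]

theorem CcwSorted.isRotated (h : CcwSorted Γ v l) (hl : l ~r l') : CcwSorted Γ v l' := by
  obtain ⟨k, rfl⟩ := hl
  induction k with
  | zero => simpa using h
  | succ k ih =>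
    rw [← List.rotate_rotate]
    rcases hk : l.rotate k with _ | ⟨a, l''⟩ <;> rw [hk] at ih
    · simpa using ih
    · simpa using ih.concat

theorem CyclicSucc.isRotated (h : CyclicSucc l a b) (hl : l ~r l') : CyclicSucc l' a b := by
  obtain ⟨k, rfl⟩ := hl
  refine ⟨by simpa using h.1, ?_⟩
  rw [List.rotate_rotate, add_comm, ← List.rotate_rotate, List.zip,
    ← List.zipWith_rotate_distrib _ _ _ _ (by simp), List.mem_rotate]
  exact h.2

theorem CyclicSucc.rel_of_isChain {R : V → V → Prop} (h : CyclicSucc (c :: l) a b)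
    (hR : List.IsChain R (c :: l ++ [c])) : R a b := by
  refine (List.forall₂_iff_zip.1 (List.isChain_cons_append_singleton_iff_forall₂.1 hR)).2 ?_
  simpa using h.2

end CyclicOrder

/-! ### Cone drawings -/

section ConeDrawing

variable {V : Type*} {G : SimpleGraph V} {r u v w a b c : V} {Γ : V → ℂ}

/-- An edge directed from `a` to `b` along which the function `f` increases. For monotone drawings,
`f` is the projection onto a line. -/
def IncreasingEdge (G : SimpleGraph V) (f : V → ℝ) (a b : V) : Prop :=
  G.Adj a b ∧ f a < f b

theorem exists_increasing_walk {f : V → ℝ} (h : Relation.ReflTransGen (IncreasingEdge G f) u v) :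
    ∃ p : G.Walk u v, (p.support.map f).Pairwise (· < ·) := by
  induction h using Relation.ReflTransGen.head_induction_on with
  | refl => exact ⟨.nil, by simp⟩
  | @head a c hac _ ih =>
    obtain ⟨p, hp⟩ := ih
    refine ⟨.cons hac.1 p, ?_⟩
    rw [← List.isChain_iff_pairwise] at hp ⊢
    rw [← p.cons_tail_support] at hp
    rw [SimpleGraph.Walk.support_cons, ← p.cons_tail_support]
    exact hp.cons_cons hac.2

theorem isMonotoneDrawing_of_increasing
    (h : ∀ u v, ∃ d : ℂ, d ≠ 0 ∧
      Relation.ReflTransGen (IncreasingEdge G fun w => inner ℝ d (Γ w)) u v) :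
    IsMonotoneDrawing G Γ := by
  refine ⟨fun u v huv => ?_, fun u v => ?_⟩
  · obtain ⟨d, -, hd⟩ := h u v
    obtain ⟨p, hp⟩ := exists_increasing_walk hd
    cases p with
    | nil => rfl
    | cons _ q =>
      have hlt := (List.pairwise_cons.1 hp).1 _ (List.mem_map_of_mem q.end_mem_support)
      simp [huv] at hlt
  · obtain ⟨d, hd₀, hd⟩ := h u v
    obtain ⟨p, hp⟩ := exists_increasing_walk hd
    exact ⟨p, .mk' (.of_map _ (hp.imp ne_of_lt)), d, hd₀, hp⟩

theorem increasing_neg (d : ℂ)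
    (h : Relation.ReflTransGen (IncreasingEdge G fun w => inner ℝ d (Γ w)) u v) :
    Relation.ReflTransGen (IncreasingEdge G fun w => inner ℝ (-d) (Γ w)) v u := by
  refine Relation.reflTransGen_swap.1 (Relation.ReflTransGen.mono ?_ u v h)
  refine fun a b hab => ⟨hab.1.symm, ?_⟩
  simpa only [inner_neg_left, neg_lt_neg_iff] using hab.2

variable [DecidableEq V]

/-- Drawings in which the edge that enters `v` is a positive multiple of `(1 - t v, 1)` and the
edges of the subtree rooted at `v` have parameters between `lo v` and `hi v`. -/
structure IsConeDrawing (G : SimpleGraph V) (r : V) (ord : V → List V) (Γ : V → ℂ)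
    (t lo hi : V → ℝ) : Prop where
  edge_eq : ∀ u v, IsChild G r u v → ∃ κ : ℝ, 0 < κ ∧ Γ v - Γ u = (κ : ℂ) * ⟨1 - t v, 1⟩
  lo_lt : ∀ v, lo v < t v
  lt_hi : ∀ v, t v < hi v
  lo_le : ∀ u v, IsChild G r u v → lo u ≤ lo v
  hi_le : ∀ u v, IsChild G r u v → hi v ≤ hi u
  siblings : ∀ u, (childList G r ord u).Pairwise fun w w' => hi w ≤ lo w'
  first_le : ∀ u, u ≠ r → ∀ c ∈ (childList G r ord u).head?, t c ≤ t u
  le_last : ∀ u, u ≠ r → ∀ c ∈ (childList G r ord u).getLast?, t u ≤ t c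

namespace IsConeDrawing

open Real

variable {ord : V → List V} {t lo hi : V → ℝ}

theorem lo_lt_of_inSubtree (h : IsConeDrawing G r ord Γ t lo hi) (hv : InSubtree G r c v) :
    lo c < t v := by
  suffices hle : lo c ≤ lo v from hle.trans_lt (h.lo_lt v)
  induction hv with
  | refl => exact le_rfl
  | tail _ hab ih => exact ih.trans (h.lo_le _ _ hab)

theorem lt_hi_of_inSubtree (h : IsConeDrawing G r ord Γ t lo hi) (hv : InSubtree G r c v) :
    t v < hi c := by
  suffices hle : hi v ≤ hi c from (h.lt_hi v).trans_le hle
  induction hv with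
  | refl => exact le_rfl
  | tail _ hab ih => exact (h.hi_le _ _ hab).trans ih

theorem increasingEdge (h : IsConeDrawing G r ord Γ t lo hi) (hab : IsChild G r a b) {d : ℂ}
    (hd : 0 < d.re * (1 - t b) + d.im) :
    IncreasingEdge G (fun w => inner ℝ d (Γ w)) a b := by
  obtain ⟨κ, hκ, hedge⟩ := h.edge_eq a b hab
  refine ⟨hab.1, sub_pos.1 ?_⟩
  have hinner : inner ℝ d (Γ b) - inner ℝ d (Γ a) = κ * (d.re * (1 - t b) + d.im) := by
    rw [← inner_sub_right, hedge, Complex.inner]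
    simp
    ring
  exact hinner ▸ mul_pos hκ hd

theorem increasing_of_inSubtree (h : IsConeDrawing G r ord Γ t lo hi) (hv : InSubtree G r c v)
    {d : ℂ} (hd : ∀ x, InSubtree G r c x → 0 < d.re * (1 - t x) + d.im) :
    Relation.ReflTransGen (IncreasingEdge G fun w => inner ℝ d (Γ w)) c v := by
  induction hv with
  | refl => exact .refl
  | tail hca hab ih => exact ih.tail (h.increasingEdge hab (hd _ (hca.tail hab)))

theorem increasing_of_branching (h : IsConeDrawing G r ord Γ t lo hi) {c₁ c₂ : V}
    (hc₁ : IsChild G r w c₁) (hc₂ : IsChild G r w c₂) (hu : InSubtree G r c₁ u)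
    (hv : InSubtree G r c₂ v) (hle : hi c₁ ≤ lo c₂) :
    ∃ d : ℂ, d ≠ 0 ∧ Relation.ReflTransGen (IncreasingEdge G fun w => inner ℝ d (Γ w)) u v := by
  -- An edge with parameter `t` projects onto `d` with length a positive multiple of `t - hi c₁`.
  let d : ℂ := ⟨-1, 1 - hi c₁⟩
  have hdown : ∀ x, InSubtree G r c₂ x → 0 < d.re * (1 - t x) + d.im := fun x hx => by
    have := h.lo_lt_of_inSubtree hx
    simp only [d]
    linarith
  have hup : ∀ x, InSubtree G r c₁ x → 0 < (-d).re * (1 - t x) + (-d).im := fun x hx => by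
    have := h.lt_hi_of_inSubtree hx
    simp only [d, Complex.neg_re, Complex.neg_im]
    linarith
  have hwu := (h.increasing_of_inSubtree hu hup).head (h.increasingEdge hc₁ (hup c₁ .refl))
  have hwv := (h.increasing_of_inSubtree hv hdown).head (h.increasingEdge hc₂ (hdown c₂ .refl))
  refine ⟨d, fun h₀ => ?_, ?_⟩
  · simpa [d] using congrArg Complex.re h₀
  · have huw := increasing_neg (-d) hwu
    rw [neg_neg] at huw
    exact huw.trans hwv

theorem siblings_or (h : IsConeDrawing G r ord Γ t lo hi) (hT : IsOrderedTree G ord) {c₁ c₂ : V}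
    (hc₁ : IsChild G r w c₁) (hc₂ : IsChild G r w c₂) (hne : c₁ ≠ c₂) :
    hi c₁ ≤ lo c₂ ∨ hi c₂ ≤ lo c₁ := by
  have : Std.Symm fun a b => hi a ≤ lo b ∨ hi b ≤ lo a := ⟨fun _ _ => Or.symm⟩
  exact ((h.siblings w).imp (S := fun a b => hi a ≤ lo b ∨ hi b ≤ lo a) Or.inl).forall
    (hT.mem_childList.2 hc₁) (hT.mem_childList.2 hc₂) hne

theorem isMonotoneDrawing (h : IsConeDrawing G r ord Γ t lo hi) (hT : IsOrderedTree G ord) :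
    IsMonotoneDrawing G Γ := by
  refine isMonotoneDrawing_of_increasing fun u v => ?_
  have reverse : ∀ {u v},
      (∃ d : ℂ, d ≠ 0 ∧ Relation.ReflTransGen (IncreasingEdge G fun w => inner ℝ d (Γ w)) v u) →
      ∃ d : ℂ, d ≠ 0 ∧ Relation.ReflTransGen (IncreasingEdge G fun w => inner ℝ d (Γ w)) u v :=
    fun ⟨d, hd₀, hd⟩ => ⟨-d, neg_ne_zero.2 hd₀, increasing_neg d hd⟩
  rcases inSubtree_or_exists_branching hT.isTree.connected r u v with
    huv | hvu | ⟨w, c₁, c₂, hne, hc₁, hc₂, hu, hv⟩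
  · exact ⟨Complex.I, Complex.I_ne_zero, h.increasing_of_inSubtree huv (by simp)⟩
  · exact reverse ⟨Complex.I, Complex.I_ne_zero, h.increasing_of_inSubtree hvu (by simp)⟩
  · rcases h.siblings_or hT hc₁ hc₂ hne with hle | hle
    · exact h.increasing_of_branching hc₁ hc₂ hu hv hle
    · exact reverse (h.increasing_of_branching hc₂ hc₁ hv hu hle)

theorem arg_child (h : IsConeDrawing G r ord Γ t lo hi) (hv : IsChild G r u v) :
    (Γ v - Γ u).arg = slopeAngle (t v) := by
  obtain ⟨κ, hκ, hedge⟩ := h.edge_eq u v hv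
  rw [hedge, arg_eq_slopeAngle hκ]

theorem arg_parent (h : IsConeDrawing G r ord Γ t lo hi) (hv : IsChild G r u v) :
    (Γ u - Γ v).arg = slopeAngle (t v) - π := by
  rw [← h.arg_child hv, ← neg_sub (Γ v)]
  apply Complex.arg_neg_eq_arg_sub_pi_of_im_pos
  obtain ⟨κ, hκ, hedge⟩ := h.edge_eq u v hv
  simpa [hedge] using hκ

theorem slope_eq (h : IsConeDrawing G r ord Γ t lo hi) (hv : IsChild G r u v) :
    slope Γ u v = slopeAngle (t v) := by
  obtain ⟨hpos, hlt⟩ := slopeAngle_mem_Ioo (t v)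
  rw [slope, h.arg_child hv, toIcoMod_eq_self, zero_add]
  exact ⟨hpos.le, by linarith⟩

theorem isNonStrictlySlopeDisjoint (h : IsConeDrawing G r ord Γ t lo hi)
    (hT : IsOrderedTree G ord) : IsNonStrictlySlopeDisjoint G r Γ := by
  have hlt : ∀ u, slopeAngle (lo u) < slopeAngle (hi u) := fun u =>
    slopeAngle_strictMono ((h.lo_lt u).trans (h.lt_hi u))
  have hslope : ∀ u v w, IsChild G r w v → InSubtree G r u v →
      slope Γ w v ∈ Set.Ioo (slopeAngle (lo u)) (slopeAngle (hi u)) := fun u v w hwv huv => by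
    rw [h.slope_eq hwv]
    exact ⟨slopeAngle_strictMono (h.lo_lt_of_inSubtree huv),
      slopeAngle_strictMono (h.lt_hi_of_inSubtree huv)⟩
  have hmono := slopeAngle_strictMono.monotone
  refine ⟨fun u => slopeAngle (lo u), fun u => slopeAngle (hi u), fun u => ?_,
    fun u v huv => ?_, fun p u₁ u₂ h₁ h₂ hne => ?_⟩
  · exact ⟨(slopeAngle_mem_Ioo _).1.le, hlt u, (slopeAngle_mem_Ioo _).2.le,
      fun w z huw hwz => hslope u z w hwz (huw.tail hwz), fun p hp => hslope u u p hp .refl⟩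
  · exact ⟨hmono (h.lo_le u v huv), hlt v, hmono (h.hi_le u v huv)⟩
  · exact (h.siblings_or hT h₁ h₂ hne).imp (fun hle => ⟨hlt _, hmono hle, hlt _⟩)
      fun hle => ⟨hlt _, hmono hle, hlt _⟩

theorem ccwAngle_children (h : IsConeDrawing G r ord Γ t lo hi) (ha : IsChild G r v a)
    (hb : IsChild G r v b) (hle : t a ≤ t b) :
    ccwAngle Γ v a b = slopeAngle (t b) - slopeAngle (t a) := by
  have hle' := slopeAngle_strictMono.monotone hle
  have hpos := (slopeAngle_mem_Ioo (t a)).1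
  have hlt := (slopeAngle_mem_Ioo (t b)).2
  refine ccwAngle_eq_of_eq_add ⟨by linarith, by linarith⟩ 0 ?_
  simp [h.arg_child ha, h.arg_child hb]

theorem ccwAngle_parent_child (h : IsConeDrawing G r ord Γ t lo hi) (hv : IsChild G r u v)
    (hw : IsChild G r v w) : ccwAngle Γ v u w = slopeAngle (t w) - slopeAngle (t v) + π := by
  obtain ⟨hv₁, hv₂⟩ := slopeAngle_mem_Ioo (t v)
  obtain ⟨hw₁, hw₂⟩ := slopeAngle_mem_Ioo (t w)
  refine ccwAngle_eq_of_eq_add ⟨by linarith, by linarith⟩ 0 ?_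
  rw [h.arg_parent hv, h.arg_child hw]
  simp
  ring

theorem ccwAngle_child_parent (h : IsConeDrawing G r ord Γ t lo hi) (hv : IsChild G r u v)
    (hw : IsChild G r v w) : ccwAngle Γ v w u = slopeAngle (t v) - slopeAngle (t w) + π := by
  obtain ⟨hv₁, hv₂⟩ := slopeAngle_mem_Ioo (t v)
  obtain ⟨hw₁, hw₂⟩ := slopeAngle_mem_Ioo (t w)
  refine ccwAngle_eq_of_eq_add ⟨by linarith, by linarith⟩ (-1) ?_
  rw [h.arg_parent hv, h.arg_child hw]
  push_cast
  ring

theorem pairwise_childList (h : IsConeDrawing G r ord Γ t lo hi) (u : V) :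
    (childList G r ord u).Pairwise fun w w' => t w < t w' :=
  (h.siblings u).imp fun {a b} hab => (h.lt_hi a).trans_le (hab.trans (h.lo_lt b).le)

theorem ccwSorted_childList (h : IsConeDrawing G r ord Γ t lo hi) (hT : IsOrderedTree G ord)
    (v : V) : CcwSorted Γ v (childList G r ord v) := by
  have hchild : ∀ w ∈ childList G r ord v, IsChild G r v w := fun w => hT.mem_childList.1
  have hsorted := h.pairwise_childList v
  rcases hl : childList G r ord v with _ | ⟨a, l⟩
  · trivial
  rw [hl] at hchild hsorted
  have hle : ∀ w ∈ a :: l, t a ≤ t w :=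
    List.forall_mem_cons.2 ⟨le_rfl, fun w hw => ((List.pairwise_cons.1 hsorted).1 w hw).le⟩
  refine hsorted.imp_of_mem fun {x y} hx hy hxy => ?_
  have ha := hchild a List.mem_cons_self
  rw [h.ccwAngle_children ha (hchild x hx) (hle x hx),
    h.ccwAngle_children ha (hchild y hy) (hle y hy)]
  exact sub_lt_sub_right (slopeAngle_strictMono hxy) _

theorem ccwSorted_parent_cons (h : IsConeDrawing G r ord Γ t lo hi) (hT : IsOrderedTree G ord)
    (hv : IsChild G r u v) : CcwSorted Γ v (u :: childList G r ord v) := by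
  refine List.pairwise_cons.2 ⟨fun w hw => ?_, ?_⟩
  · rw [ccwAngle_self, h.ccwAngle_parent_child hv (hT.mem_childList.1 hw)]
    linarith [(slopeAngle_mem_Ioo (t v)).2, (slopeAngle_mem_Ioo (t w)).1]
  · refine (h.pairwise_childList v).imp_of_mem fun {x y} hx hy hxy => ?_
    rw [h.ccwAngle_parent_child hv (hT.mem_childList.1 hx),
      h.ccwAngle_parent_child hv (hT.mem_childList.1 hy)]
    linarith [slopeAngle_strictMono hxy]

theorem respectsOrder (h : IsConeDrawing G r ord Γ t lo hi) (hT : IsOrderedTree G ord) :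
    RespectsOrder ord Γ := by
  intro v a l hl
  suffices hs : CcwSorted Γ v (ord v) by rwa [hl] at hs
  by_cases hv : v = r
  · rw [hv, ← hT.childList_root (r := r)]
    exact h.ccwSorted_childList hT r
  · exact (h.ccwSorted_parent_cons hT (isChild_parent hT.isTree.connected hv)).isRotated
      (hT.isRotated_ord hv)

theorem isChain_childList (h : IsConeDrawing G r ord Γ t lo hi) (hT : IsOrderedTree G ord)
    (v : V) : (childList G r ord v).IsChain fun a b => ccwAngle Γ v a b ∈ Set.Ioc 0 π := by
  refine ((h.pairwise_childList v).imp_of_mem fun {a b} ha hb hab => ?_).isChain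
  rw [h.ccwAngle_children (hT.mem_childList.1 ha) (hT.mem_childList.1 hb) hab.le]
  have := slopeAngle_strictMono hab
  have := (slopeAngle_mem_Ioo (t a)).1
  have := (slopeAngle_mem_Ioo (t b)).2
  exact ⟨by linarith, by linarith⟩

theorem isChain_parent_cons (h : IsConeDrawing G r ord Γ t lo hi) (hT : IsOrderedTree G ord)
    (hv : IsChild G r u v) (hne : childList G r ord v ≠ []) :
    (u :: childList G r ord v ++ [u]).IsChain fun a b => ccwAngle Γ v a b ∈ Set.Ioc 0 π := by
  have hfirst : ∀ c ∈ (childList G r ord v).head?, ccwAngle Γ v u c ∈ Set.Ioc 0 π := by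
    intro c hc
    rw [h.ccwAngle_parent_child hv (hT.mem_childList.1 (List.mem_of_mem_head? hc))]
    have := slopeAngle_strictMono.monotone (h.first_le v hv.ne_root c hc)
    have := (slopeAngle_mem_Ioo (t v)).2
    have := (slopeAngle_mem_Ioo (t c)).1
    exact ⟨by linarith, by linarith⟩
  have hlast : ∀ c ∈ (childList G r ord v).getLast?, ccwAngle Γ v c u ∈ Set.Ioc 0 π := by
    intro c hc
    rw [h.ccwAngle_child_parent hv (hT.mem_childList.1 (List.mem_of_mem_getLast? hc))]
    have := slopeAngle_strictMono.monotone (h.le_last v hv.ne_root c hc)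
    have := (slopeAngle_mem_Ioo (t v)).1
    have := (slopeAngle_mem_Ioo (t c)).2
    exact ⟨by linarith, by linarith⟩
  refine List.isChain_append.2
    ⟨List.isChain_cons.2 ⟨hfirst, h.isChain_childList hT v⟩, by simp, fun x hx y hy => ?_⟩
  obtain rfl : u = y := by simpa using hy
  exact hlast x (by rwa [List.getLast?_cons_of_ne_nil hne] at hx)

theorem isNearConvexMonotone (h : IsConeDrawing G r ord Γ t lo hi) (hT : IsOrderedTree G ord) :
    IsNearConvexMonotone G r ord Γ := by
  refine ⟨h.isMonotoneDrawing hT, h.respectsOrder hT,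
    ((ord r).getLastD r, (ord r).headD r), fun v w w' hsucc => ?_⟩
  by_cases hv : v = r
  · subst hv
    have hchain := h.isChain_childList hT v
    rw [hT.childList_root] at hchain
    rcases hl : ord v with _ | ⟨a, l⟩ <;> rw [hl] at hsucc hchain
    · simp [CyclicSucc] at hsucc
    refine hsucc.rel_of_isChain
      (R := fun w w' => (v = v ∧ (w, w') = _) ∨ ccwAngle Γ v w w' ∈ Set.Ioc 0 π) ?_
    refine List.isChain_append.2 ⟨hchain.imp fun _ _ => .inr, by simp, fun x hx y hy => .inl ?_⟩
    simp_all [List.getLastD_eq_getLast?]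
  · have hp := isChild_parent hT.isTree.connected hv
    replace hsucc := hsucc.isRotated (hT.isRotated_ord hv).symm
    have hne : childList G r ord v ≠ [] := by
      rintro h₀
      simpa [h₀] using hsucc.1
    exact .inr (hsucc.rel_of_isChain (h.isChain_parent_cons hT hp hne))

end IsConeDrawing

end ConeDrawing

/-! ### Placements -/

theorem convex_secondOctant : Convex ℝ secondOctant := by
  rintro x ⟨hx1, hx2⟩ y ⟨hy1, hy2⟩ a b ha hb -
  refine ⟨?_, ?_⟩ <;>
    simp only [Complex.add_re, Complex.add_im, Complex.smul_re, Complex.smul_im, smul_eq_mul]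
  · positivity
  · gcongr

theorem drawnSet_subset_secondOctant {V : Type*} {G : SimpleGraph V} {Γ : V → ℂ}
    (h : ∀ v, Γ v ∈ secondOctant) : drawnSet G Γ ⊆ secondOctant := by
  rintro z (⟨v, rfl⟩ | hz)
  · exact h v
  · simp only [Set.mem_iUnion] at hz
    obtain ⟨u, v, -, hz⟩ := hz
    exact convex_secondOctant.segment_subset (h u) (h v) hz

/-- The fraction `j / k` lies in the interval `[l / N, h / N)`; stated without divisions, this is
the test made by the algorithm. -/
def FractionMem (N l h j k : ℕ) : Prop :=
  l * k ≤ j * N ∧ j * N < h * k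

instance (N l h j k : ℕ) : Decidable (FractionMem N l h j k) :=
  inferInstanceAs (Decidable (_ ∧ _))

namespace FractionMem

variable {N l h j k : ℕ}

theorem pos (hm : FractionMem N l h j k) : 0 < k :=
  Nat.pos_of_ne_zero fun hk => by simp [hk, FractionMem] at hm

theorem lt_denominator (hm : FractionMem N l h j k) (hN : h ≤ N) : j < k := by
  have : j * N < k * N := hm.2.trans_le (by rw [mul_comm]; gcongr)
  exact lt_of_mul_lt_mul_right this N.zero_le

theorem div_le (hm : FractionMem N l h j k) (hN : 0 < N) : (l : ℝ) / N ≤ j / k := by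
  have := hm.pos
  rw [div_le_div_iff₀ (by positivity) (by positivity)]
  exact_mod_cast hm.1

theorem lt_div (hm : FractionMem N l h j k) (hN : 0 < N) : (j : ℝ) / k < h / N := by
  have := hm.pos
  rw [div_lt_div_iff₀ (by positivity) (by positivity)]
  exact_mod_cast hm.2

theorem add_inv_lt_div (hm : FractionMem N l h j k) (hN : 0 < N) {m : ℕ} (hk : k < m) :
    (j : ℝ) / k + 1 / (m * N) < h / N := by
  have := hm.pos
  have hstep : (j : ℝ) * N + 1 ≤ h * k := by exact_mod_cast hm.2
  calc (j : ℝ) / k + 1 / (m * N) < j / k + 1 / (k * N) := by gcongr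
    _ = (j * N + 1) / (k * N) := by field_simp
    _ ≤ h * k / (k * N) := by gcongr
    _ = h / N := by field_simp

theorem ceilDiv (hN : 0 < N) (hlh : l < h) :
    FractionMem N l h ((N ⌈/⌉ (h - l)) * l ⌈/⌉ N) (N ⌈/⌉ (h - l)) := by
  set k := N ⌈/⌉ (h - l)
  have hk : N ≤ (h - l) * k := by simpa using le_smul_ceilDiv (b := N) (Nat.sub_pos_of_lt hlh)
  have hj : k * l ≤ N * (k * l ⌈/⌉ N) := by simpa using le_smul_ceilDiv (b := k * l) hN
  have hj' : (k * l ⌈/⌉ N) * N < k * l + N := by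
    rw [Nat.ceilDiv_eq_add_pred_div]
    have := Nat.div_mul_le_self (k * l + N - 1) N
    omega
  refine ⟨by linarith, hj'.trans_le ?_⟩
  calc k * l + N ≤ k * l + (h - l) * k := by gcongr
    _ = h * k := by rw [mul_comm k, ← add_mul, Nat.add_sub_cancel' hlh.le]

end FractionMem

theorem ceilDiv_mul_lt {N w : ℕ} (hw : 0 < w) : (N ⌈/⌉ w) * w < N + w := by
  rw [Nat.ceilDiv_eq_add_pred_div]
  have := Nat.div_mul_le_self (N + w - 1) w
  omega

/-- Placement of a vertex: the interval `[lo / N, hi / N)` reserved for its subtree (the common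
denominator `N` is a parameter of the construction), the vector `(k - j, k)` of the edge entering it
and its position `(x, y)`. -/
structure Placement where
  lo : ℕ
  hi : ℕ
  j : ℕ
  k : ℕ
  x : ℕ
  y : ℕ

namespace Placement

/-- The vertex as a point of the plane. -/
noncomputable def point (p : Placement) : ℂ := ⟨p.x, p.y⟩

/-- The chosen fraction `j / k`; the edge entering the vertex has the direction of
`(1 - j / k, 1)`. -/
noncomputable def fraction (p : Placement) : ℝ := p.j / p.k

variable {N : ℕ} {K : ℝ} {p : Placement} {off sz S : ℕ}

/-- The end of the first `off` parts of the interval of `p`, divided into `S` parts. -/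
def split (p : Placement) (S off : ℕ) : ℕ :=
  p.lo + (p.hi - p.lo) * off / S

theorem split_zero (p : Placement) (S : ℕ) : p.split S 0 = p.lo := by
  simp [split]

theorem split_self (hp : p.lo ≤ p.hi) (hS : 0 < S) : p.split S S = p.hi := by
  rw [split, Nat.mul_div_cancel _ hS, Nat.add_sub_cancel' hp]

theorem split_mono (p : Placement) (S : ℕ) : Monotone (p.split S) := fun a b hab => by
  unfold split
  gcongr

theorem split_mem_Icc (hp : p.lo ≤ p.hi) (h : off ≤ S) : p.split S off ∈ Set.Icc p.lo p.hi := by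
  refine ⟨Nat.le_add_right _ _, ?_⟩
  have : (p.hi - p.lo) * off / S ≤ p.hi - p.lo :=
    Nat.div_le_of_le_mul (by rw [mul_comm S]; gcongr)
  unfold split
  omega

/-- Numerator and denominator of the fraction chosen in `[l / N, h / N)`: the given fraction
`j / k` if possible, otherwise one whose denominator is the least that the width of the interval
warrants. -/
def chooseFraction (N l h j k : ℕ) : ℕ × ℕ :=
  if FractionMem N l h j k then (j, k) else ((N ⌈/⌉ (h - l)) * l ⌈/⌉ N, N ⌈/⌉ (h - l))

/-- The child of a vertex placed at `p` whose interval is `[l / N, h / N)`. -/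
def extend (N : ℕ) (p : Placement) (l h : ℕ) : Placement :=
  let f := chooseFraction N l h p.j p.k
  ⟨l, h, f.1, f.2, p.x + f.2 - f.1, p.y + f.2⟩

/-- Placement of a child of a vertex placed at `p`, where `sz` of the `S` proper descendants of the
vertex belong to the subtree of the child and `off` to those of the preceding children. -/
def step (N : ℕ) (p : Placement) (off sz S : ℕ) : Placement :=
  p.extend N (p.split S off) (p.split S (off + sz))

theorem extend_fraction_of_mem {l h : ℕ} (hm : FractionMem N l h p.j p.k) :
    (p.extend N l h).j = p.j ∧ (p.extend N l h).k = p.k := by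
  simp [extend, chooseFraction, hm]

theorem fractionMem_extend (p : Placement) {l h : ℕ} (hN : 0 < N) (hlh : l < h) :
    FractionMem N l h (p.extend N l h).j (p.extend N l h).k := by
  simp only [extend, chooseFraction]
  split_ifs with hm
  · exact hm
  · exact .ceilDiv hN hlh

/-- Length of the interval in excess of the square of the number of vertices of the subtree, which
compensates for the rounding in `split`. -/
def slack (p : Placement) (sz : ℕ) : ℝ :=
  p.hi - p.lo - sz ^ 2

/-- Upper bound for the heights of the vertices of a subtree that has `sz` vertices and whose root
is placed at `p`. -/
noncomputable def potential (N : ℕ) (p : Placement) (sz : ℕ) : ℝ :=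
  p.y + 2 * N * (sz - 1) / p.slack sz

/-- Invariant of the placement of the root of a subtree that has `sz` vertices, in a drawing of
height less than `K`. -/
structure Admissible (N : ℕ) (K : ℝ) (sz : ℕ) (p : Placement) : Prop where
  sz_pos : 1 ≤ sz
  slack_pos : 0 < p.slack sz
  hi_le : p.hi ≤ N
  fractionMem : FractionMem N p.lo p.hi p.j p.k
  k_mul_lt : p.k * (p.hi - p.lo) < N + (p.hi - p.lo)
  k_le : p.k ≤ p.y + 1
  x_le : p.x ≤ p.y
  potential_lt : p.potential N sz < K

theorem lo_lt_hi_of_slack_pos (h : 0 < p.slack sz) : p.lo < p.hi := by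
  have : (0 : ℝ) ≤ sz ^ 2 := by positivity
  have : (p.lo : ℝ) < p.hi := by unfold slack at h; linarith
  exact_mod_cast this

theorem slack_mul_le (hp : p.lo ≤ p.hi) (hsz : 1 ≤ sz) (hS : off + sz ≤ S) :
    p.slack (S + 1) * sz ≤ (p.step N off sz S).slack sz * S := by
  obtain ⟨w, hw⟩ := Nat.exists_eq_add_of_le hp
  have hlo : (w * off / S : ℕ) * (S : ℝ) ≤ w * off := by
    exact_mod_cast Nat.div_mul_le_self (w * off) S
  have hhi : (w : ℝ) * (off + sz) < ((w * (off + sz) / S : ℕ) + 1) * S := by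
    have := Nat.lt_div_mul_add (a := w * (off + sz)) (b := S) (by omega)
    rw [← Nat.succ_mul] at this
    exact_mod_cast this
  have hszS : (sz : ℝ) ≤ S := by exact_mod_cast (by omega : sz ≤ S)
  have hsz1 : (1 : ℝ) ≤ sz := by exact_mod_cast hsz
  have hround : (S : ℝ) + sz ^ 2 * S ≤ (S + 1) ^ 2 * sz := by
    nlinarith [mul_nonneg (by positivity : (0 : ℝ) ≤ sz * S) (sub_nonneg.2 hszS),
      mul_nonneg (by positivity : (0 : ℝ) ≤ S) (sub_nonneg.2 hsz1)]
  simp only [slack, step, extend, split, hw, Nat.add_sub_cancel_left]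
  push_cast
  linarith

theorem slack_step_pos (hp : 0 < p.slack (S + 1)) (hsz : 1 ≤ sz) (hS : off + sz ≤ S) :
    0 < (p.step N off sz S).slack sz := by
  have hsz' : (0 : ℝ) < sz := by exact_mod_cast hsz
  exact pos_of_mul_pos_left ((mul_pos hp hsz').trans_le
    (slack_mul_le (lo_lt_hi_of_slack_pos hp).le hsz hS)) (by positivity)

namespace Admissible

variable (h : p.Admissible N K sz)
include h

theorem lo_lt_hi : p.lo < p.hi :=
  lo_lt_hi_of_slack_pos h.slack_pos

theorem pos : 0 < N :=
  Nat.zero_lt_of_lt (h.lo_lt_hi.trans_le h.hi_le)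

theorem j_lt : p.j < p.k :=
  h.fractionMem.lt_denominator h.hi_le

theorem y_lt : (p.y : ℝ) < K := by
  have hsz : (1 : ℝ) ≤ sz := by exact_mod_cast h.sz_pos
  have : 0 ≤ 2 * N * ((sz : ℝ) - 1) / p.slack sz :=
    div_nonneg (mul_nonneg (by positivity) (by linarith)) h.slack_pos.le
  have := h.potential_lt
  unfold potential at this
  linarith

theorem k_le_div : (p.k : ℝ) ≤ 2 * N / p.slack sz := by
  have hlt : (p.k : ℝ) * (p.hi - p.lo) < N + (p.hi - p.lo) := by
    have := h.k_mul_lt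
    rify [h.lo_lt_hi.le] at this
    exact this
  have hhi : (p.hi : ℝ) ≤ N := by exact_mod_cast h.hi_le
  have hsq : (0 : ℝ) ≤ p.k * sz ^ 2 := by positivity
  rw [le_div_iff₀ h.slack_pos, slack]
  linarith [Nat.cast_nonneg (α := ℝ) p.lo]

end Admissible

theorem k_extend_mul_lt {l h : ℕ} (hp : p.k * (p.hi - p.lo) < N + (p.hi - p.lo)) (hk : 0 < p.k)
    (hl : p.lo ≤ l) (hlh : l < h) (hh : h ≤ p.hi) :
    (p.extend N l h).k * (h - l) < N + (h - l) := by
  simp only [extend, chooseFraction]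
  split_ifs
  · obtain ⟨e, he⟩ : ∃ e, p.hi - p.lo = (h - l) + e := ⟨p.hi - p.lo - (h - l), by omega⟩
    rw [he, mul_add] at hp
    have : e ≤ p.k * e := Nat.le_mul_of_pos_left e hk
    simp only
    omega
  · exact ceilDiv_mul_lt (by omega)

theorem potential_step_le (hp : 0 < p.slack (S + 1)) (hsz : 1 ≤ sz) (hS : off + sz ≤ S)
    (hk : ((p.step N off sz S).k : ℝ) ≤ 2 * N / (p.step N off sz S).slack sz) :
    (p.step N off sz S).potential N sz ≤ p.potential N (S + 1) := by
  have hslack := slack_mul_le (N := N) (lo_lt_hi_of_slack_pos hp).le hsz hS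
  have hpos := slack_step_pos (N := N) hp hsz hS
  have hy : (p.step N off sz S).y = p.y + (p.step N off sz S).k := rfl
  generalize p.step N off sz S = q at *
  calc q.potential N sz
      = p.y + (q.k - 2 * N / q.slack sz) + 2 * N * sz / q.slack sz := by
        rw [potential, hy]
        push_cast
        ring
    _ ≤ p.y + 0 + 2 * N * S / p.slack (S + 1) := by
        refine add_le_add (add_le_add_right (sub_nonpos.2 hk) _) ?_
        rw [div_le_div_iff₀ hpos hp]
        have := mul_le_mul_of_nonneg_left hslack (by positivity : (0 : ℝ) ≤ 2 * N)
        linarith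
    _ = p.potential N (S + 1) := by
        rw [potential]
        push_cast
        ring

theorem Admissible.step (hp : p.Admissible N K (S + 1)) (hsz : 1 ≤ sz) (hS : off + sz ≤ S) :
    (p.step N off sz S).Admissible N K sz := by
  have hlo := split_mem_Icc hp.lo_lt_hi.le (show off ≤ S by omega)
  have hhi := split_mem_Icc hp.lo_lt_hi.le hS
  have hslack := slack_step_pos (N := N) hp.slack_pos hsz hS
  have hlt := lo_lt_hi_of_slack_pos hslack
  have hmem := p.fractionMem_extend hp.pos hlt
  have hx := hp.x_le
  have hk := k_extend_mul_lt hp.k_mul_lt hp.fractionMem.pos hlo.1 hlt hhi.2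
  suffices ∀ K, (p.step N off sz S).potential N sz < K → (p.step N off sz S).Admissible N K sz
    from this K ((potential_step_le hp.slack_pos hsz hS
      (this _ (lt_add_one _)).k_le_div).trans_lt hp.potential_lt)
  refine fun K hK => ⟨hsz, hslack, hhi.2.trans hp.hi_le, hmem, hk, ?_, ?_, hK⟩ <;>
    simp only [Placement.step, extend] <;> omega

/-- Placement of the root. -/
def root (N : ℕ) : Placement := ⟨0, N, 0, 1, 0, 0⟩

theorem admissible_root {n : ℕ} (hn : 1 ≤ n) (hN : n ^ 3 < N) :
    (root N).Admissible N (2 * n) n := by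
  have hN' : (n : ℝ) ^ 3 < N := by exact_mod_cast hN
  have hsq : (n : ℝ) ^ 2 ≤ n ^ 3 := by exact_mod_cast Nat.pow_le_pow_right hn (by norm_num)
  have hslack : (root N).slack n = N - n ^ 2 := by simp [slack, root]
  refine ⟨hn, by rw [hslack]; linarith, le_rfl, ?_, ?_, ?_, ?_, ?_⟩
  · simp only [FractionMem, root]
    omega
  · simp only [root]
    omega
  · simp [root]
  · simp [root]
  · rw [potential, hslack, root, Nat.cast_zero, zero_add, div_lt_iff₀ (by linarith)]
    linarith

end Placement

section DrawingOfTree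

variable {V : Type*} [Fintype V] [DecidableEq V] {G : SimpleGraph V} {r u v w : V}
  {ord : V → List V} {N : ℕ}

/-- Number of vertices of the subtrees of the siblings that precede `v`. -/
noncomputable def siblingOffset (G : SimpleGraph V) (r : V) (ord : V → List V) (v : V) : ℕ :=
  (((childList G r ord (parent G r v)).takeWhile (· ≠ v)).map (subtreeSize G r)).sum

/-- Placement of a vertex of depth `d`. -/
noncomputable def placementAux (G : SimpleGraph V) (r : V) (ord : V → List V) (N : ℕ) :
    ℕ → V → Placement
  | 0, _ => .root N
  | d + 1, v => (placementAux G r ord N d (parent G r v)).step N (siblingOffset G r ord v)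
      (subtreeSize G r v) (subtreeSize G r (parent G r v) - 1)

/-- Placement of a vertex, computed from the root downwards. -/
noncomputable def placement (G : SimpleGraph V) (r : V) (ord : V → List V) (N : ℕ) (v : V) :
    Placement :=
  placementAux G r ord N (G.dist r v) v

/-- The drawing given by the positions in `placement`. -/
noncomputable def treeDrawing (G : SimpleGraph V) (r : V) (ord : V → List V) (N : ℕ) : V → ℂ :=
  fun v => (placement G r ord N v).point

theorem placement_root : placement G r ord N r = .root N := by
  simp [placement, placementAux]

namespace IsOrderedTree

variable (hT : IsOrderedTree G ord)
include hT

theorem siblingOffset_eq {pre post : List V} (h : childList G r ord u = pre ++ w :: post) :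
    siblingOffset G r ord w = (pre.map (subtreeSize G r)).sum := by
  have hw : IsChild G r u w := hT.mem_childList.1 (by simp [h])
  have hnd := hT.nodup_childList (r := r) (u := u)
  rw [h] at hnd
  rw [siblingOffset, hw.parent_eq hT.isTree, h, List.takeWhile_append_of_pos]
  · simp
  · intro a ha
    have : a ≠ w := fun haw => List.disjoint_of_nodup_append hnd ha (by simp [haw])
    simpa using this

theorem siblingOffset_add_le (h : IsChild G r u v) :
    siblingOffset G r ord v + subtreeSize G r v ≤ subtreeSize G r u - 1 := by
  obtain ⟨pre, post, hl⟩ := List.append_of_mem (hT.mem_childList.2 h)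
  have hsum := hT.subtreeSize_eq r u
  rw [hT.siblingOffset_eq hl]
  simp only [hl, List.map_append, List.map_cons, List.sum_append, List.sum_cons] at hsum
  omega

theorem placement_child (h : IsChild G r u v) :
    placement G r ord N v = (placement G r ord N u).step N (siblingOffset G r ord v)
      (subtreeSize G r v) (subtreeSize G r u - 1) := by
  rw [placement, h.2, placementAux, h.parent_eq hT.isTree, placement]

theorem pairwise_childList_placement (u : V) : (childList G r ord u).Pairwise fun v w =>
    (placement G r ord N v).hi ≤ (placement G r ord N w).lo := by
  have hoffset {i : ℕ} (hi : i < (childList G r ord u).length) :=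
    hT.siblingOffset_eq (u := u) (pre := (childList G r ord u).take i)
      (post := (childList G r ord u).drop (i + 1)) (w := (childList G r ord u)[i])
      (by rw [← List.drop_eq_getElem_cons hi, List.take_append_drop])
  rw [List.pairwise_iff_getElem]
  intro i j hi hj hij
  rw [hT.placement_child (hT.mem_childList.1 (List.getElem_mem hi)),
    hT.placement_child (hT.mem_childList.1 (List.getElem_mem hj)), hoffset hi, hoffset hj]
  apply Placement.split_mono
  have := ((List.take_sublist_take_left (l := childList G r ord u) (show i + 1 ≤ j by omega)).map
    (subtreeSize G r)).sum_le_sum (by simp)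
  rwa [List.take_succ_eq_append_getElem hi, List.map_append, List.sum_append, List.map_singleton,
    List.sum_singleton] at this

variable (hN : Fintype.card V ^ 3 < N)
include hN

theorem admissible_placement (r v : V) :
    (placement G r ord N v).Admissible N (2 * Fintype.card V) (subtreeSize G r v) := by
  induction v using induction_on_isChild (r := r) hT.isTree.connected with
  | root =>
    rw [placement_root, subtreeSize_root hT.isTree.connected]
    exact Placement.admissible_root (Fintype.card_pos_iff.2 ⟨r⟩) hN
  | child u v huv ih =>
    rw [hT.placement_child huv]
    refine Placement.Admissible.step ?_ (by rw [hT.subtreeSize_eq]; omega)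
      (hT.siblingOffset_add_le huv)
    rwa [Nat.sub_add_cancel ih.sz_pos]

theorem fractionMem_placement (r v : V) : FractionMem N (placement G r ord N v).lo
    (placement G r ord N v).hi (placement G r ord N v).j (placement G r ord N v).k :=
  (hT.admissible_placement hN r v).fractionMem

theorem y_placement_lt (r v : V) : (placement G r ord N v).y < 2 * Fintype.card V := by
  exact_mod_cast (hT.admissible_placement hN r v).y_lt

theorem k_placement_le (r v : V) : (placement G r ord N v).k ≤ 2 * Fintype.card V :=
  (hT.admissible_placement hN r v).k_le.trans (hT.y_placement_lt hN r v)

theorem placement_interval_subset (h : IsChild G r u v) :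
    (placement G r ord N u).lo ≤ (placement G r ord N v).lo ∧
      (placement G r ord N v).hi ≤ (placement G r ord N u).hi := by
  have hle := (hT.admissible_placement hN r u).lo_lt_hi.le
  have hoff := hT.siblingOffset_add_le h
  rw [hT.placement_child h]
  exact ⟨(Placement.split_mem_Icc hle (by omega)).1, (Placement.split_mem_Icc hle hoff).2⟩

theorem treeDrawing_sub (h : IsChild G r u v) :
    treeDrawing G r ord N v - treeDrawing G r ord N u =
      ((placement G r ord N v).k : ℝ) * (⟨1 - (placement G r ord N v).fraction, 1⟩ : ℂ) := by
  have hk : ((placement G r ord N v).k : ℝ) ≠ 0 := by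
    exact_mod_cast (hT.fractionMem_placement hN r v).pos.ne'
  have hj := (hT.admissible_placement hN r v).j_lt
  have hx : (placement G r ord N v).x =
      (placement G r ord N u).x + (placement G r ord N v).k - (placement G r ord N v).j := by
    rw [hT.placement_child h]
    rfl
  have hy : (placement G r ord N v).y = (placement G r ord N u).y + (placement G r ord N v).k := by
    rw [hT.placement_child h]
    rfl
  rify [show (placement G r ord N v).j ≤
    (placement G r ord N u).x + (placement G r ord N v).k by omega] at hx
  apply Complex.ext
  · simp only [treeDrawing, Placement.point, Placement.fraction, hx, Complex.sub_re,
      Complex.mul_re, Complex.ofReal_re, Complex.ofReal_im, zero_mul, sub_zero]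
    field_simp
    ring
  · simp [treeDrawing, Placement.point, hy]

omit hN in
theorem fraction_placement_eq (h : IsChild G r u v)
    (hm : FractionMem N (placement G r ord N v).lo (placement G r ord N v).hi
      (placement G r ord N u).j (placement G r ord N u).k) :
    (placement G r ord N v).fraction = (placement G r ord N u).fraction := by
  rw [hT.placement_child h] at hm ⊢
  obtain ⟨hj, hk⟩ := Placement.extend_fraction_of_mem hm
  exact congrArg₂ (fun j k : ℕ => (j : ℝ) / k) hj hk

theorem fraction_head?_le (huv : v ∈ (childList G r ord u).head?) :
    (placement G r ord N v).fraction ≤ (placement G r ord N u).fraction := by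
  have hu := hT.fractionMem_placement hN r u
  have hv := hT.fractionMem_placement hN r v
  have hpos := (hT.admissible_placement hN r u).pos
  have hl := List.head?_eq_some_iff.1 huv
  obtain ⟨l, hl⟩ := hl
  have hc := hT.mem_childList.1 (show v ∈ childList G r ord u by simp [hl])
  have hlo : (placement G r ord N v).lo = (placement G r ord N u).lo := by
    rw [hT.placement_child hc, hT.siblingOffset_eq (pre := []) hl]
    exact Placement.split_zero _ _
  by_cases hm : FractionMem N (placement G r ord N v).lo (placement G r ord N v).hi
      (placement G r ord N u).j (placement G r ord N u).k
  · exact (hT.fraction_placement_eq hc hm).le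
  · refine (hv.lt_div hpos).le.trans ?_
    have := hu.pos
    rw [Placement.fraction, div_le_div_iff₀ (by positivity) (by positivity)]
    rw [FractionMem, hlo, not_and, not_lt] at hm
    exact_mod_cast hm hu.1

theorem le_fraction_getLast? (huv : v ∈ (childList G r ord u).getLast?) :
    (placement G r ord N u).fraction ≤ (placement G r ord N v).fraction := by
  have hu := hT.fractionMem_placement hN r u
  have hv := hT.fractionMem_placement hN r v
  have hau := hT.admissible_placement hN r u
  obtain ⟨l, hl⟩ := List.getLast?_eq_some_iff.1 huv
  have hc := hT.mem_childList.1 (show v ∈ childList G r ord u by simp [hl])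
  have hhi : (placement G r ord N v).hi = (placement G r ord N u).hi := by
    have hS : (l.map (subtreeSize G r)).sum + subtreeSize G r v = subtreeSize G r u - 1 := by
      rw [hT.subtreeSize_eq r u, hl]
      simp
    have hpos := (hT.admissible_placement hN r v).sz_pos
    rw [hT.placement_child hc, hT.siblingOffset_eq (post := []) hl]
    refine (congrArg _ hS).trans (Placement.split_self hau.lo_lt_hi.le ?_)
    omega
  by_cases hm : FractionMem N (placement G r ord N v).lo (placement G r ord N v).hi
      (placement G r ord N u).j (placement G r ord N u).k
  · exact (hT.fraction_placement_eq hc hm).ge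
  · refine le_trans ?_ (hv.div_le hau.pos)
    have := hu.pos
    have := hau.pos
    rw [Placement.fraction, div_le_div_iff₀ (by positivity) (by positivity)]
    rw [FractionMem, hhi, not_and', not_le] at hm
    exact_mod_cast (hm hu.2).le

theorem isConeDrawing_treeDrawing :
    -- Subtracting `ε` makes the intervals open on the left; `ε` is small since `k ≤ 2 |V|`.
    let ε : ℝ := 1 / ((2 * Fintype.card V + 1 : ℕ) * N)
    IsConeDrawing G r ord (treeDrawing G r ord N) (fun v => (placement G r ord N v).fraction)
      (fun v => (placement G r ord N v).lo / N - ε)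
      (fun v => (placement G r ord N v).hi / N - ε) := by
  intro ε
  have hN₀ : 0 < N := Nat.zero_lt_of_lt hN
  have hε : 0 < ε := by positivity
  have hmem (v : V) := hT.fractionMem_placement hN r v
  refine ⟨fun u v huv => ?_, fun v => ?_, fun v => ?_, fun u v huv => ?_, fun u v huv => ?_,
    fun u => ?_, fun u _ c hc => hT.fraction_head?_le hN hc,
    fun u _ c hc => hT.le_fraction_getLast? hN hc⟩
  · exact ⟨_, by exact_mod_cast (hmem v).pos, hT.treeDrawing_sub hN huv⟩
  · exact (sub_lt_self _ hε).trans_le ((hmem v).div_le hN₀)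
  · exact lt_sub_iff_add_lt.2
      ((hmem v).add_inv_lt_div hN₀ (Nat.lt_succ_of_le (hT.k_placement_le hN r v)))
  · have : ((placement G r ord N u).lo : ℝ) ≤ (placement G r ord N v).lo :=
      mod_cast (hT.placement_interval_subset hN huv).1
    gcongr
  · have : ((placement G r ord N v).hi : ℝ) ≤ (placement G r ord N u).hi :=
      mod_cast (hT.placement_interval_subset hN huv).2
    gcongr
  · refine (hT.pairwise_childList_placement (N := N) u).imp fun {a b} hab => ?_
    have : ((placement G r ord N a).hi : ℝ) ≤ (placement G r ord N b).lo := mod_cast hab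
    gcongr

theorem treeDrawing_mem_secondOctant (v : V) : treeDrawing G r ord N v ∈ secondOctant :=
  ⟨Nat.cast_nonneg _, Nat.cast_le.2 (hT.admissible_placement hN r v).x_le⟩

theorem fitsInGrid_treeDrawing :
    FitsInGrid (treeDrawing G r ord N) (2 * Fintype.card V) := fun v =>
  have hy := hT.y_placement_lt hN r v
  ⟨_, _, (hT.admissible_placement hN r v).x_le.trans_lt hy, hy, rfl⟩

end IsOrderedTree

theorem treeDrawing_root : treeDrawing G r ord N r = 0 := by
  rw [treeDrawing, placement_root, Placement.point, Placement.root]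
  simp only [Nat.cast_zero]
  rfl

end DrawingOfTree

/-! ### Reasoning about programs -/

local notation:60 p:61 ";;" q:60 => Program.seq p q

/-- Weakest precondition for total correctness: started in `s`, the program `p` halts, and `Q` holds
of its running time and of the final configuration. -/
def WP (W : ℕ) (p : Program) (s : Config) (Q : ℕ → Config → Prop) : Prop :=
  ∃ t s', Runs W p s t s' ∧ Q t s'

namespace Config

variable (s : Config) (d x i : ℕ)

theorem setReg_reg : (s.setReg d x).reg i = if i = d then x else s.reg i := by
  simp [setReg, Function.update_apply]

theorem setReg_mem : (s.setReg d x).mem = s.mem := rfl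

theorem setMem_mem : (s.setMem d x).mem i = if i = d then x else s.mem i := by
  simp [setMem, Function.update_apply]

theorem setReg_setReg (y : ℕ) : (s.setReg d x).setReg d y = s.setReg d y := by
  simp [setReg]

end Config

section Logic

variable {W : ℕ} {p q : Program} {s : Config} {Q Q' : ℕ → Config → Prop} {a b c d : ℕ}

theorem WP.mono (h : WP W p s Q) (hQ : ∀ t s', Q t s' → Q' t s') : WP W p s Q' :=
  let ⟨t, s', hr, hq⟩ := h
  ⟨t, s', hr, hQ t s' hq⟩

theorem wp_skip : WP W .skip s Q ↔ Q 1 s := by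
  refine ⟨?_, fun h => ⟨1, s, .skip s, h⟩⟩
  rintro ⟨_, _, ⟨⟩, h⟩
  exact h

theorem wp_const : WP W (.const d c) s Q ↔ c < W ∧ Q 1 (s.setReg d c) := by
  refine ⟨?_, fun ⟨hc, h⟩ => ⟨1, _, .const s d c hc, h⟩⟩
  rintro ⟨_, _, ⟨⟩, h⟩
  exact ⟨‹_›, h⟩

theorem wp_arith {o : Op} : WP W (.arith o d a b) s Q ↔
    o.eval (s.reg a) (s.reg b) < W ∧ Q 1 (s.setReg d (o.eval (s.reg a) (s.reg b))) := by
  refine ⟨?_, fun ⟨ho, h⟩ => ⟨1, _, .arith s o d a b ho, h⟩⟩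
  rintro ⟨_, _, ⟨⟩, h⟩
  exact ⟨‹_›, h⟩

theorem wp_load : WP W (.load d a) s Q ↔
    s.mem (s.reg a) < W ∧ Q 1 (s.setReg d (s.mem (s.reg a))) := by
  refine ⟨?_, fun ⟨hm, h⟩ => ⟨1, _, .load s d a hm, h⟩⟩
  rintro ⟨_, _, ⟨⟩, h⟩
  exact ⟨‹_›, h⟩

theorem wp_store : WP W (.store a b) s Q ↔
    s.reg b < W ∧ Q 1 (s.setMem (s.reg a) (s.reg b)) := by
  refine ⟨?_, fun ⟨hb, h⟩ => ⟨1, _, .store s a b hb, h⟩⟩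
  rintro ⟨_, _, ⟨⟩, h⟩
  exact ⟨‹_›, h⟩

theorem wp_seq : WP W (p ;; q) s Q ↔
    WP W p s fun t s' => WP W q s' fun t' s'' => Q (t + t') s'' := by
  constructor
  · rintro ⟨_, _, ⟨⟩, h⟩
    exact ⟨_, _, ‹_›, _, _, ‹_›, h⟩
  · rintro ⟨_, _, hp, _, _, hq, h⟩
    exact ⟨_, _, .seq hp hq, h⟩

theorem wp_ifLt : WP W (.ifLt a b p q) s Q ↔
    if s.reg a < s.reg b then WP W p s fun t => Q (t + 1) else WP W q s fun t => Q (t + 1) := by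
  split_ifs with hlt
  · constructor
    · rintro ⟨_, _, ⟨⟩, h⟩
      · exact ⟨_, _, ‹_›, h⟩
      · contradiction
    · rintro ⟨_, _, hp, h⟩
      exact ⟨_, _, .ifTrue hlt hp, h⟩
  · constructor
    · rintro ⟨_, _, ⟨⟩, h⟩
      · contradiction
      · exact ⟨_, _, ‹_›, h⟩
    · rintro ⟨_, _, hq, h⟩
      exact ⟨_, _, .ifFalse hlt hq, h⟩

/-- The registers to which a program assigns. -/
def Program.writes : Program → List ℕ
  | skip => []
  | const d _ => [d]
  | arith _ d _ _ => [d]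
  | load d _ => [d]
  | store _ _ => []
  | seq p q => p.writes ++ q.writes
  | ifLt _ _ p q => p.writes ++ q.writes
  | whileLt _ _ p => p.writes

/-- All registers and memory cells contain words less than `W`. -/
structure Config.Bounded (W : ℕ) (s : Config) : Prop where
  reg_lt : ∀ d, s.reg d < W
  mem_lt : ∀ a, s.mem a < W

theorem Config.Bounded.setReg (hs : s.Bounded W) {x : ℕ} (hx : x < W) : (s.setReg d x).Bounded W :=
  ⟨fun i => by rw [Config.setReg_reg]; split_ifs; exacts [hx, hs.reg_lt i], hs.mem_lt⟩

theorem Config.Bounded.setMem (hs : s.Bounded W) {x : ℕ} (hx : x < W) : (s.setMem a x).Bounded W :=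
  ⟨hs.reg_lt, fun i => by rw [Config.setMem_mem]; split_ifs; exacts [hx, hs.mem_lt i]⟩

/-- What is known of the effect of a program that runs from `s` to `s'` on words less than `W`,
whatever the program computes. -/
structure Frame (W : ℕ) (p : Program) (s s' : Config) : Prop where
  reg_eq : ∀ d ∉ p.writes, s'.reg d = s.reg d
  bounded : s'.Bounded W

theorem Frame.trans {s' s'' : Config} (h : Frame W p s s') (h' : Frame W q s' s'') :
    Frame W (p ;; q) s s'' where
  reg_eq d hd := by
    rw [Program.writes, List.mem_append, not_or] at hd
    exact (h'.reg_eq d hd.2).trans (h.reg_eq d hd.1)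
  bounded := h'.bounded

theorem Frame.mono {s' : Config} (h : Frame W p s s') (hpq : p.writes ⊆ q.writes) :
    Frame W q s s' :=
  ⟨fun d hd => h.reg_eq d fun hp => hd (hpq hp), h.bounded⟩

theorem Runs.frame {t : ℕ} {s' : Config} (h : Runs W p s t s') (hs : s.Bounded W) :
    Frame W p s s' := by
  induction h with
  | skip | whileFalse => exact ⟨fun _ _ => rfl, hs⟩
  | const _ _ _ h | arith _ _ _ _ _ h | load _ _ _ h =>
    exact ⟨by simp +contextual [Program.writes, Config.setReg_reg], hs.setReg h⟩
  | store _ _ _ h => exact ⟨fun _ _ => rfl, hs.setMem h⟩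
  | seq _ _ ih₁ ih₂ => exact (ih₁ hs).trans (ih₂ (ih₁ hs).bounded)
  | ifTrue _ _ ih => exact (ih hs).mono (List.subset_append_left _ _)
  | ifFalse _ _ ih => exact (ih hs).mono (List.subset_append_right _ _)
  | whileTrue _ _ _ ih₁ ih₂ =>
    exact ((ih₁ hs).trans (ih₂ (ih₁ hs).bounded)).mono
      (List.append_subset.2 ⟨fun _ => id, fun _ => id⟩)

theorem WP.frame (h : WP W p s Q) (hs : s.Bounded W) :
    WP W p s fun t s' => Q t s' ∧ Frame W p s s' :=
  let ⟨t, s', hr, hq⟩ := h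
  ⟨t, s', hr, hq, hr.frame hs⟩

theorem wp_whileLt (I : ℕ → Config → Prop) (m : ℕ) (T : ℕ → ℕ) (hs : s.Bounded W)
    (start : I 0 s)
    (step : ∀ i < m, ∀ s₁, Frame W (.whileLt a b p) s s₁ → I i s₁ →
      s₁.reg a < s₁.reg b ∧ WP W p s₁ fun t s₂ => t ≤ T i ∧ I (i + 1) s₂)
    (exit : ∀ s₁, Frame W (.whileLt a b p) s s₁ → I m s₁ → ¬ s₁.reg a < s₁.reg b) :
    WP W (.whileLt a b p) s fun t s' => t ≤ ∑ i ∈ Finset.range m, (T i + 1) + 1 ∧ I m s' := by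
  induction m generalizing s I T with
  | zero =>
    exact ⟨1, s, .whileFalse (exit s ⟨fun _ _ => rfl, hs⟩ start), by simp, start⟩
  | succ m ih =>
    obtain ⟨hlt, hbody⟩ := step 0 m.succ_pos s ⟨fun _ _ => rfl, hs⟩ start
    obtain ⟨t₁, s₁, hrun₁, ⟨ht₁, hI₁⟩, hf⟩ := hbody.frame hs
    have htrans {s₂ : Config} (hf₂ : Frame W (.whileLt a b p) s₁ s₂) :
        Frame W (.whileLt a b p) s s₂ :=
      ⟨fun d hd => (hf₂.reg_eq d hd).trans (hf.reg_eq d hd), hf₂.bounded⟩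
    obtain ⟨t₂, s₂, hrun₂, ht₂, hI₂⟩ := ih (fun i => I (i + 1)) (fun i => T (i + 1)) hf.bounded hI₁
      (fun i hi s₂ hf₂ => step (i + 1) (by omega) s₂ (htrans hf₂))
      (fun s₂ hf₂ => exit s₂ (htrans hf₂))
    refine ⟨_, _, .whileTrue hlt hrun₁ hrun₂, ?_, hI₂⟩
    rw [Finset.sum_range_succ']
    omega

end Logic

/-! ### Breadth-first search order -/

theorem getElem_notMem_take_of_nodup {α : Type*} {l : List α} {i : ℕ} (hl : l.Nodup)
    (hi : i < l.length) :
    l[i] ∉ l.take i := fun h =>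
  List.disjoint_take_drop hl le_rfl h (List.drop_eq_getElem_cons hi ▸ List.mem_cons_self)

section SearchOrder

variable {V : Type*} [DecidableEq V] {G : SimpleGraph V} {r v : V} {ord : V → List V} {i j : ℕ}

/-- The vertices that a breadth-first search from `r` has found when it has listed the children
of the first `i` of them, in the order in which it has found them. -/
noncomputable def searchPrefix (G : SimpleGraph V) (r : V) (ord : V → List V) : ℕ → List V
  | 0 => [r]
  | i + 1 => searchPrefix G r ord i ++ (searchPrefix G r ord i)[i]?.elim [] (childList G r ord)

theorem searchPrefix_succ (hi : i < (searchPrefix G r ord i).length) :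
    searchPrefix G r ord (i + 1) =
      searchPrefix G r ord i ++ childList G r ord (searchPrefix G r ord i)[i] := by
  rw [searchPrefix, List.getElem?_eq_getElem hi, Option.elim_some]

theorem searchPrefix_isPrefix (h : i ≤ j) : searchPrefix G r ord i <+: searchPrefix G r ord j := by
  induction j, h using Nat.le_induction with
  | base => exact List.prefix_rfl
  | succ j _ ih => exact ih.trans (List.prefix_append _ _)

namespace IsOrderedTree

variable (hT : IsOrderedTree G ord)
include hT

theorem mem_searchPrefix :
    v ∈ searchPrefix G r ord i ↔ v = r ∨ parent G r v ∈ (searchPrefix G r ord i).take i := by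
  induction i with
  | zero => simp [searchPrefix]
  | succ i ih =>
    rcases lt_or_ge i (searchPrefix G r ord i).length with hi | hi
    · have hchild : v ∈ childList G r ord (searchPrefix G r ord i)[i] ↔
          v ≠ r ∧ parent G r v = (searchPrefix G r ord i)[i] := by
        rw [hT.mem_childList]
        exact ⟨fun h => ⟨h.ne_root, h.parent_eq hT.isTree⟩,
          fun h => h.2 ▸ isChild_parent hT.isTree.connected h.1⟩
      rw [searchPrefix_succ hi, List.mem_append, ih, hchild, List.take_append_of_le_length hi,
        List.take_add_one, List.getElem?_eq_getElem hi]
      simp only [Option.toList_some, List.mem_append, List.mem_singleton]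
      tauto
    · rw [searchPrefix, List.getElem?_eq_none hi, Option.elim_none, List.append_nil, ih,
        List.take_of_length_le hi, List.take_of_length_le (hi.trans i.le_succ)]

theorem nodup_searchPrefix : (searchPrefix G r ord i).Nodup := by
  induction i with
  | zero => exact List.nodup_singleton r
  | succ i ih =>
    rcases lt_or_ge i (searchPrefix G r ord i).length with hi | hi
    · rw [searchPrefix_succ hi]
      refine ih.append hT.nodup_childList fun v hv hvc => ?_
      have hc := hT.mem_childList.1 hvc
      have hmem := (hT.mem_searchPrefix.1 hv).resolve_left hc.ne_root
      rw [hc.parent_eq hT.isTree] at hmem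
      exact getElem_notMem_take_of_nodup ih hi hmem
    · rwa [searchPrefix, List.getElem?_eq_none hi, Option.elim_none, List.append_nil]

theorem mem_searchPrefix_of_length_le (h : (searchPrefix G r ord i).length ≤ i) (v : V) :
    v ∈ searchPrefix G r ord i := by
  induction v using induction_on_isChild (r := r) hT.isTree.connected with
  | root => exact hT.mem_searchPrefix.2 (.inl rfl)
  | child u v huv ih =>
    rw [hT.mem_searchPrefix, List.take_of_length_le h, huv.parent_eq hT.isTree]
    exact .inr ih

variable [Fintype V]

theorem lt_length_searchPrefix (hi : i < Fintype.card V) : i < (searchPrefix G r ord i).length := by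
  by_contra! h
  have := Finset.card_le_card (s := Finset.univ) (t := (searchPrefix G r ord i).toFinset)
    fun v _ => List.mem_toFinset.2 (hT.mem_searchPrefix_of_length_le h v)
  have := (searchPrefix G r ord i).toFinset_card_le
  rw [Finset.card_univ] at *
  omega

end IsOrderedTree

/-- The vertices in the order in which a breadth-first search from `r` finds them. -/
noncomputable def searchOrder [Fintype V] (G : SimpleGraph V) (r : V) (ord : V → List V) : List V :=
  searchPrefix G r ord (Fintype.card V)

namespace IsOrderedTree

variable [Fintype V] (hT : IsOrderedTree G ord)
include hT

theorem mem_searchOrder (v : V) : v ∈ searchOrder G r ord :=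
  hT.mem_searchPrefix_of_length_le hT.nodup_searchPrefix.length_le_card v

theorem nodup_searchOrder : (searchOrder G r ord).Nodup :=
  hT.nodup_searchPrefix

theorem length_searchOrder : (searchOrder G r ord).length = Fintype.card V := by
  rw [← List.toFinset_card_of_nodup hT.nodup_searchOrder, ← Finset.card_univ]
  congr 1
  ext v
  simpa using hT.mem_searchOrder v

theorem lt_of_isChild_getElem_searchOrder (hi : i < (searchOrder G r ord).length)
    (hj : j < (searchOrder G r ord).length)
    (h : IsChild G r (searchOrder G r ord)[i] (searchOrder G r ord)[j]) : i < j := by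
  rw [hT.length_searchOrder] at hi
  have hlen := hT.lt_length_searchPrefix hi (r := r)
  have hpre : searchPrefix G r ord i <+: searchOrder G r ord := searchPrefix_isPrefix hi.le
  by_contra! hji
  rw [← hpre.getElem hlen, ← hpre.getElem (hji.trans_lt hlen)] at h
  have hmem := (hT.mem_searchPrefix.1 (List.getElem_mem _)).resolve_left h.ne_root
  rw [h.parent_eq hT.isTree] at hmem
  exact getElem_notMem_take_of_nodup hT.nodup_searchPrefix hlen hmem

end IsOrderedTree

end SearchOrder

/-! ### Registers and arrays -/

/-- The registers of the drawing program. The input is in the first two, and so is the output in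
the end. -/
inductive Reg where
  | count | root | zero | one | width | address
  | position | tail | vertex | parent | total
  | first | last | middle | pointer | entry
  | offset | span | part | left | right
  | lo | hi | j | k | x | y
  | lo' | hi' | j' | k' | x' | y'

/-- The number that identifies a register in programs. -/
def Reg.idx (a : Reg) : ℕ := a.ctorIdx

instance : Coe Reg ℕ := ⟨Reg.idx⟩

theorem Reg.idx_inj {a b : Reg} : a.idx = b.idx ↔ a = b :=
  ⟨fun h => by cases a <;> cases b <;> first | rfl | exact absurd h (by decide), congrArg idx⟩

namespace Program

variable (d a b : Reg)

abbrev copy : Program := .arith .add d a Reg.zero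

abbrev add : Program := .arith .add d a b

abbrev sub : Program := .arith .sub d a b

abbrev mul : Program := .arith .mul d a b

abbrev div : Program := .arith .div d a b

end Program

/-- The arrays of the drawing program. Each has an entry for each of the numbers less than `n`,
which are positions in the search order in the case of `order`, and vertices otherwise. -/
inductive Arr where
  | parent | order | size | lo | hi | j | k | x | y

/-- The number of arrays of length `n` for which there is room before the array; the input occupies
less than the room of three. -/
def Arr.num (A : Arr) : ℕ := A.ctorIdx + 3

theorem Arr.num_inj {A B : Arr} : A.num = B.num ↔ A = B :=
  ⟨fun h => by cases A <;> cases B <;> first | rfl | exact absurd h (by decide), congrArg num⟩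

theorem Arr.num_lt (A : Arr) : A.num < 12 := by
  cases A <;> decide

/-- The address of entry `i` of an array. -/
def addr (n : ℕ) (A : Arr) (i : ℕ) : ℕ := A.num * n + i

section Addr

variable {n i j : ℕ} {A B : Arr}

theorem addr_inj (hi : i < n) (hj : j < n) : addr n A i = addr n B j ↔ A = B ∧ i = j := by
  refine ⟨fun h => ?_, fun h => by rw [h.1, h.2]⟩
  have hnum : A.num = B.num := by
    have := congrArg (· / n) h
    simpa [addr, mul_comm, Nat.mul_add_div (Nat.zero_lt_of_lt hi), Nat.div_eq_of_lt hi,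
      Nat.div_eq_of_lt hj] using this
  exact ⟨Arr.num_inj.1 hnum, by simpa [addr, hnum] using h⟩

theorem addr_lt (A : Arr) (hi : i < n) : addr n A i < 12 * n := by
  have := Nat.mul_le_mul_right n A.num_lt
  rw [Nat.succ_mul] at this
  unfold addr
  omega

theorem le_addr (n : ℕ) (A : Arr) (i : ℕ) : 3 * n ≤ addr n A i := by
  unfold addr Arr.num
  nlinarith

end Addr

/-- Put the address of the entry of `A` at the index in register `i` into register `address`. -/
def locate (A : Arr) (i : Reg) : Program :=
  .const Reg.address A.num ;; .mul .address .address .count ;; .add .address .address i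

/-- Load the entry of `A` at the index in register `i` into register `d`. -/
def read (d : Reg) (A : Arr) (i : Reg) : Program :=
  locate A i ;; .load d Reg.address

/-- Store register `a` at the index in register `i` of `A`. -/
def write (A : Arr) (i a : Reg) : Program :=
  locate A i ;; .store Reg.address a

/-- For each pair `(A, d)` in the list, load the entry of `A` at the index in register `i` into
register `d`. -/
def readAll (i : Reg) : List (Arr × Reg) → Program
  | [] => .skip
  | (A, d) :: l => read d A i ;; readAll i l

/-- For each pair `(A, a)` in the list, store register `a` at the index in register `i` of `A`. -/
def writeAll (i : Reg) : List (Arr × Reg) → Program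
  | [] => .skip
  | (A, a) :: l => write A i a ;; writeAll i l

/-- The machine has words less than `W`, which suffices for all addresses that are used, and the
registers that the program never changes contain what they should. -/
structure Config.Ready (W n : ℕ) (s : Config) : Prop extends s.Bounded W where
  room : 12 * n ≤ W
  count_eq : s.reg Reg.count = n
  zero_eq : s.reg Reg.zero = 0
  one_eq : s.reg Reg.one = 1

theorem Config.Ready.setReg {W n x : ℕ} {s : Config} {d : Reg} (hs : s.Ready W n) (hx : x < W)
    (hd : d ∉ [Reg.count, .zero, .one]) : (s.setReg d x).Ready W n := by
  simp only [List.mem_cons, List.not_mem_nil, or_false, not_or, @ne_comm _ d] at hd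
  exact ⟨hs.toBounded.setReg hx, hs.room,
    by simp [Config.setReg_reg, Reg.idx_inj, hd, hs.count_eq],
    by simp [Config.setReg_reg, Reg.idx_inj, hd, hs.zero_eq],
    by simp [Config.setReg_reg, Reg.idx_inj, hd, hs.one_eq]⟩

theorem Config.Ready.frame {W n : ℕ} {s s' : Config} {p : Program} (hs : s.Ready W n)
    (hf : Frame W p s s') (hp : ∀ a ∈ [Reg.count, .zero, .one], a.idx ∉ p.writes) :
    s'.Ready W n := by
  simp only [List.mem_cons, List.not_mem_nil, or_false, forall_eq_or_imp, forall_eq] at hp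
  exact ⟨hf.bounded, hs.room, (hf.reg_eq _ hp.1).trans hs.count_eq,
    (hf.reg_eq _ hp.2.1).trans hs.zero_eq, (hf.reg_eq _ hp.2.2).trans hs.one_eq⟩

section Represents

variable {n : ℕ} {G : SimpleGraph (Fin n)} {ord : Fin n → List (Fin n)} {u v : Fin n}
  {f : Arr → Fin n → ℕ} {D D' : Set (Arr × Fin n)} {m : ℕ → ℕ}

theorem listAddr_succ (ord : Fin n → List (Fin n)) (v : Fin n) :
    listAddr ord (v + 1) = listAddr ord v + (ord v).length := by
  simp [listAddr, List.take_add_one, add_assoc]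

theorem listAddr_eq (ord : Fin n → List (Fin n)) :
    listAddr ord n = n + 1 + ∑ v, (ord v).length := by
  rw [listAddr, List.take_of_length_le (by simp), ← List.sum_ofFn, List.ofFn_eq_map]

theorem listAddr_mono (ord : Fin n → List (Fin n)) : Monotone (listAddr ord) := fun i j hij =>
  Nat.add_le_add_left (((List.take_sublist_take_left hij).map _).sum_le_sum (by simp)) _

theorem IsOrderedTree.listAddr_lt (hT : IsOrderedTree G ord) {i : ℕ} (hi : i ≤ n) :
    listAddr ord i < 3 * n := by
  have := listAddr_mono ord hi
  have := hT.sum_length_ord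
  rw [listAddr_eq] at *
  rw [Fintype.card_fin] at this
  omega

/-- The memory `m` contains the adjacency arrays of the input. -/
structure HasInput (ord : Fin n → List (Fin n)) (m : ℕ → ℕ) : Prop where
  listAddr_eq : ∀ i ≤ n, m i = listAddr ord i
  ord_eq : ∀ v, ∀ i, (h : i < (ord v).length) → m (listAddr ord v + i) = (ord v)[i]

/-- The memory `m` contains the input, and for `(A, v)` in `D` the entry of the array `A` at `v` is
`f A v`. -/
structure Represents (ord : Fin n → List (Fin n)) (f : Arr → Fin n → ℕ) (D : Set (Arr × Fin n))
    (m : ℕ → ℕ) : Prop extends HasInput ord m where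
  arr_eq : ∀ A v, (A, v) ∈ D → m (addr n A v) = f A v

theorem represents_inputConfig (r : Fin n) (ord : Fin n → List (Fin n)) (f : Arr → Fin n → ℕ) :
    Represents ord f ∅ (inputConfig r ord).mem where
  listAddr_eq i hi := by
    simp only [inputConfig, inputWords]
    rw [List.getD_append _ _ _ _ (by simpa using Nat.lt_succ_of_le hi),
      List.getD_eq_getElem _ _ (by simpa using Nat.lt_succ_of_le hi)]
    simp
  ord_eq v i hi := by
    have hsplit := List.take_append_drop (v : ℕ) (List.finRange n)
    rw [List.drop_eq_getElem_cons (by simp), List.getElem_finRange] at hsplit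
    simp only [inputConfig, inputWords, listAddr]
    conv_lhs => enter [1, 2, 2]; rw [← hsplit]
    rw [List.flatMap_append, List.flatMap_cons]
    generalize hpre : ((List.finRange n).take v).flatMap _ = pre
    have hlen : (((List.finRange n).take v).map fun u => (ord u).length).sum = pre.length := by
      rw [← hpre]; simp [List.length_flatMap]
    rw [hlen, List.getD_append_right _ _ _ _ (by simp; omega), List.length_map, List.length_range,
      add_assoc, Nat.add_sub_cancel_left, List.getD_append_right _ _ _ _ (by omega),
      Nat.add_sub_cancel_left, List.getD_append _ _ _ _ (by simpa using hi),
      List.getD_eq_getElem _ _ (by simpa using hi)]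
    simp [← List.map_eq_flatMap]
  arr_eq _ _ h := h.elim

theorem Represents.mono (h : Represents ord f D m) (hD : D' ⊆ D) : Represents ord f D' m :=
  ⟨h.toHasInput, fun A v hv => h.arr_eq A v (hD hv)⟩

theorem Represents.setMem {s : Config} {A : Arr} {x : ℕ} (hT : IsOrderedTree G ord)
    (h : Represents ord f D s.mem) (hx : x = f A v) :
    Represents ord f (insert (A, v) D) (s.setMem (addr n A v) x).mem where
  listAddr_eq i hi := by
    have := le_addr n A v
    have := v.isLt
    rw [Config.setMem_mem, if_neg (by omega), h.listAddr_eq i hi]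
  ord_eq w i hi := by
    have := le_addr n A v
    have := hT.listAddr_lt w.isLt
    rw [listAddr_succ] at this
    rw [Config.setMem_mem, if_neg (by omega), h.ord_eq w i hi]
  arr_eq B w hw := by
    rw [Config.setMem_mem]
    split_ifs with heq
    · rw [addr_inj w.isLt v.isLt, Fin.val_inj] at heq
      rw [hx, heq.1, heq.2]
    · refine h.arr_eq B w (hw.resolve_left ?_)
      rintro ⟨⟩
      exact heq rfl

variable {W i : ℕ} {s : Config} {Q : ℕ → Config → Prop} {A : Arr} {a b d : Reg}
  {l : List (Arr × Reg)}

theorem wp_locate (hs : s.Ready W n) (hb : s.reg b = i) (hi : i < n) (hb' : b ≠ .address) :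
    WP W (locate A b) s Q ↔ Q 3 (s.setReg Reg.address (addr n A i)) := by
  have hW := hs.room
  have hnum : A.num < W := by have := A.num_lt; omega
  have haddr : A.num * n + i < W := (addr_lt A hi).trans_le hW
  simp [locate, wp_seq, wp_const, wp_arith, Config.setReg_reg, Config.setReg_setReg, Reg.idx_inj,
    Op.eval, hb', hb, hs.count_eq, addr, hnum, haddr, (Nat.le_add_right _ _).trans_lt haddr]

theorem wp_read (hs : s.Ready W n) (hm : Represents ord f D s.mem) (hb : s.reg b = v)
    (hv : (A, v) ∈ D) (hb' : b ≠ .address) :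
    WP W (read d A b) s Q ↔ Q 4 ((s.setReg Reg.address (addr n A v)).setReg d (f A v)) := by
  simp [read, wp_seq, wp_locate hs hb v.isLt hb', wp_load, Config.setReg_reg, Config.setReg_mem,
    ← hm.arr_eq A v hv, hs.mem_lt]

theorem idx_notMem_writes_readAll (ha : a ≠ .address) (hl : a ∉ l.map Prod.snd) :
    a.idx ∉ (readAll b l).writes := by
  induction l with
  | nil => simp [readAll, Program.writes]
  | cons q l ih =>
    simp only [List.map_cons, List.mem_cons, not_or] at hl
    simpa [readAll, read, locate, Program.writes, Reg.idx_inj, ha, hl.1] using ih hl.2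

theorem wp_readAll (hs : s.Ready W n) (hm : Represents ord f D s.mem) (hb : s.reg b = v)
    (hv : ∀ q ∈ l, (q.1, v) ∈ D) (hl : (l.map Prod.snd).Nodup)
    (hl' : ∀ a ∈ [Reg.count, .zero, .one, .address, b], a ∉ l.map Prod.snd) (hb' : b ≠ .address) :
    WP W (readAll b l) s fun t s' =>
      t ≤ 4 * l.length + 1 ∧ (∀ q ∈ l, s'.reg q.2 = f q.1 v) ∧ s'.mem = s.mem := by
  induction l generalizing s with
  | nil => exact wp_skip.2 ⟨le_rfl, by simp, rfl⟩
  | cons q l ih =>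
    simp only [List.mem_cons, List.not_mem_nil, or_false, forall_eq_or_imp, forall_eq,
      List.map_cons, List.nodup_cons, not_or] at hv hl hl'
    have hq : WP W (read q.2 q.1 b) s fun t s' =>
        t = 4 ∧ s' = (s.setReg Reg.address (addr n q.1 v)).setReg q.2 (f q.1 v) :=
      (wp_read hs hm hb hv.1 hb').2 ⟨rfl, rfl⟩
    rw [readAll, wp_seq]
    refine (hq.frame hs.toBounded).mono ?_
    rintro _ s₁ ⟨⟨rfl, rfl⟩, hf⟩
    have hs₁ := hs.frame hf (by
      simp [read, locate, Program.writes, Reg.idx_inj, hl'])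
    refine ((ih hs₁ hm ?_ hv.2 hl.2 ?_).frame hs₁.toBounded).mono ?_
    · simpa [Config.setReg_reg, Reg.idx_inj, hb', hl'] using hb
    · simp only [List.mem_cons, List.not_mem_nil, or_false, forall_eq_or_imp, forall_eq]
      exact ⟨hl'.1.2, hl'.2.1.2, hl'.2.2.1.2, hl'.2.2.2.1.2, hl'.2.2.2.2.2⟩
    · rintro t s₂ ⟨⟨ht, hreg, hmem⟩, hf₂⟩
      refine ⟨by simp; omega, ?_, hmem⟩
      rw [List.forall_mem_cons]
      refine ⟨?_, hreg⟩
      rw [hf₂.reg_eq _ (idx_notMem_writes_readAll (Ne.symm hl'.2.2.2.1.1) hl.1)]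
      simp [Config.setReg_reg]

theorem wp_write (hT : IsOrderedTree G ord) (hs : s.Ready W n) (hm : Represents ord f D s.mem)
    (hb : s.reg b = v) (ha : s.reg a = f A v) (hb' : b ≠ .address) (ha' : a ≠ .address) :
    WP W (write A b a) s fun t s' => t = 4 ∧ Represents ord f (insert (A, v) D) s'.mem := by
  simp only [write, wp_seq, wp_locate hs hb v.isLt hb', wp_store, Config.setReg_reg, Reg.idx_inj,
    ha', if_true, if_false]
  exact ⟨hs.reg_lt _, trivial, hm.setMem (s := s.setReg _ _) hT ha⟩

theorem wp_writeAll (hT : IsOrderedTree G ord) (hs : s.Ready W n) (hm : Represents ord f D s.mem)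
    (hb : s.reg b = v) (hl : ∀ q ∈ l, s.reg q.2 = f q.1 v) (hb' : b ≠ .address)
    (hl' : Reg.address ∉ l.map Prod.snd) :
    WP W (writeAll b l) s fun t s' => t ≤ 4 * l.length + 1 ∧
      Represents ord f (D ∪ {q | q.1 ∈ l.map Prod.fst ∧ q.2 = v}) s'.mem := by
  induction l generalizing s D with
  | nil => exact wp_skip.2 ⟨le_rfl, hm.mono (by simp)⟩
  | cons q l ih =>
    rw [writeAll, wp_seq]
    simp only [List.map_cons, List.mem_cons, not_or, forall_eq_or_imp] at hl hl'
    refine ((wp_write hT hs hm hb hl.1 hb' (Ne.symm hl'.1)).frame hs.toBounded).mono ?_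
    rintro t s' ⟨⟨rfl, hm'⟩, hf⟩
    have hkeep {a : Reg} (ha : a ≠ .address) : s'.reg a = s.reg a :=
      hf.reg_eq _ (by simpa [write, locate, Program.writes, Reg.idx_inj] using ha)
    refine (ih (hs.frame hf (by simp [write, locate, Program.writes, Reg.idx_inj])) hm'
      ((hkeep hb').trans hb) (fun q hq => ?_) hl'.2).mono ?_
    · rw [hkeep, hl.2 q hq]
      rintro h
      exact hl'.2 (h ▸ List.mem_map_of_mem hq)
    · rintro t s'' ⟨ht, hm''⟩
      refine ⟨by simp; omega, hm''.mono ?_⟩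
      rintro ⟨A, w⟩ (h | ⟨h, hw⟩)
      · exact .inl (.inr h)
      · exact (List.mem_cons.1 h).imp (fun h => .inl (Prod.ext h hw)) fun h => ⟨h, hw⟩

end Represents

/-! ### Loops over adjacency lists -/

/-- Run `body` for the words from the one at the address in `pointer` to the one before the address
in `limit`, with the word in `entry`. -/
def forRange (limit : Reg) (body : Program) : Program :=
  .whileLt Reg.pointer limit (.load Reg.entry Reg.pointer ;; body ;; .add .pointer .pointer .one)

/-- Advance `middle` to the position of the parent of `vertex` in the list of its neighbours, which
begins at `first` and ends before `last`; if the parent is not in the list, advance to `last`. -/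
def findParent : Program :=
  .copy .middle .last ;; .copy .pointer .first ;;
  forRange .last (.ifLt Reg.entry Reg.parent .skip
    (.ifLt Reg.parent Reg.entry .skip (.copy .middle .pointer)))

/-- Let `first`, `last` and `middle` be the beginning and the end of the list of the neighbours of
`vertex` and the position of the parent in it, and `pointer` the position after `middle`. -/
def findChildren : Program :=
  .load Reg.first Reg.vertex ;; .add .last .vertex .one ;; .load Reg.last Reg.last ;;
  findParent ;; .add .pointer .middle .one

/-- Run `body` for the words from the address in `first` to the one before the address in
`middle`. -/
def forPrefix (body : Program) : Program :=
  .copy .pointer .first ;; forRange .middle body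

/-- Run `body` for the words from the one at the address in `pointer` to the one before the address
in `last`, and then for those from the address in `first` to the one before the address in
`middle`. -/
def forCut (body : Program) : Program :=
  forRange .last body ;; forPrefix body

/-- Run `body` for the children of `vertex` in the order of `childList`, with the child in
`entry`. -/
def forChildren (body : Program) : Program :=
  findChildren ;; forCut body

section Loops

variable {W n T : ℕ} {s : Config} {body : Program} {acc limit : Reg} {G : SimpleGraph (Fin n)}
  {ord : Fin n → List (Fin n)} {u r : Fin n}

theorem wp_forRange_iteration {P : ℕ → (ℕ → ℕ) → Prop} (hs : s.Bounded W)
    (hone : s.reg Reg.one = 1) (hptr : s.reg Reg.pointer + 1 < W)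
    (hbody : ∀ a ∈ [Reg.one, .pointer], a.idx ∉ body.writes) (hacc : acc ≠ .pointer)
    (h : WP W body (s.setReg Reg.entry (s.mem (s.reg Reg.pointer))) fun t s' =>
      t ≤ T ∧ P (s'.reg acc) s'.mem) :
    WP W (.load Reg.entry Reg.pointer ;; body ;; .add .pointer .pointer .one) s fun t s' =>
      t ≤ T + 2 ∧ s'.reg Reg.pointer = s.reg Reg.pointer + 1 ∧ P (s'.reg acc) s'.mem := by
  simp only [List.mem_cons, List.not_mem_nil, or_false, forall_eq_or_imp, forall_eq] at hbody
  simp only [wp_seq, wp_load]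
  refine ⟨hs.mem_lt _, (h.frame (hs.setReg (hs.mem_lt _))).mono ?_⟩
  rintro t s₁ ⟨⟨ht, hP⟩, hf⟩
  have hptr₁ := hf.reg_eq _ hbody.2
  have hone₁ := hf.reg_eq _ hbody.1
  simp only [Config.setReg_reg, Reg.idx_inj, reduceCtorEq, if_false, hone] at hptr₁ hone₁
  simp only [wp_arith, Op.eval, Config.setReg_reg, Config.setReg_mem, Reg.idx_inj, hptr₁, hone₁,
    hacc, if_true, if_false]
  exact ⟨hptr, by omega, trivial, hP⟩

theorem wp_forRange (J : List (Fin n) → ℕ → (ℕ → ℕ) → Prop) (l : List (Fin n))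
    (hs : s.Bounded W) (hone : s.reg Reg.one = 1)
    (hlen : s.reg limit - s.reg Reg.pointer = l.length)
    (hbody : ∀ a ∈ [Reg.one, .pointer, limit], a.idx ∉ body.writes)
    (hlimit : limit ∉ [Reg.entry, .pointer]) (hacc : acc ∉ [Reg.entry, .pointer])
    (hread : ∀ pre a m, J pre a m → ∀ i, (h : i < l.length) → m (s.reg Reg.pointer + i) = l[i])
    (start : J [] (s.reg acc) s.mem)
    (step : ∀ pre (w : Fin n) post, l = pre ++ w :: post →
      ∀ s₁, Frame W (forRange limit body) s s₁ →
      s₁.reg Reg.pointer = s.reg Reg.pointer + pre.length → s₁.reg Reg.entry = w →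
      J pre (s₁.reg acc) s₁.mem →
      WP W body s₁ fun t s₂ => t ≤ T ∧ J (pre ++ [w]) (s₂.reg acc) s₂.mem) :
    WP W (forRange limit body) s fun t s' =>
      t ≤ (T + 3) * l.length + 1 ∧ J l (s'.reg acc) s'.mem := by
  simp only [List.mem_cons, List.not_mem_nil, or_false, forall_eq_or_imp, forall_eq, not_or]
    at hbody hlimit hacc
  have hkeep {s₁ : Config} {a : Reg} (hf : Frame W (forRange limit body) s s₁)
      (ha : a.idx ∉ body.writes) (he : a ≠ .entry) (hp : a ≠ .pointer) : s₁.reg a = s.reg a :=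
    hf.reg_eq _ (by simp [forRange, Program.writes, ha, Reg.idx_inj, he, hp])
  refine (wp_whileLt (fun i s₁ => s₁.reg Reg.pointer = s.reg Reg.pointer + i ∧
    J (l.take i) (s₁.reg acc) s₁.mem) l.length (fun _ => T + 2) hs ⟨rfl, by simpa using start⟩
    ?_ ?_).mono ?_
  · rintro i hi s₁ hf ⟨hptr, hJ⟩
    have hlimit₁ := hkeep hf hbody.2.2 hlimit.1 hlimit.2
    have hone₁ := hkeep hf hbody.1 (by simp) (by simp)
    have hval : s₁.mem (s₁.reg Reg.pointer) = l[i] := hptr ▸ hread _ _ _ hJ i hi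
    have hf₁ : Frame W (forRange limit body) s (s₁.setReg Reg.entry l[i]) := by
      refine ⟨fun d hd => ?_, hf.bounded.setReg (hval ▸ hf.bounded.mem_lt _)⟩
      rw [Config.setReg_reg, if_neg, hf.reg_eq d hd]
      rintro rfl
      exact hd (by simp [forRange, Program.writes])
    have hstep := step (l.take i) l[i] (l.drop (i + 1)) (by simp) _ hf₁
      (by simpa [Config.setReg_reg, Reg.idx_inj, hi.le] using hptr) (by simp [Config.setReg_reg])
      (by simpa [Config.setReg_reg, Config.setReg_mem, Reg.idx_inj, hacc] using hJ)
    rw [List.take_concat_get', ← hval] at hstep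
    have hlt : s₁.reg Reg.pointer + 1 < W := by
      have := hs.reg_lt limit
      omega
    refine ⟨by omega, (wp_forRange_iteration hf.bounded (hone₁.trans hone) hlt
      (by simp [hbody.1, hbody.2.1]) hacc.2 hstep).mono ?_⟩
    rintro t s₂ ⟨ht, hptr₂, hJ₂⟩
    exact ⟨ht, by omega, hJ₂⟩
  · rintro s₁ hf ⟨hptr, -⟩
    have hlimit₁ := hkeep hf hbody.2.2 hlimit.1 hlimit.2
    omega
  · rintro t s' ⟨ht, -, hJ⟩
    rw [List.take_length] at hJ
    refine ⟨?_, hJ⟩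
    simpa [mul_comm] using ht

theorem wp_findParent {p : Fin n} (hs : s.Bounded W) (hzero : s.reg Reg.zero = 0)
    (hone : s.reg Reg.one = 1) (hfirst : s.reg Reg.first = listAddr ord u)
    (hlast : s.reg Reg.last = listAddr ord (u + 1)) (hp : s.reg Reg.parent = p)
    (hnd : (ord u).Nodup) (hm : HasInput ord s.mem) :
    WP W findParent s fun t s' => t ≤ 6 * (ord u).length + 3 ∧
      s'.reg Reg.middle = listAddr ord u + (ord u).idxOf p ∧ s'.mem = s.mem := by
  have hW := hs.reg_lt
  have hfirstW := hfirst ▸ hW Reg.first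
  have hlastW := hlast ▸ hW Reg.last
  simp only [findParent, wp_seq, wp_arith, Op.eval, Config.setReg_reg, Reg.idx_inj, reduceCtorEq,
    if_false, hzero, hfirst, hlast, add_zero]
  refine ⟨hlastW, hfirstW, (wp_forRange (T := 3) (acc := .middle)
    (fun pre a m => (a = if p ∈ pre then listAddr ord u + (ord u).idxOf p else
      listAddr ord (u + 1)) ∧ m = s.mem) (ord u) ((hs.setReg hlastW).setReg hfirstW) ?_ ?_ ?_ ?_ ?_
      ?_ ?_ ?_).mono ?_⟩
  · simp [Config.setReg_reg, Reg.idx_inj, hone]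
  · simp [Config.setReg_reg, Reg.idx_inj, hlast, listAddr_succ]
  · decide
  · simp
  · simp
  · rintro pre a m ⟨-, rfl⟩ i hi
    simpa [Config.setReg_reg] using hm.ord_eq u i hi
  · simp [Config.setReg_reg, Reg.idx_inj, Config.setReg_mem]
  · rintro pre w post hl s₁ hf hptr hentry ⟨hmid, hmem⟩
    have hidx : w = p → (ord u).idxOf p = pre.length := by
      rintro rfl
      rw [hl, List.nodup_append] at hnd
      rw [hl, List.idxOf_append_of_notMem fun h => hnd.2.2 w h w (by simp) rfl]
      simp
    have hp₁ := hf.reg_eq Reg.parent (by decide)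
    have hzero₁ := hf.reg_eq Reg.zero (by decide)
    simp only [Config.setReg_reg, Reg.idx_inj, reduceCtorEq, if_true, if_false, hp, hzero]
      at hp₁ hzero₁ hptr
    have hptrW := hptr ▸ hf.bounded.reg_lt Reg.pointer
    simp only [wp_ifLt, wp_skip, wp_arith, Op.eval, hentry, hp₁, hptr, hzero₁, add_zero,
      Config.setReg_reg, Config.setReg_mem, Fin.val_fin_lt, if_true, hptrW, true_and, hmem]
    rcases lt_trichotomy w p with h | rfl | h
    · simpa [h, h.ne'] using hmid
    · simp [hidx]
    · simpa [h, h.ne, h.not_gt] using hmid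
  · rintro t s' ⟨ht, hmid, hmem⟩
    refine ⟨by omega, ?_, hmem⟩
    rw [hmid]
    split_ifs with h
    · rfl
    · rw [List.idxOf_of_notMem h, listAddr_succ]

theorem IsOrderedTree.wp_findChildren {p : Fin n} (hT : IsOrderedTree G ord) (hs : s.Ready W n)
    (hu : s.reg Reg.vertex = u) (hp : s.reg Reg.parent = p) (hm : HasInput ord s.mem) :
    WP W findChildren s fun t s' => t ≤ 6 * (ord u).length + 7 ∧
      s'.reg Reg.first = listAddr ord u ∧ s'.reg Reg.last = listAddr ord (u + 1) ∧
      s'.reg Reg.middle = listAddr ord u + (ord u).idxOf p ∧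
      s'.reg Reg.pointer = listAddr ord u + (ord u).idxOf p + 1 ∧ s'.mem = s.mem := by
  have hW := hs.room
  have hlt : listAddr ord (u + 1) < 3 * n := hT.listAddr_lt u.isLt
  have hidx := (ord u).idxOf_le_length (a := p)
  have hsucc := listAddr_succ ord u
  have hfirstW : listAddr ord u < W := by omega
  have hlastW : listAddr ord (u + 1) < W := by omega
  simp only [findChildren, wp_seq, wp_arith, wp_load, Op.eval, Config.setReg_reg,
    Config.setReg_mem, Reg.idx_inj, reduceCtorEq, if_true, if_false, hs.one_eq, hu,
    hm.listAddr_eq u u.isLt.le, hm.listAddr_eq (u + 1) u.isLt, Config.setReg_setReg]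
  have hs' := (hs.toBounded.setReg (d := Reg.first) hfirstW).setReg (d := Reg.last) hlastW
  refine ⟨hfirstW, by omega, hlastW, ((wp_findParent (ord := ord) (u := u) (p := p) hs' ?_ ?_ ?_ ?_
    ?_ (hT.isEdgeOrder u).1 hm).frame hs').mono ?_⟩
  · simpa [Config.setReg_reg, Reg.idx_inj] using hs.zero_eq
  · simpa [Config.setReg_reg, Reg.idx_inj] using hs.one_eq
  · simp [Config.setReg_reg, Reg.idx_inj]
  · simp [Config.setReg_reg]
  · simpa [Config.setReg_reg, Reg.idx_inj] using hp
  · rintro t s' ⟨⟨ht, hmid, hmem⟩, hf⟩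
    have hfirst := hf.reg_eq Reg.first (by decide)
    have hlast := hf.reg_eq Reg.last (by decide)
    have hone' := hf.reg_eq Reg.one (by decide)
    simp only [Config.setReg_reg, Reg.idx_inj, reduceCtorEq, if_true, if_false, hs.one_eq]
      at hfirst hlast hone'
    exact ⟨by omega, by omega, hfirst, hlast, hmid, by rw [hmid, hone'], hmem⟩

theorem wp_forPrefix (J : List (Fin n) → ℕ → (ℕ → ℕ) → Prop) {c : ℕ} (hc : c ≤ (ord u).length)
    (hs : s.Bounded W) (hzero : s.reg Reg.zero = 0) (hone : s.reg Reg.one = 1)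
    (hfirst : s.reg Reg.first = listAddr ord u) (hmiddle : s.reg Reg.middle = listAddr ord u + c)
    (hbody : ∀ a ∈ [Reg.one, .pointer, .middle], a.idx ∉ body.writes)
    (hacc : acc ∉ [Reg.entry, .pointer]) (hread : ∀ pre a m, J pre a m → HasInput ord m)
    (start : J [] (s.reg acc) s.mem)
    (step : ∀ pre (w : Fin n) post, (ord u).take c = pre ++ w :: post → ∀ s₁,
      Frame W (forPrefix body) s s₁ → s₁.reg Reg.entry = w → J pre (s₁.reg acc) s₁.mem →
      WP W body s₁ fun t s₂ => t ≤ T ∧ J (pre ++ [w]) (s₂.reg acc) s₂.mem) :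
    WP W (forPrefix body) s fun t s' => t ≤ (T + 3) * c + 2 ∧
      J ((ord u).take c) (s'.reg acc) s'.mem := by
  have hW := hfirst ▸ hs.reg_lt Reg.first
  rw [forPrefix, wp_seq, wp_arith, Op.eval, hfirst, hzero, add_zero]
  have hf₁ : Frame W (.copy .pointer .first) s (s.setReg Reg.pointer (listAddr ord u)) :=
    ⟨by simp +contextual [Program.writes, Config.setReg_reg], hs.setReg hW⟩
  refine ⟨hW, (wp_forRange (T := T) J ((ord u).take c) hf₁.bounded ?_ ?_ hbody (by simp) hacc ?_ ?_
    ?_).mono ?_⟩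
  · simpa [Config.setReg_reg, Reg.idx_inj] using hone
  · simpa [Config.setReg_reg, Reg.idx_inj, hmiddle] using hc
  · intro pre a m hJ i hi
    rw [List.length_take] at hi
    simp [Config.setReg_reg, (hread _ _ _ hJ).ord_eq u i (by omega)]
  · simp only [List.mem_cons, List.not_mem_nil, or_false, not_or] at hacc
    simpa [Config.setReg_reg, Config.setReg_mem, Reg.idx_inj, hacc] using start
  · exact fun pre w post hl s₂ hf₂ _ => step pre w post hl s₂ (hf₁.trans hf₂)
  · rintro t s' ⟨ht, hJ⟩
    rw [List.length_take, min_eq_left hc] at ht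
    exact ⟨by omega, hJ⟩

theorem wp_forCut (J : List (Fin n) → ℕ → (ℕ → ℕ) → Prop) {c : ℕ} (hc : c ≤ (ord u).length)
    (hs : s.Bounded W) (hzero : s.reg Reg.zero = 0) (hone : s.reg Reg.one = 1)
    (hfirst : s.reg Reg.first = listAddr ord u) (hlast : s.reg Reg.last = listAddr ord (u + 1))
    (hmiddle : s.reg Reg.middle = listAddr ord u + c)
    (hpointer : s.reg Reg.pointer = listAddr ord u + c + 1)
    (hbody : ∀ a ∈ [Reg.zero, .one, .first, .last, .middle, .pointer], a.idx ∉ body.writes)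
    (hacc : acc ∉ [Reg.entry, .pointer]) (hread : ∀ pre a m, J pre a m → HasInput ord m)
    (start : J [] (s.reg acc) s.mem)
    (step : ∀ pre (w : Fin n) post, (ord u).drop (c + 1) ++ (ord u).take c = pre ++ w :: post →
      ∀ s₁, Frame W (forCut body) s s₁ → s₁.reg Reg.entry = w → J pre (s₁.reg acc) s₁.mem →
      WP W body s₁ fun t s₂ => t ≤ T ∧ J (pre ++ [w]) (s₂.reg acc) s₂.mem) :
    WP W (forCut body) s fun t s' => t ≤ (T + 3) * (ord u).length + 3 ∧
      J ((ord u).drop (c + 1) ++ (ord u).take c) (s'.reg acc) s'.mem := by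
  simp only [List.mem_cons, List.not_mem_nil, or_false, forall_eq_or_imp, forall_eq] at hbody
  obtain ⟨hzeroB, honeB, hfirstB, hlastB, hmiddleB, hpointerB⟩ := hbody
  rw [forCut, wp_seq]
  refine ((wp_forRange (T := T) J ((ord u).drop (c + 1)) hs hone ?_ ?_ (by simp) hacc ?_ start
    ?_).frame hs).mono ?_
  · rw [hlast, hpointer, listAddr_succ, List.length_drop]
    omega
  · simp [honeB, hpointerB, hlastB]
  · intro pre a m hJ i hi
    rw [List.length_drop] at hi
    simp [hpointer, add_assoc, (hread _ _ _ hJ).ord_eq u (c + (1 + i)) (by omega)]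
  · intro pre w post hl s₁ hf₁ _
    exact step pre w (post ++ (ord u).take c) (by simp [hl]) s₁
      (hf₁.mono (List.subset_append_left _ _))
  rintro t₁ s₁ ⟨⟨ht₁, hJ₁⟩, hf₁⟩
  have hkeep {a : Reg} (ha : a.idx ∉ body.writes) (he : a ≠ .entry) (hp : a ≠ .pointer) :
      s₁.reg a = s.reg a :=
    hf₁.reg_eq _ (by simp [forRange, Program.writes, ha, Reg.idx_inj, he, hp])
  refine (wp_forPrefix (T := T) (fun pre => J ((ord u).drop (c + 1) ++ pre)) hc hf₁.bounded
    ((hkeep hzeroB (by simp) (by simp)).trans hzero) ((hkeep honeB (by simp) (by simp)).trans hone)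
    ((hkeep hfirstB (by simp) (by simp)).trans hfirst)
    ((hkeep hmiddleB (by simp) (by simp)).trans hmiddle) (by simp [honeB, hpointerB, hmiddleB])
    hacc (fun _ => hread _) (by simpa using hJ₁) fun pre w post hl s₂ hf₂ => ?_).mono ?_
  · rw [← List.append_assoc]
    exact step _ w post (by simp [hl]) s₂ (hf₁.trans hf₂)
  · rintro t₂ s₂ ⟨ht₂, hJ₂⟩
    rw [List.length_drop] at ht₁
    have hlen : (T + 3) * ((ord u).length - (c + 1)) + (T + 3) * c ≤ (T + 3) * (ord u).length := by
      rw [← mul_add]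
      exact Nat.mul_le_mul_left _ (by omega)
    exact ⟨by omega, hJ₂⟩

theorem IsOrderedTree.wp_forChildren (J : List (Fin n) → ℕ → (ℕ → ℕ) → Prop)
    (hT : IsOrderedTree G ord) (hs : s.Ready W n) (hu : s.reg Reg.vertex = u)
    (hp : s.reg Reg.parent = parent G r u)
    (hbody : ∀ a ∈ [Reg.zero, .one, .first, .last, .middle, .pointer], a.idx ∉ body.writes)
    (hacc : acc ∉ [Reg.first, .last, .middle, .entry, .pointer])
    (hread : ∀ pre a m, J pre a m → HasInput ord m) (start : J [] (s.reg acc) s.mem)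
    (step : ∀ pre (w : Fin n) post, childList G r ord u = pre ++ w :: post → ∀ s₁,
      Frame W (forChildren body) s s₁ → s₁.reg Reg.entry = w → J pre (s₁.reg acc) s₁.mem →
      WP W body s₁ fun t s₂ => t ≤ T ∧ J (pre ++ [w]) (s₂.reg acc) s₂.mem) :
    WP W (forChildren body) s fun t s' =>
      t ≤ (T + 9) * (ord u).length + 10 ∧ J (childList G r ord u) (s'.reg acc) s'.mem := by
  rw [forChildren, wp_seq]
  refine ((hT.wp_findChildren hs hu hp (hread _ _ _ start)).frame hs.toBounded).mono ?_
  rintro t₁ s₁ ⟨⟨ht₁, hfirst, hlast, hmiddle, hpointer, hmem⟩, hf₁⟩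
  have hs₁ := hs.frame hf₁ (by decide)
  simp only [List.mem_cons, List.not_mem_nil, or_false, not_or] at hacc
  have hacc₁ : s₁.reg acc = s.reg acc := hf₁.reg_eq acc (by
    simp [findChildren, findParent, forRange, Program.writes, Reg.idx_inj, hacc])
  refine (wp_forCut (T := T) J List.idxOf_le_length hs₁.toBounded hs₁.zero_eq
    hs₁.one_eq hfirst hlast hmiddle hpointer hbody (by simp [hacc]) hread
    (by rwa [hacc₁, hmem]) fun pre w post hl s₂ hf₂ =>
      step pre w post hl s₂ (hf₁.trans hf₂)).mono ?_
  rintro t₂ s₂ ⟨ht₂, hJ⟩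
  exact ⟨by linarith, hJ⟩

end Loops

/-! ### Search -/

section Table

variable {n W N i : ℕ} {G : SimpleGraph (Fin n)} {r u v : Fin n} {ord : Fin n → List (Fin n)}
  {D : Set (Arr × Fin n)} {s : Config}

/-- Vertex `i` of the search order. -/
noncomputable def searchVertex (G : SimpleGraph (Fin n)) (r : Fin n)
    (ord : Fin n → List (Fin n)) (i : ℕ) : Fin n :=
  (searchOrder G r ord).getD i r

/-- The final contents of the arrays. -/
noncomputable def table (G : SimpleGraph (Fin n)) (r : Fin n) (ord : Fin n → List (Fin n))
    (N : ℕ) : Arr → Fin n → ℕ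
  | .parent, v => (TreeDrawing.parent G r v : Fin n)
  | .order, i => searchVertex G r ord i
  | .size, v => subtreeSize G r v
  | .lo, v => (placement G r ord N v).lo
  | .hi, v => (placement G r ord N v).hi
  | .j, v => (placement G r ord N v).j
  | .k, v => (placement G r ord N v).k
  | .x, v => (placement G r ord N v).x
  | .y, v => (placement G r ord N v).y

/-- The entries of the arrays `parent` and `order` that are known when the search has found the
vertices in the list. -/
def found (L : List (Fin n)) : Set (Arr × Fin n) :=
  {q | q.1 = .parent ∧ q.2 ∈ L ∨ q.1 = .order ∧ q.2 < L.length}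

theorem searchVertex_eq {L : List (Fin n)}
    (hL : L <+: searchOrder G r ord) (hi : i < L.length) : searchVertex G r ord i = L[i] := by
  rw [searchVertex, List.getD_eq_getElem _ _ (hi.trans_le hL.length_le), hL.getElem hi]

theorem IsOrderedTree.sum_range_searchVertex (hT : IsOrderedTree G ord) (f : Fin n → ℕ) :
    ∑ i ∈ Finset.range n, f (searchVertex G r ord i) = ∑ v, f v := by
  have hlen := hT.length_searchOrder (r := r)
  rw [Fintype.card_fin] at hlen
  have huniv : (searchOrder G r ord).toFinset = Finset.univ :=
    Finset.eq_univ_of_forall fun v => List.mem_toFinset.2 (hT.mem_searchOrder v)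
  rw [← huniv, List.sum_toFinset _ hT.nodup_searchOrder, Finset.sum_range, ← List.sum_ofFn]
  congr 1
  refine List.ext_getElem (by simp [hlen]) fun i hi hi' => ?_
  rw [List.length_map] at hi'
  simp [searchVertex_eq List.prefix_rfl hi']

theorem IsOrderedTree.sum_range_le (hT : IsOrderedTree G ord) (r : Fin n) (a b : ℕ) :
    ∑ i ∈ Finset.range n, (a * (ord (searchVertex G r ord i)).length + b + 1) ≤
      (2 * a + b + 1) * n := by
  have hsum := hT.sum_length_ord
  rw [Fintype.card_fin] at hsum
  rw [hT.sum_range_searchVertex fun v => a * (ord v).length + b + 1]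
  simp only [Finset.sum_add_distrib, ← Finset.mul_sum, Finset.sum_const, Finset.card_univ,
    Fintype.card_fin, smul_eq_mul]
  nlinarith

theorem IsOrderedTree.length_searchPrefix_le (hT : IsOrderedTree G ord) (hi : i ≤ n) :
    (searchPrefix G r ord i).length ≤ n := by
  have := (searchPrefix_isPrefix (G := G) (r := r) (ord := ord) hi).length_le
  have hlen := hT.length_searchOrder (r := r)
  rw [searchOrder, Fintype.card_fin] at hlen
  omega

theorem IsOrderedTree.searchPrefix_searchVertex (hT : IsOrderedTree G ord) (r : Fin n)
    (hi : i < n) : searchPrefix G r ord (i + 1) =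
      searchPrefix G r ord i ++ childList G r ord (searchVertex G r ord i) := by
  have hlt := hT.lt_length_searchPrefix (r := r) ((Fintype.card_fin n).symm ▸ hi)
  rw [searchPrefix_succ hlt, ← searchVertex_eq (searchPrefix_isPrefix _) hlt]
  simpa using hi.le

/-- Let `vertex` be the vertex at `position` in the search order, and `parent` its parent. -/
def loadVertex : Program :=
  read .vertex .order .position ;; read .parent .parent .vertex

theorem wp_loadVertex (hs : s.Ready W n) (hm : Represents ord (table G r ord N) D s.mem)
    (hpos : s.reg Reg.position = i) (hi : i < n) (horder : (.order, ⟨i, hi⟩) ∈ D)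
    (hparent : (.parent, searchVertex G r ord i) ∈ D) :
    WP W loadVertex s fun t s' => t = 8 ∧ s'.reg Reg.vertex = searchVertex G r ord i ∧
      s'.reg Reg.parent = parent G r (searchVertex G r ord i) ∧ s'.mem = s.mem := by
  have hread : WP W (read .vertex .order .position) s fun t s' => t = 4 ∧
      s'.reg Reg.vertex = searchVertex G r ord i ∧ s'.mem = s.mem := by
    rw [wp_read (v := ⟨i, hi⟩) hs hm hpos horder (by simp)]
    exact ⟨rfl, by simp [Config.setReg_reg, table], rfl⟩
  rw [loadVertex, wp_seq]
  refine (hread.frame hs.toBounded).mono ?_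
  rintro _ s₁ ⟨⟨rfl, hv, hmem⟩, hf⟩
  rw [wp_read (hs.frame hf (by decide)) (hmem ▸ hm) hv hparent (by simp)]
  exact ⟨rfl, by simpa [Config.setReg_reg, Reg.idx_inj] using hv,
    by simp [Config.setReg_reg, table], hmem⟩

/-- Make `entry` a child of `vertex`, at the end of the search order so far. -/
def appendChild : Program :=
  write .parent .entry .vertex ;; write .order .tail .entry ;; .add .tail .tail .one

/-- Breadth-first search from `root`. -/
def search : Program :=
  write .parent .root .root ;; write .order .zero .root ;;
  .copy .position .zero ;; .copy .tail .one ;;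
  .whileLt Reg.position Reg.tail
    (loadVertex ;; forChildren appendChild ;; .add .position .position .one)

theorem IsOrderedTree.wp_appendChild (hT : IsOrderedTree G ord) (hs : s.Ready W n)
    {L : List (Fin n)} {w : Fin n} (hL : L ++ [w] <+: searchOrder G r ord)
    (hw : s.reg Reg.entry = w) (hu : s.reg Reg.vertex = parent G r w)
    (hL' : s.reg Reg.tail = L.length)
    (hm : Represents ord (table G r ord N) (found L) s.mem) :
    WP W appendChild s fun t s' => t ≤ 9 ∧ s'.reg Reg.tail = (L ++ [w]).length ∧
      Represents ord (table G r ord N) (found (L ++ [w])) s'.mem := by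
  have hlen : L.length < n := by
    have := hL.length_le
    simpa [hT.length_searchOrder] using this
  have hindex : searchVertex G r ord L.length = w := by
    simp [searchVertex_eq (i := L.length) hL]
  rw [appendChild, wp_seq]
  refine ((wp_write hT hs hm hw hu (by simp) (by simp)).frame hs.toBounded).mono ?_
  rintro _ s₁ ⟨⟨rfl, hm₁⟩, hf₁⟩
  have hs₁ := hs.frame hf₁ (by decide)
  have htail₁ := (hf₁.reg_eq Reg.tail (by decide)).trans hL'
  have hentry₁ := (hf₁.reg_eq Reg.entry (by decide)).trans hw
  rw [wp_seq]
  refine ((wp_write (v := ⟨L.length, hlen⟩) hT hs₁ hm₁ htail₁ ?_ (by simp) (by simp)).frame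
    hs₁.toBounded).mono ?_
  · simpa [table, hindex] using hentry₁
  rintro _ s₂ ⟨⟨rfl, hm₂⟩, hf₂⟩
  have hone₂ := (hs₁.frame hf₂ (by decide)).one_eq
  have htail₂ := (hf₂.reg_eq Reg.tail (by decide)).trans htail₁
  have hroom := hs.room
  rw [wp_arith, Op.eval, htail₂, hone₂]
  refine ⟨by omega, le_rfl, by simp [Config.setReg_reg], hm₂.mono ?_⟩
  rintro ⟨A, v⟩ h
  simp only [found, List.mem_append, List.mem_singleton, List.length_append, List.length_singleton,
    Set.mem_ofPred_eq, Set.mem_insert_iff, Prod.mk.injEq, Fin.ext_iff] at h ⊢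
  grind

theorem IsOrderedTree.wp_search_iteration (hT : IsOrderedTree G ord) (hs : s.Ready W n)
    (hi : i < n) (hpos : s.reg Reg.position = i)
    (htail : s.reg Reg.tail = (searchPrefix G r ord i).length)
    (hm : Represents ord (table G r ord N) (found (searchPrefix G r ord i)) s.mem) :
    WP W (loadVertex ;; forChildren appendChild ;; .add .position .position .one) s fun t s' =>
      t ≤ 18 * (ord (searchVertex G r ord i)).length + 19 ∧ s'.reg Reg.position = i + 1 ∧
      s'.reg Reg.tail = (searchPrefix G r ord (i + 1)).length ∧
      Represents ord (table G r ord N) (found (searchPrefix G r ord (i + 1))) s'.mem := by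
  have hlt := hT.lt_length_searchPrefix (r := r) ((Fintype.card_fin n).symm ▸ hi)
  have hpre : searchPrefix G r ord i <+: searchOrder G r ord :=
    searchPrefix_isPrefix (by simpa using hi.le)
  have hpre' : searchPrefix G r ord (i + 1) <+: searchOrder G r ord :=
    searchPrefix_isPrefix (by simpa using hi)
  have hsucc := hT.searchPrefix_searchVertex r hi
  rw [wp_seq]
  refine ((wp_loadVertex hs hm hpos hi (.inr ⟨rfl, hlt⟩) (.inl ⟨rfl, ?_⟩)).frame
    hs.toBounded).mono ?_
  · simp [searchVertex_eq hpre hlt]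
  rintro _ s₁ ⟨⟨rfl, hv, hp, hmem⟩, hf₁⟩
  have hs₁ := hs.frame hf₁ (by decide)
  have htail₁ := (hf₁.reg_eq Reg.tail (by decide)).trans htail
  rw [wp_seq]
  refine ((hT.wp_forChildren (T := 9) (acc := .tail) (fun pre a m =>
    a = (searchPrefix G r ord i ++ pre).length ∧
      Represents ord (table G r ord N) (found (searchPrefix G r ord i ++ pre)) m)
    hs₁ hv hp (by decide) (by simp) (fun _ _ _ h => h.2.toHasInput) ?_ ?_).frame
    hs₁.toBounded).mono ?_
  · simpa [htail₁, hmem] using hm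
  · rintro pre w post hl s₂ hf₂ hw ⟨ht₂, hm₂⟩
    have hchild : IsChild G r (searchVertex G r ord i) w := hT.mem_childList.1 (by simp [hl])
    rw [← List.append_assoc]
    refine hT.wp_appendChild (hs₁.frame hf₂ (by decide)) (List.IsPrefix.trans ⟨post, ?_⟩ hpre') hw
      ?_ ht₂ hm₂
    · simp [hsucc, hl]
    · rw [hchild.parent_eq hT.isTree, ← hv]
      exact hf₂.reg_eq _ (by decide)
  · rintro t₂ s₂ ⟨⟨ht₂, htail₂, hm₂⟩, hf₂⟩
    have hpos₂ := (hf₂.reg_eq Reg.position (by decide)).trans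
      ((hf₁.reg_eq _ (by decide)).trans hpos)
    have hone₂ := (hs₁.frame hf₂ (by decide)).one_eq
    have hroom := hs.room
    rw [wp_arith, Op.eval, hpos₂, hone₂, hsucc]
    refine ⟨by omega, by omega, by simp [Config.setReg_reg], ?_, hm₂⟩
    simpa [Config.setReg_reg, Reg.idx_inj] using htail₂

theorem IsOrderedTree.wp_search (hT : IsOrderedTree G ord) (hs : s.Ready W n)
    (hr : s.reg Reg.root = r) (hm : Represents ord (table G r ord N) ∅ s.mem) :
    WP W search s fun t s' => t ≤ 56 * n + 11 ∧
      Represents ord (table G r ord N) (found (searchOrder G r ord)) s'.mem := by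
  have hn : 0 < n := r.pos
  rw [search, wp_seq]
  refine ((wp_write hT hs hm hr ?_ (by simp) (by simp)).frame hs.toBounded).mono ?_
  · simpa [table, parent_root] using hr
  rintro _ s₁ ⟨⟨rfl, hm₁⟩, hf₁⟩
  have hs₁ := hs.frame hf₁ (by decide)
  rw [wp_seq]
  refine ((wp_write (v := ⟨0, hn⟩) hT hs₁ hm₁ hs₁.zero_eq ?_ (by simp) (by simp)).frame
    hs₁.toBounded).mono ?_
  · have h₀ : searchVertex G r ord 0 = r :=
      searchVertex_eq (searchPrefix_isPrefix (Nat.zero_le _)) (Nat.zero_lt_one)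
    simpa [table, h₀] using (hf₁.reg_eq Reg.root (by decide)).trans hr
  rintro _ s₂ ⟨⟨rfl, hm₂⟩, hf₂⟩
  have hs₂ := hs₁.frame hf₂ (by decide)
  have hroom := hs.room
  simp only [wp_seq, wp_arith, Op.eval, Config.setReg_reg, Reg.idx_inj, reduceCtorEq, if_false,
    hs₂.zero_eq, hs₂.one_eq]
  have hs₃ := (hs₂.setReg (d := Reg.position) (x := 0) (by omega) (by simp)).setReg
    (d := Reg.tail) (x := 1) (by omega) (by simp)
  refine ⟨by omega, by omega, (wp_whileLt (fun i s' => s'.reg Reg.position = i ∧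
    s'.reg Reg.tail = (searchPrefix G r ord i).length ∧
    Represents ord (table G r ord N) (found (searchPrefix G r ord i)) s'.mem) n
    (fun i => 18 * (ord (searchVertex G r ord i)).length + 19) hs₃.toBounded ?_ ?_ ?_).mono ?_⟩
  · refine ⟨by simp [Config.setReg_reg, Reg.idx_inj], by simp [Config.setReg_reg, searchPrefix],
      hm₂.mono ?_⟩
    rintro ⟨A, v⟩ h
    simpa [found, searchPrefix, Prod.ext_iff, Fin.ext_iff, or_comm] using h
  · rintro i hi s' hf ⟨hpos, htail, hm'⟩
    have hlt := hT.lt_length_searchPrefix (r := r) ((Fintype.card_fin n).symm ▸ hi)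
    exact ⟨by omega, hT.wp_search_iteration (hs₃.frame hf (by decide)) hi hpos htail hm'⟩
  · rintro s' - ⟨hpos, htail, -⟩
    have := hT.length_searchPrefix_le (r := r) le_rfl
    omega
  · rintro t s' ⟨ht, -, -, hm'⟩
    have := hT.sum_range_le r 18 19
    rw [searchOrder, Fintype.card_fin]
    exact ⟨by omega, hm'⟩

end Table

/-! ### Sizes of the subtrees -/

section Sizes

variable {n W N i : ℕ} {G : SimpleGraph (Fin n)} {r u v w : Fin n} {ord : Fin n → List (Fin n)}
  {D : Set (Arr × Fin n)} {s : Config}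

theorem IsOrderedTree.mem_drop_searchOrder (hT : IsOrderedTree G ord) (hi : i < n)
    (hw : IsChild G r (searchVertex G r ord i) w) : w ∈ (searchOrder G r ord).drop (i + 1) := by
  have hlen := hT.length_searchOrder (r := r)
  rw [Fintype.card_fin] at hlen
  have hi' : i < (searchOrder G r ord).length := hi.trans_eq hlen.symm
  obtain ⟨j, hj, rfl⟩ := List.getElem_of_mem (hT.mem_searchOrder (r := r) w)
  rw [searchVertex_eq List.prefix_rfl hi'] at hw
  have hij := hT.lt_of_isChild_getElem_searchOrder hi' hj hw
  exact List.mem_drop_iff_getElem.2 ⟨j - (i + 1), by omega, by congr 1; omega⟩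

/-- The entries of the arrays that are known when the sizes of the subtrees have been computed from
the end of the search order back to position `i`. -/
def sized (G : SimpleGraph (Fin n)) (r : Fin n) (ord : Fin n → List (Fin n)) (i : ℕ) :
    Set (Arr × Fin n) :=
  found (searchOrder G r ord) ∪ {q | q.1 = .size ∧ q.2 ∈ (searchOrder G r ord).drop i}

theorem IsOrderedTree.order_mem_sized (hT : IsOrderedTree G ord) (hi : i < n) (j : ℕ) :
    (.order, ⟨i, hi⟩) ∈ sized G r ord j :=
  .inl (.inr ⟨rfl, by simpa [hT.length_searchOrder] using hi⟩)

theorem IsOrderedTree.parent_mem_sized (hT : IsOrderedTree G ord) (v : Fin n) (j : ℕ) :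
    (.parent, v) ∈ sized G r ord j :=
  .inl (.inl ⟨rfl, hT.mem_searchOrder v⟩)

theorem IsOrderedTree.sized_subset (hT : IsOrderedTree G ord) (hi : i < n) :
    sized G r ord i ⊆ insert (.size, searchVertex G r ord i) (sized G r ord (i + 1)) := by
  have hi' : i < (searchOrder G r ord).length := by simpa [hT.length_searchOrder] using hi
  rintro ⟨A, v⟩ h
  rw [sized, List.drop_eq_getElem_cons hi', ← searchVertex_eq List.prefix_rfl hi'] at h
  simp only [sized, Set.mem_union, Set.mem_ofPred_eq, List.mem_cons, Set.mem_insert_iff,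
    Prod.mk.injEq] at h ⊢
  tauto

/-- Add the size of the subtree at `entry` to `total`. -/
def addSize : Program :=
  read .part .size .entry ;; .add .total .total .part

/-- Compute the size of the subtree at the vertex that precedes `position` in the search order, and
decrease `position`. -/
def computeSize : Program :=
  .sub .position .position .one ;; loadVertex ;; .copy .total .one ;;
  forChildren addSize ;; write .size .vertex .total

/-- Compute the sizes of all subtrees. -/
def computeSizes : Program :=
  .copy .position .count ;; .whileLt Reg.zero Reg.position computeSize

theorem wp_addSize (hs : s.Ready W n) (hm : Represents ord (table G r ord N) D s.mem)
    (hw : s.reg Reg.entry = w) (hD : (.size, w) ∈ D)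
    (hlt : s.reg Reg.total + subtreeSize G r w < W) :
    WP W addSize s fun t s' => t = 5 ∧
      s'.reg Reg.total = s.reg Reg.total + subtreeSize G r w ∧ s'.mem = s.mem := by
  rw [addSize, wp_seq, wp_read hs hm hw hD (by simp)]
  simpa [wp_arith, Op.eval, Config.setReg_reg, Config.setReg_mem, Reg.idx_inj, table] using hlt

theorem IsOrderedTree.wp_forChildren_addSize (hT : IsOrderedTree G ord) (hs : s.Ready W n)
    (hi : i < n) (hv : s.reg Reg.vertex = searchVertex G r ord i)
    (hp : s.reg Reg.parent = parent G r (searchVertex G r ord i)) (htotal : s.reg Reg.total = 1)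
    (hm : Represents ord (table G r ord N) (sized G r ord (i + 1)) s.mem) :
    WP W (forChildren addSize) s fun t s' =>
      t ≤ 14 * (ord (searchVertex G r ord i)).length + 10 ∧
      s'.reg Reg.total = subtreeSize G r (searchVertex G r ord i) ∧
      Represents ord (table G r ord N) (sized G r ord (i + 1)) s'.mem := by
  have hsize := hT.subtreeSize_eq r (searchVertex G r ord i)
  refine (hT.wp_forChildren (T := 5) (acc := .total) (fun pre a m =>
    a = 1 + (pre.map (subtreeSize G r)).sum ∧
      Represents ord (table G r ord N) (sized G r ord (i + 1)) m)
    hs hv hp (by decide) (by simp) (fun _ _ _ h => h.2.toHasInput) ⟨by simpa using htotal, hm⟩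
    ?_).mono ?_
  · rintro pre w post hl s₁ hf hw ⟨htotal₁, hm₁⟩
    have hchild : IsChild G r (searchVertex G r ord i) w := hT.mem_childList.1 (by simp [hl])
    have hle := (subtreeSize_le G r (searchVertex G r ord i)).trans_eq (Fintype.card_fin n)
    have hroom := hs.room
    rw [hl, List.map_append, List.map_cons, List.sum_append, List.sum_cons] at hsize
    refine (wp_addSize (hs.frame hf (by decide)) hm₁ hw
      (.inr ⟨rfl, hT.mem_drop_searchOrder hi hchild⟩) (by omega)).mono ?_
    rintro t s₂ ⟨rfl, htotal₂, hmem⟩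
    exact ⟨le_rfl, by simp [htotal₂, htotal₁, add_assoc], hmem ▸ hm₁⟩
  · rintro t s₁ ⟨ht, htotal₁, hm₁⟩
    exact ⟨ht, htotal₁.trans hsize.symm, hm₁⟩

theorem IsOrderedTree.wp_computeSize (hT : IsOrderedTree G ord) (hs : s.Ready W n) (hi : i < n)
    (hpos : s.reg Reg.position = i + 1)
    (hm : Represents ord (table G r ord N) (sized G r ord (i + 1)) s.mem) :
    WP W computeSize s fun t s' => t ≤ 14 * (ord (searchVertex G r ord i)).length + 24 ∧
      s'.reg Reg.position = i ∧
      Represents ord (table G r ord N) (sized G r ord i) s'.mem := by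
  have hroom := hs.room
  simp only [computeSize, wp_seq (p := .sub _ _ _), wp_arith, Op.eval, hpos, hs.one_eq,
    Nat.add_sub_cancel]
  have hs₀ := hs.setReg (d := Reg.position) (x := i) (by omega) (by simp)
  rw [wp_seq]
  refine ⟨by omega, ((wp_loadVertex hs₀ hm (by simp [Config.setReg_reg]) hi
    (hT.order_mem_sized hi _) (hT.parent_mem_sized _ _)).frame hs₀.toBounded).mono ?_⟩
  rintro _ s₁ ⟨⟨rfl, hv, hp, hmem⟩, hf₁⟩
  have hs₁ := hs₀.frame hf₁ (by decide)
  have hpos₁ := hf₁.reg_eq Reg.position (by decide)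
  simp only [Config.setReg_reg, if_true] at hpos₁
  simp only [wp_seq (p := .copy _ _), wp_arith, Op.eval, hs₁.zero_eq, hs₁.one_eq]
  have hs₂ := hs₁.setReg (d := Reg.total) (x := 1) (by omega) (by simp)
  rw [wp_seq]
  refine ⟨by omega, ((hT.wp_forChildren_addSize hs₂ hi ?_ ?_ ?_ (hmem ▸ hm)).frame
    hs₂.toBounded).mono ?_⟩
  · simpa [Config.setReg_reg, Reg.idx_inj] using hv
  · simpa [Config.setReg_reg, Reg.idx_inj] using hp
  · simp [Config.setReg_reg]
  rintro t s₃ ⟨⟨ht, htotal, hm₃⟩, hf₃⟩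
  have hv₃ := hf₃.reg_eq Reg.vertex (by decide)
  have hpos₃ := hf₃.reg_eq Reg.position (by decide)
  simp only [Config.setReg_reg, Reg.idx_inj, reduceCtorEq, if_false, hv, hpos₁] at hv₃ hpos₃
  have hs₃ := hs₂.frame hf₃ (by decide)
  refine ((wp_write hT hs₃ hm₃ hv₃ htotal (by simp) (by simp)).frame hs₃.toBounded).mono ?_
  rintro _ s₄ ⟨⟨rfl, hm₄⟩, hf₄⟩
  refine ⟨by omega, (hf₄.reg_eq _ (by decide)).trans hpos₃, hm₄.mono (hT.sized_subset hi)⟩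

theorem IsOrderedTree.wp_computeSizes (hT : IsOrderedTree G ord) (hs : s.Ready W n)
    (hm : Represents ord (table G r ord N) (found (searchOrder G r ord)) s.mem) :
    WP W computeSizes s fun t s' => t ≤ 53 * n + 2 ∧
      Represents ord (table G r ord N) (sized G r ord 0) s'.mem := by
  have hroom := hs.room
  have hn : n < W := by have := r.pos; omega
  simp only [computeSizes, wp_seq, wp_arith, Op.eval, hs.count_eq, hs.zero_eq]
  have hs₁ := hs.setReg (d := Reg.position) hn (by simp)
  refine ⟨hn, (wp_whileLt (fun i s' => s'.reg Reg.position = n - i ∧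
    Represents ord (table G r ord N) (sized G r ord (n - i)) s'.mem) n
    (fun i => 14 * (ord (searchVertex G r ord (n - 1 - i))).length + 24) hs₁.toBounded
    ⟨by simp [Config.setReg_reg], hm.mono ?_⟩ ?_ ?_).mono ?_⟩
  · have hlen := hT.length_searchOrder (r := r)
    rw [Fintype.card_fin] at hlen
    simp [sized, List.drop_of_length_le hlen.le]
  · rintro i hi s' hf ⟨hpos, hm'⟩
    have hs' := hs₁.frame hf (by decide)
    rw [show n - i = n - 1 - i + 1 by omega] at hpos hm'
    rw [show n - (i + 1) = n - 1 - i by omega]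
    exact ⟨by rw [hs'.zero_eq, hpos]; omega, hT.wp_computeSize hs' (by omega) hpos hm'⟩
  · rintro s' - ⟨hpos, -⟩
    simp [hpos]
  · rintro t s' ⟨ht, -, hm'⟩
    have hsum := hT.sum_range_le r 14 24
    rw [← Finset.sum_range_reflect] at hsum
    exact ⟨by omega, by simpa using hm'⟩

end Sizes

/-! ### Placement of a child -/

/-- All fields are at most `N`, and the interval is not reversed. -/
structure Placement.IsBounded (N : ℕ) (p : Placement) : Prop where
  lo_le_hi : p.lo ≤ p.hi
  hi_le : p.hi ≤ N
  j_le : p.j ≤ N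
  k_le : p.k ≤ N
  x_le : p.x ≤ N
  y_le : p.y ≤ N

/-- The registers without prime contain the fields of `p`. -/
structure Config.HasParent (p : Placement) (s : Config) : Prop where
  lo_eq : s.reg Reg.lo = p.lo
  hi_eq : s.reg Reg.hi = p.hi
  j_eq : s.reg Reg.j = p.j
  k_eq : s.reg Reg.k = p.k
  x_eq : s.reg Reg.x = p.x
  y_eq : s.reg Reg.y = p.y

theorem Config.HasParent.frame {W : ℕ} {p : Placement} {q : Program} {s s' : Config}
    (hp : s.HasParent p) (hf : Frame W q s s')
    (hq : ∀ a ∈ [Reg.lo, .hi, .j, .k, .x, .y], a.idx ∉ q.writes) : s'.HasParent p := by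
  constructor <;> rw [hf.reg_eq _ (hq _ (by simp))]
  exacts [hp.lo_eq, hp.hi_eq, hp.j_eq, hp.k_eq, hp.x_eq, hp.y_eq]

/-- The registers with prime contain the fields of `p`. -/
structure Config.HasChild (p : Placement) (s : Config) : Prop where
  lo_eq : s.reg Reg.lo' = p.lo
  hi_eq : s.reg Reg.hi' = p.hi
  j_eq : s.reg Reg.j' = p.j
  k_eq : s.reg Reg.k' = p.k
  x_eq : s.reg Reg.x' = p.x
  y_eq : s.reg Reg.y' = p.y

/-- Compute `Placement.split` for `span` and `offset`. -/
def computeSplit (d : Reg) : Program :=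
  .sub .left .hi .lo ;; .mul .left .left .offset ;; .div .left .left .span ;; .add d .lo .left

/-- Compute the quotient of `a` and `b`, rounded up. -/
def divUp (d a b : Reg) : Program :=
  .add d a b ;; .sub d d .one ;; .div d d b

/-- Compute the numerator and denominator that `Placement.chooseFraction` yields unless the given
fraction is possible. -/
def computeNewFraction : Program :=
  .sub .left .hi' .lo' ;; divUp .k' .width .left ;; .mul .right .k' .lo' ;;
  divUp .j' .right .width

/-- Compute `Placement.chooseFraction`. -/
def computeFraction : Program :=
  .mul .right .j .width ;; .mul .left .lo' .k ;;
  .ifLt Reg.right Reg.left computeNewFraction (.mul .left .hi' .k ;;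
    .ifLt Reg.right Reg.left (.copy .j' .j ;; .copy .k' .k) computeNewFraction)

/-- Compute `Placement.extend`. -/
def computeExtend : Program :=
  computeFraction ;; .add .x' .x .k' ;; .sub .x' .x' .j' ;; .add .y' .y .k'

/-- Compute `Placement.step`, and add `part` to `offset`. -/
def computeStep : Program :=
  computeSplit .lo' ;; .add .offset .offset .part ;; computeSplit .hi' ;; computeExtend

section Step

variable {n W N l h off sz S : ℕ} {p : Placement} {s : Config} {a b d : Reg}

theorem wp_computeSplit (hs : s.Bounded W) (hp : s.HasParent p) (hoff : s.reg Reg.offset = off)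
    (hspan : s.reg Reg.span = S) (hmul : (p.hi - p.lo) * off < W) (hsplit : p.split S off < W) :
    WP W (computeSplit d) s fun t s' => t = 4 ∧ s'.reg d = p.split S off ∧ s'.mem = s.mem := by
  have hsub : p.hi - p.lo < W := (Nat.sub_le _ _).trans_lt (hp.hi_eq ▸ hs.reg_lt _)
  rw [Placement.split] at hsplit ⊢
  simp [computeSplit, wp_seq, wp_arith, Op.eval, Config.setReg_reg, Config.setReg_mem, Reg.idx_inj,
    hp.lo_eq, hp.hi_eq, hoff, hspan, hsub, hmul, (Nat.div_le_self _ _).trans_lt hmul, hsplit]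

theorem wp_divUp (hone : s.reg Reg.one = 1) (hd : d ∉ [.one, b])
    (hadd : s.reg a + s.reg b < W) :
    WP W (divUp d a b) s fun t s' => t = 3 ∧ s' = s.setReg d (s.reg a ⌈/⌉ s.reg b) := by
  have hsub := (Nat.sub_le (s.reg a + s.reg b) 1).trans_lt hadd
  simp only [List.mem_cons, List.not_mem_nil, or_false, not_or, @eq_comm _ d] at hd
  simp [divUp, wp_seq, wp_arith, Op.eval, Config.setReg_reg, Config.setReg_setReg, Reg.idx_inj,
    hone, hd, hadd, hsub, (Nat.div_le_self _ _).trans_lt hsub, Nat.ceilDiv_eq_add_pred_div]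

theorem ceilDiv_le_self (N w : ℕ) : N ⌈/⌉ w ≤ N := by
  rcases w.eq_zero_or_pos with rfl | hw
  · simp
  · exact (ceilDiv_le_iff_le_mul hw).2 (Nat.le_mul_of_pos_left N hw)

theorem wp_computeNewFraction (hs : s.Ready W n) (hW : N * N + 2 * N < W)
    (hwidth : s.reg Reg.width = N) (hlo : s.reg Reg.lo' = l) (hhi : s.reg Reg.hi' = h)
    (hlh : l ≤ h) (hN : h ≤ N) :
    WP W computeNewFraction s fun t s' => t = 8 ∧
      s'.reg Reg.j' = (N ⌈/⌉ (h - l)) * l ⌈/⌉ N ∧ s'.reg Reg.k' = N ⌈/⌉ (h - l) ∧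
      s'.mem = s.mem := by
  have hmul : (N ⌈/⌉ (h - l)) * l ≤ N * N := Nat.mul_le_mul (ceilDiv_le_self _ _) (hlh.trans hN)
  simp only [computeNewFraction, wp_seq, wp_arith, Op.eval, hlo, hhi]
  refine ⟨by omega, (wp_divUp ?_ (by simp) ?_).mono ?_⟩
  · simpa [Config.setReg_reg, Reg.idx_inj] using hs.one_eq
  · simp [Config.setReg_reg, Reg.idx_inj, hwidth]
    omega
  rintro _ s₁ ⟨rfl, rfl⟩
  simp only [Config.setReg_reg, Reg.idx_inj, reduceCtorEq, if_true, if_false, hwidth, hlo]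
  refine ⟨by omega, (wp_divUp ?_ (by simp) ?_).mono ?_⟩
  · simpa [Config.setReg_reg, Reg.idx_inj] using hs.one_eq
  · simp [Config.setReg_reg, Reg.idx_inj, hwidth]
    omega
  rintro _ s₂ ⟨rfl, rfl⟩
  simp [Config.setReg_reg, Config.setReg_mem, Reg.idx_inj, hwidth]

theorem wp_computeFraction (hs : s.Ready W n) (hW : N * N + 2 * N < W)
    (hwidth : s.reg Reg.width = N) (hp : s.HasParent p) (hpN : p.IsBounded N)
    (hlo : s.reg Reg.lo' = l) (hhi : s.reg Reg.hi' = h) (hlh : l ≤ h) (hN : h ≤ N) :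
    WP W computeFraction s fun t s' => t ≤ 13 ∧
      s'.reg Reg.j' = (Placement.chooseFraction N l h p.j p.k).1 ∧
      s'.reg Reg.k' = (Placement.chooseFraction N l h p.j p.k).2 ∧ s'.mem = s.mem := by
  have hj : p.j * N < W := by have := Nat.mul_le_mul_right N hpN.j_le; omega
  have hk {m : ℕ} (hm : m ≤ N) : m * p.k < W := by have := Nat.mul_le_mul hm hpN.k_le; omega
  have hlk := hk (hlh.trans hN)
  have hhk := hk hN
  have hnew {x y : ℕ} (hx : x < W) (hy : y < W) :=
    wp_computeNewFraction ((hs.setReg (d := .right) hx (by simp)).setReg (d := .left) hy (by simp))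
      hW (by simpa [Config.setReg_reg, Reg.idx_inj] using hwidth)
      (by simpa [Config.setReg_reg, Reg.idx_inj] using hlo)
      (by simpa [Config.setReg_reg, Reg.idx_inj] using hhi) hlh hN
  simp only [computeFraction, wp_seq (p := .mul _ _ _), wp_arith, wp_ifLt, Op.eval,
    Config.setReg_reg, Reg.idx_inj, reduceCtorEq, if_true, if_false, hwidth, hlo, hhi, hp.j_eq,
    hp.k_eq, Config.setReg_setReg, hj, hlk, hhk, true_and, Placement.chooseFraction, FractionMem]
  by_cases hl : l * p.k ≤ p.j * N
  · by_cases hh : p.j * N < h * p.k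
    · have hjW := hs.reg_lt Reg.j
      have hkW := hs.reg_lt Reg.k
      simp [hl, hh, hl.not_gt, wp_seq, wp_arith, Op.eval, Config.setReg_reg, Config.setReg_mem,
        Reg.idx_inj, hp.j_eq ▸ hjW, hp.k_eq ▸ hkW, hs.zero_eq, hp.j_eq, hp.k_eq]
    · simp only [hl, hh, hl.not_gt, if_false, and_false]
      refine (hnew hj hhk).mono ?_
      rintro _ s' ⟨rfl, h⟩
      exact ⟨by omega, h⟩
  · simp only [hl, lt_of_not_ge hl, if_true, if_false, false_and]
    refine (hnew hj hlk).mono ?_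
    rintro _ s' ⟨rfl, h⟩
    exact ⟨by omega, h⟩

theorem wp_computeExtend (hs : s.Ready W n) (hW : N * N + 2 * N < W)
    (hwidth : s.reg Reg.width = N) (hp : s.HasParent p) (hpN : p.IsBounded N)
    (hlo : s.reg Reg.lo' = l) (hhi : s.reg Reg.hi' = h) (hlh : l ≤ h) (hN : h ≤ N) :
    WP W computeExtend s fun t s' =>
      t ≤ 16 ∧ s'.HasChild (p.extend N l h) ∧ s'.mem = s.mem := by
  have hk : (Placement.chooseFraction N l h p.j p.k).2 ≤ N := by
    unfold Placement.chooseFraction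
    split_ifs
    exacts [hpN.k_le, ceilDiv_le_self _ _]
  have hx := hpN.x_le
  have hy := hpN.y_le
  rw [computeExtend, wp_seq]
  refine ((wp_computeFraction hs hW hwidth hp hpN hlo hhi hlh hN).frame hs.toBounded).mono ?_
  rintro t s₁ ⟨⟨ht, hj, hk, hmem⟩, hf⟩
  have hx₁ := (hf.reg_eq Reg.x (by decide)).trans hp.x_eq
  have hy₁ := (hf.reg_eq Reg.y (by decide)).trans hp.y_eq
  have hlo₁ := (hf.reg_eq Reg.lo' (by decide)).trans hlo
  have hhi₁ := (hf.reg_eq Reg.hi' (by decide)).trans hhi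
  simp only [wp_seq, wp_arith, Op.eval, Config.setReg_reg, Config.setReg_mem, Reg.idx_inj,
    reduceCtorEq, if_true, if_false, hx₁, hy₁, hj, hk, Config.setReg_setReg]
  refine ⟨by omega, by omega, by omega, by omega, ?_, hmem⟩
  constructor <;> simp [Config.setReg_reg, Reg.idx_inj, Placement.extend, *]

theorem wp_computeStep (hs : s.Ready W n) (hW : N * N + 2 * N < W)
    (hwidth : s.reg Reg.width = N) (hp : s.HasParent p) (hpN : p.IsBounded N)
    (hoff : s.reg Reg.offset = off) (hpart : s.reg Reg.part = sz) (hspan : s.reg Reg.span = S)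
    (hS : off + sz ≤ S) (hSN : S ≤ N) :
    WP W computeStep s fun t s' => t ≤ 25 ∧ s'.reg Reg.offset = off + sz ∧
      s'.HasChild (p.step N off sz S) ∧ s'.mem = s.mem := by
  have hmul {m : ℕ} (hm : m ≤ S) : (p.hi - p.lo) * m < W := by
    have := Nat.mul_le_mul ((Nat.sub_le p.hi p.lo).trans hpN.hi_le) (hm.trans hSN)
    omega
  have hsplit {m : ℕ} (hm : m ≤ S) : p.split S m ≤ N :=
    (Placement.split_mem_Icc hpN.lo_le_hi hm).2.trans hpN.hi_le
  have hle : off ≤ S := by omega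
  rw [computeStep, wp_seq]
  refine ((wp_computeSplit hs.toBounded hp hoff hspan (hmul hle)
    (by have := hsplit hle; omega)).frame hs.toBounded).mono ?_
  rintro _ s₁ ⟨⟨rfl, hlo₁, hmem₁⟩, hf₁⟩
  have hs₁ := hs.frame hf₁ (by decide)
  have hadd : WP W (.add .offset .offset .part) s₁ fun t s' =>
      t = 1 ∧ s'.reg Reg.offset = off + sz ∧ s'.mem = s₁.mem := by
    rw [wp_arith, Op.eval, (hf₁.reg_eq Reg.offset (by decide)).trans hoff,
      (hf₁.reg_eq Reg.part (by decide)).trans hpart]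
    exact ⟨by omega, rfl, by simp [Config.setReg_reg], rfl⟩
  rw [wp_seq]
  refine (hadd.frame hs₁.toBounded).mono ?_
  rintro _ s₂ ⟨⟨rfl, hoff₂, hmem₂⟩, hf₂⟩
  have hs₂ := hs₁.frame hf₂ (by decide)
  have hf₁₂ := hf₁.trans hf₂
  rw [wp_seq]
  refine ((wp_computeSplit hs₂.toBounded (hp.frame hf₁₂ (by decide)) hoff₂
    ((hf₁₂.reg_eq Reg.span (by decide)).trans hspan) (hmul hS)
    (by have := hsplit hS; omega)).frame hs₂.toBounded).mono ?_
  rintro _ s₃ ⟨⟨rfl, hhi₃, hmem₃⟩, hf₃⟩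
  have hs₃ := hs₂.frame hf₃ (by decide)
  have hf₁₃ := hf₁₂.trans hf₃
  have hlo₃ := ((hf₂.trans hf₃).reg_eq Reg.lo' (by decide)).trans hlo₁
  refine ((wp_computeExtend hs₃ hW ((hf₁₃.reg_eq Reg.width (by decide)).trans hwidth)
    (hp.frame hf₁₃ (by decide)) hpN hlo₃ hhi₃ (p.split_mono S (Nat.le_add_right _ _))
    (hsplit hS)).frame hs₃.toBounded).mono ?_
  rintro t s₄ ⟨⟨ht, hchild, hmem₄⟩, hf₄⟩
  exact ⟨by omega, ((hf₃.trans hf₄).reg_eq Reg.offset (by decide)).trans hoff₂, hchild,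
    by rw [hmem₄, hmem₃, hmem₂, hmem₁]⟩

end Step

/-! ### Placement of all vertices -/

/-- The arrays of placements, with the registers for the parent. -/
def parentRegs : List (Arr × Reg) :=
  [(.lo, .lo), (.hi, .hi), (.j, .j), (.k, .k), (.x, .x), (.y, .y)]

/-- The arrays of placements, with the registers for the child. -/
def childRegs : List (Arr × Reg) :=
  [(.lo, .lo'), (.hi, .hi'), (.j, .j'), (.k, .k'), (.x, .x'), (.y, .y')]

/-- The arrays of placements, with registers that contain `Placement.root`. -/
def rootRegs : List (Arr × Reg) :=
  [(.lo, .zero), (.hi, .width), (.j, .zero), (.k, .one), (.x, .zero), (.y, .zero)]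

/-- Place the child at `entry` of `vertex`. -/
def placeChild : Program :=
  read .part .size .entry ;; computeStep ;; writeAll .entry childRegs

/-- Load what is needed to place the children of the vertex at `position` in the search order. -/
def loadPlacement : Program :=
  loadVertex ;; readAll .vertex parentRegs ;; read .span .size .vertex ;;
  .sub .span .span .one ;; .copy .offset .zero

/-- Place the children of the vertex at `position` in the search order. -/
def placeVertex : Program :=
  loadPlacement ;; forChildren placeChild ;; .add .position .position .one

/-- Place all vertices. -/
def placeAll : Program :=
  writeAll .root rootRegs ;; .copy .position .zero ;; .whileLt Reg.position Reg.count placeVertex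

section Place

variable {n W N i : ℕ} {G : SimpleGraph (Fin n)} {r u v w : Fin n} {ord : Fin n → List (Fin n)}
  {L : List (Fin n)} {D : Set (Arr × Fin n)} {s : Config}

/-- The entries of the arrays that are known when the vertices in the list have been placed. -/
def placed (G : SimpleGraph (Fin n)) (r : Fin n) (ord : Fin n → List (Fin n))
    (L : List (Fin n)) : Set (Arr × Fin n) :=
  sized G r ord 0 ∪ {q | q.1 ∈ [.lo, .hi, .j, .k, .x, .y] ∧ q.2 ∈ L}

theorem IsOrderedTree.size_mem_placed (hT : IsOrderedTree G ord) (v : Fin n) (L : List (Fin n)) :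
    (.size, v) ∈ placed G r ord L :=
  .inl (.inr ⟨rfl, hT.mem_searchOrder v⟩)

theorem placed_append_singleton {l : List (Arr × Reg)}
    (hl : l.map Prod.fst = [.lo, .hi, .j, .k, .x, .y]) :
    placed G r ord (L ++ [w]) =
      placed G r ord L ∪ {q | q.1 ∈ l.map Prod.fst ∧ q.2 = w} := by
  ext q
  simp only [placed, hl, Set.mem_union, Set.mem_ofPred_eq, List.mem_append, List.mem_singleton]
  tauto

theorem IsOrderedTree.isBounded_placement (hT : IsOrderedTree G ord) (hN : n ^ 3 < N) :
    (placement G r ord N v).IsBounded N := by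
  have h := hT.admissible_placement (N := N) (by rwa [Fintype.card_fin]) r v
  have hy := hT.y_placement_lt (N := N) (by rwa [Fintype.card_fin]) r v
  rw [Fintype.card_fin] at hy
  have hnN : 2 * n ≤ N := by
    rcases n with _ | _ | n
    · exact Nat.zero_le _
    · omega
    · nlinarith [Nat.zero_le (n ^ 3)]
  have := h.j_lt
  have := h.k_le
  have := h.x_le
  exact ⟨h.lo_lt_hi.le, h.hi_le, by omega, by omega, by omega, by omega⟩

theorem IsOrderedTree.wp_placeChild (hT : IsOrderedTree G ord) (hN : n ^ 3 < N)
    (hW : N * N + 2 * N < W) (hs : s.Ready W n) (hwidth : s.reg Reg.width = N)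
    (hp : s.HasParent (placement G r ord N u)) (huw : IsChild G r u w)
    (hw : s.reg Reg.entry = w) (hoff : s.reg Reg.offset = siblingOffset G r ord w)
    (hspan : s.reg Reg.span = subtreeSize G r u - 1)
    (hm : Represents ord (table G r ord N) (placed G r ord L) s.mem) :
    WP W placeChild s fun t s' => t ≤ 54 ∧
      s'.reg Reg.offset = siblingOffset G r ord w + subtreeSize G r w ∧
      Represents ord (table G r ord N) (placed G r ord (L ++ [w])) s'.mem := by
  have hsize : WP W (read .part .size .entry) s fun t s' =>
      t = 4 ∧ s'.reg Reg.part = subtreeSize G r w ∧ s'.mem = s.mem := by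
    rw [wp_read hs hm hw (hT.size_mem_placed w L) (by simp)]
    exact ⟨rfl, by simp [Config.setReg_reg, table], rfl⟩
  rw [placeChild, wp_seq]
  refine (hsize.frame hs.toBounded).mono ?_
  rintro _ s₁ ⟨⟨rfl, hpart, hmem₁⟩, hf₁⟩
  have hs₁ := hs.frame hf₁ (by decide)
  have hSN : subtreeSize G r u - 1 ≤ N := by
    have := (subtreeSize_le G r u).trans_eq (Fintype.card_fin n)
    have := Nat.le_self_pow (show 3 ≠ 0 by simp) n
    omega
  rw [wp_seq]
  refine ((wp_computeStep hs₁ hW ((hf₁.reg_eq Reg.width (by decide)).trans hwidth)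
    (hp.frame hf₁ (by decide)) (hT.isBounded_placement hN)
    ((hf₁.reg_eq Reg.offset (by decide)).trans hoff) hpart
    ((hf₁.reg_eq Reg.span (by decide)).trans hspan) (hT.siblingOffset_add_le huw) hSN).frame
    hs₁.toBounded).mono ?_
  rintro t₂ s₂ ⟨⟨ht₂, hoff₂, hchild, hmem₂⟩, hf₂⟩
  rw [← hT.placement_child huw] at hchild
  have hs₂ := hs₁.frame hf₂ (by decide)
  have hw₂ := ((hf₁.trans hf₂).reg_eq Reg.entry (by decide)).trans hw
  refine ((wp_writeAll (l := childRegs) hT hs₂ (v := w) (f := table G r ord N)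
    (by rwa [hmem₂, hmem₁]) hw₂ ?_ (by simp) (by simp [childRegs])).frame hs₂.toBounded).mono ?_
  · simp [childRegs, table, hchild.lo_eq, hchild.hi_eq, hchild.j_eq, hchild.k_eq, hchild.x_eq,
      hchild.y_eq]
  · rintro t₃ s₃ ⟨⟨ht₃, hm₃⟩, hf₃⟩
    have hlen : childRegs.length = 6 := rfl
    rw [placed_append_singleton (l := childRegs) rfl]
    exact ⟨by omega, (hf₃.reg_eq Reg.offset (by decide)).trans hoff₂, hm₃⟩

theorem IsOrderedTree.wp_loadPlacement (hT : IsOrderedTree G ord) (hs : s.Ready W n) (hi : i < n)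
    (hpos : s.reg Reg.position = i) (hL : searchVertex G r ord i ∈ L)
    (hm : Represents ord (table G r ord N) (placed G r ord L) s.mem) :
    WP W loadPlacement s fun t s' => t ≤ 39 ∧
      s'.reg Reg.vertex = searchVertex G r ord i ∧
      s'.reg Reg.parent = parent G r (searchVertex G r ord i) ∧
      s'.HasParent (placement G r ord N (searchVertex G r ord i)) ∧
      s'.reg Reg.span = subtreeSize G r (searchVertex G r ord i) - 1 ∧
      s'.reg Reg.offset = 0 ∧ s'.mem = s.mem := by
  rw [loadPlacement, wp_seq]
  refine ((wp_loadVertex hs hm hpos hi (.inl (hT.order_mem_sized hi 0))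
    (.inl (hT.parent_mem_sized _ 0))).frame hs.toBounded).mono ?_
  rintro _ s₁ ⟨⟨rfl, hv, hp, hmem₁⟩, hf₁⟩
  have hs₁ := hs.frame hf₁ (by decide)
  rw [wp_seq]
  refine ((wp_readAll (l := parentRegs) hs₁ (hmem₁ ▸ hm) hv ?_ ?_ ?_ (by simp)).frame
    hs₁.toBounded).mono ?_
  · simp [parentRegs, placed, hL]
  · simp [parentRegs]
  · simp [parentRegs]
  rintro t₂ s₂ ⟨⟨ht₂, hreg, hmem₂⟩, hf₂⟩
  have hs₂ := hs₁.frame hf₂ (by decide)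
  have hv₂ := (hf₂.reg_eq Reg.vertex (by decide)).trans hv
  have hp₂ := (hf₂.reg_eq Reg.parent (by decide)).trans hp
  have hparent : s₂.HasParent (placement G r ord N (searchVertex G r ord i)) := by
    simp only [parentRegs, List.forall_mem_cons, table] at hreg
    obtain ⟨hlo, hhi, hj, hk, hx, hy, -⟩ := hreg
    exact ⟨hlo, hhi, hj, hk, hx, hy⟩
  have hspan : WP W (read .span .size .vertex ;; .sub .span .span .one ;; .copy .offset .zero) s₂
      fun t s' => t = 6 ∧ s'.reg Reg.span = subtreeSize G r (searchVertex G r ord i) - 1 ∧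
        s'.reg Reg.offset = 0 ∧ s'.mem = s₂.mem := by
    have hroom := hs.room
    have hle := (subtreeSize_le G r (searchVertex G r ord i)).trans_eq (Fintype.card_fin n)
    rw [wp_seq, wp_read hs₂ (by rwa [hmem₂, hmem₁]) hv₂ (hT.size_mem_placed _ L) (by simp)]
    simp only [wp_seq, wp_arith, Op.eval, Config.setReg_reg, Config.setReg_mem, Reg.idx_inj,
      reduceCtorEq, if_true, if_false, hs₂.one_eq, hs₂.zero_eq, table]
    exact ⟨by omega, by omega, by simp⟩
  refine (hspan.frame hs₂.toBounded).mono ?_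
  rintro _ s₃ ⟨⟨rfl, hspan₃, hoff₃, hmem₃⟩, hf₃⟩
  have hlen : parentRegs.length = 6 := rfl
  refine ⟨by omega, (hf₃.reg_eq _ (by decide)).trans hv₂,
    (hf₃.reg_eq _ (by decide)).trans hp₂, hparent.frame hf₃ (by decide), hspan₃, hoff₃,
    by rw [hmem₃, hmem₂, hmem₁]⟩

theorem IsOrderedTree.wp_placeVertex (hT : IsOrderedTree G ord) (hN : n ^ 3 < N)
    (hW : N * N + 2 * N < W) (hs : s.Ready W n) (hwidth : s.reg Reg.width = N) (hi : i < n)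
    (hpos : s.reg Reg.position = i)
    (hm : Represents ord (table G r ord N) (placed G r ord (searchPrefix G r ord i)) s.mem) :
    WP W placeVertex s fun t s' => t ≤ 63 * (ord (searchVertex G r ord i)).length + 50 ∧
      s'.reg Reg.position = i + 1 ∧
      Represents ord (table G r ord N) (placed G r ord (searchPrefix G r ord (i + 1))) s'.mem := by
  have hlt := hT.lt_length_searchPrefix (r := r) ((Fintype.card_fin n).symm ▸ hi)
  have hmem : searchVertex G r ord i ∈ searchPrefix G r ord i := by
    rw [searchVertex_eq (searchPrefix_isPrefix (by simpa using hi.le)) hlt]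
    exact List.getElem_mem hlt
  rw [placeVertex, wp_seq]
  refine ((hT.wp_loadPlacement hs hi hpos hmem hm).frame hs.toBounded).mono ?_
  rintro t₁ s₁ ⟨⟨ht₁, hv, hp, hparent, hspan, hoff, hmem₁⟩, hf₁⟩
  have hs₁ := hs.frame hf₁ (by decide)
  rw [wp_seq]
  refine ((hT.wp_forChildren (T := 54) (acc := .offset) (fun pre a m =>
    a = (pre.map (subtreeSize G r)).sum ∧
      Represents ord (table G r ord N) (placed G r ord (searchPrefix G r ord i ++ pre)) m)
    hs₁ hv hp (by decide) (by simp) (fun _ _ _ h => h.2.toHasInput) ?_ ?_).frame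
    hs₁.toBounded).mono ?_
  · simpa [hoff, hmem₁] using hm
  · rintro pre w post hl s₂ hf₂ hw ⟨hoff₂, hm₂⟩
    have hchild : IsChild G r (searchVertex G r ord i) w := hT.mem_childList.1 (by simp [hl])
    have hsib := hT.siblingOffset_eq hl
    refine (hT.wp_placeChild hN hW (hs₁.frame hf₂ (by decide))
      (((hf₁.trans hf₂).reg_eq Reg.width (by decide)).trans hwidth)
      (hparent.frame hf₂ (by decide)) hchild hw (hoff₂.trans hsib.symm)
      ((hf₂.reg_eq Reg.span (by decide)).trans hspan) hm₂).mono ?_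
    rintro t₃ s₃ ⟨ht₃, hoff₃, hm₃⟩
    exact ⟨ht₃, by simp [hoff₃, hsib], by rwa [← List.append_assoc]⟩
  · rintro t₂ s₂ ⟨⟨ht₂, -, hm₂⟩, hf₂⟩
    have hpos₂ := ((hf₁.trans hf₂).reg_eq Reg.position (by decide)).trans hpos
    have hroom := hs.room
    rw [wp_arith, Op.eval, hpos₂, (hs₁.frame hf₂ (by decide)).one_eq,
      hT.searchPrefix_searchVertex r hi]
    exact ⟨by omega, by omega, by simp [Config.setReg_reg], hm₂⟩

theorem IsOrderedTree.wp_placeAll (hT : IsOrderedTree G ord) (hN : n ^ 3 < N)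
    (hW : N * N + 2 * N < W) (hs : s.Ready W n) (hwidth : s.reg Reg.width = N)
    (hr : s.reg Reg.root = r)
    (hm : Represents ord (table G r ord N) (sized G r ord 0) s.mem) :
    WP W placeAll s fun t s' => t ≤ 177 * n + 27 ∧
      Represents ord (table G r ord N) (placed G r ord (searchOrder G r ord)) s'.mem := by
  have hm₀ : Represents ord (table G r ord N) (placed G r ord []) s.mem := by
    simpa [placed] using hm
  rw [placeAll, wp_seq]
  refine ((wp_writeAll (l := rootRegs) hT hs hm₀ hr ?_ (by simp) (by simp [rootRegs])).frame
    hs.toBounded).mono ?_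
  · simp [rootRegs, table, placement_root, Placement.root, hs.zero_eq, hs.one_eq, hwidth]
  rintro t₁ s₁ ⟨⟨ht₁, hm₁⟩, hf₁⟩
  rw [← placed_append_singleton rfl] at hm₁
  have hs₁ := hs.frame hf₁ (by decide)
  have hwidth₁ := (hf₁.reg_eq Reg.width (by decide)).trans hwidth
  simp only [wp_seq, wp_arith, Op.eval, hs₁.zero_eq]
  have hs₂ := hs₁.setReg (d := Reg.position) (x := 0) (by omega) (by simp)
  refine ⟨by omega, (wp_whileLt (fun i s' => s'.reg Reg.position = i ∧
    Represents ord (table G r ord N) (placed G r ord (searchPrefix G r ord i)) s'.mem) n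
    (fun i => 63 * (ord (searchVertex G r ord i)).length + 50) hs₂.toBounded
    ⟨by simp [Config.setReg_reg], hm₁⟩ ?_ ?_).mono ?_⟩
  · rintro i hi s' hf ⟨hpos, hm'⟩
    have hs' := hs₂.frame hf (by decide)
    refine ⟨by rwa [hpos, hs'.count_eq], hT.wp_placeVertex hN hW hs' ?_ hi hpos hm'⟩
    rw [hf.reg_eq _ (by decide), Config.setReg_reg, if_neg (by decide), hwidth₁]
  · rintro s' hf ⟨hpos, -⟩
    rw [hpos, (hs₂.frame hf (by decide)).count_eq]
    exact lt_irrefl n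
  · rintro t s' ⟨ht, -, hm'⟩
    have := hT.sum_range_le r 63 50
    have hlen : rootRegs.length = 6 := rfl
    rw [searchOrder, Fintype.card_fin]
    exact ⟨by omega, hm'⟩

end Place

/-! ### The drawing program -/

/-- Initialize the registers that the program never changes. -/
def initRegs : Program :=
  .const Reg.one 1 ;; .mul .width .count .count ;; .mul .width .width .count ;;
  .add .width .width .one

/-- Put the addresses of the arrays of coordinates where `outputDrawing` expects them. -/
def setOutput : Program :=
  locate .y .zero ;; .copy .root .address ;; locate .x .zero ;; .copy .count .address

/-- Compute `treeDrawing`. -/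
def drawTree : Program :=
  initRegs ;; search ;; computeSizes ;; placeAll ;; setOutput

section Draw

variable {n W : ℕ} {G : SimpleGraph (Fin n)} {r : Fin n} {ord : Fin n → List (Fin n)} {s : Config}

theorem IsOrderedTree.lt_of_mem_inputWords (hT : IsOrderedTree G ord) {x : ℕ}
    (hx : x ∈ inputWords ord) : x < 3 * n := by
  simp only [inputWords, List.mem_append, List.mem_map, List.mem_range, List.mem_flatMap,
    List.bind_eq_flatMap, List.pure_def, List.mem_singleton] at hx
  rcases hx with ⟨i, hi, rfl⟩ | ⟨-, -, -, ⟨w, -, rfl⟩, rfl⟩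
  · exact hT.listAddr_lt (Nat.le_of_lt_succ hi)
  · have := w.isLt
    omega

theorem IsOrderedTree.bounded_inputConfig (hT : IsOrderedTree G ord) (r : Fin n)
    (hW : 3 * n ≤ W) : (inputConfig r ord).Bounded W := by
  have hr := r.isLt
  refine ⟨fun d => ?_, fun a => ?_⟩
  · simp only [inputConfig]
    split_ifs <;> omega
  · rcases lt_or_ge a (inputWords ord).length with ha | ha
    · simp only [inputConfig, List.getD_eq_getElem _ _ ha]
      exact (hT.lt_of_mem_inputWords (List.getElem_mem ha)).trans_le hW
    · simp only [inputConfig, List.getD_eq_default _ _ ha]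
      omega

theorem IsOrderedTree.wp_initRegs (hT : IsOrderedTree G ord) (r : Fin n) (hW : 12 * n ≤ W)
    (hW' : n ^ 3 + 1 < W) :
    WP W initRegs (inputConfig r ord) fun t s => t = 4 ∧ s.Ready W n ∧
      s.reg Reg.width = n ^ 3 + 1 ∧ s.reg Reg.root = r ∧ s.mem = (inputConfig r ord).mem := by
  have hs := hT.bounded_inputConfig r (W := W) (by omega)
  have hsq : n * n ≤ n ^ 3 := by nlinarith [r.pos]
  have hregs : WP W initRegs (inputConfig r ord) fun t s => t = 4 ∧ s.reg Reg.one = 1 ∧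
      s.reg Reg.width = n ^ 3 + 1 ∧ s.mem = (inputConfig r ord).mem := by
    have hcount : (inputConfig r ord).reg Reg.count = n := rfl
    simp only [initRegs, wp_seq, wp_const, wp_arith, Op.eval, Config.setReg_reg,
      Config.setReg_mem, Reg.idx_inj, reduceCtorEq, if_true, if_false, hcount, true_and, and_true]
    exact ⟨by omega, by omega, by nlinarith, by nlinarith, by ring⟩
  refine (hregs.frame hs).mono ?_
  rintro _ s ⟨⟨rfl, hone, hwidth, hmem⟩, hf⟩
  exact ⟨rfl, ⟨hf.bounded, hW, hf.reg_eq _ (by decide), hf.reg_eq _ (by decide), hone⟩, hwidth,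
    hf.reg_eq _ (by decide), hmem⟩

theorem wp_setOutput (hs : s.Ready W n) (hn : 0 < n) :
    WP W setOutput s fun t s' => t = 8 ∧ s'.reg Reg.count = addr n .x 0 ∧
      s'.reg Reg.root = addr n .y 0 ∧ s'.mem = s.mem := by
  have hy : addr n .y 0 < W := (addr_lt .y hn).trans_le hs.room
  have hx : addr n .x 0 < W := (addr_lt .x hn).trans_le hs.room
  have hs' := (hs.setReg (d := .address) hy (by simp)).setReg (d := .root) hy (by simp)
  rw [setOutput, wp_seq, wp_locate hs hs.zero_eq hn (by simp)]
  simp only [wp_seq, wp_arith, Op.eval, Config.setReg_reg, Reg.idx_inj, reduceCtorEq, if_true,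
    if_false, hs.zero_eq, add_zero]
  rw [wp_locate hs' hs'.zero_eq hn (by simp)]
  simp [Config.setReg_reg, Config.setReg_mem, Reg.idx_inj, hs.zero_eq, hx, hy]

theorem IsOrderedTree.wp_drawTree (hT : IsOrderedTree G ord) (r : Fin n) :
    WP (400 * n ^ 6) drawTree (inputConfig r ord) fun t s =>
      t ≤ 400 * n ∧ outputDrawing n s = treeDrawing G r ord (n ^ 3 + 1) := by
  have hn : 0 < n := r.pos
  have hW : (n ^ 3 + 1) * (n ^ 3 + 1) + 2 * (n ^ 3 + 1) < 400 * n ^ 6 := by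
    have : 1 ≤ n ^ 3 := Nat.one_le_pow 3 n hn
    nlinarith
  have hroom : 12 * n ≤ 400 * n ^ 6 := by
    have := Nat.le_self_pow (show 6 ≠ 0 by simp) n
    omega
  rw [drawTree, wp_seq]
  refine (hT.wp_initRegs r hroom (by nlinarith)).mono ?_
  rintro _ s₀ ⟨rfl, hs₀, hwidth₀, hr₀, hmem₀⟩
  rw [wp_seq]
  refine ((hT.wp_search (N := n ^ 3 + 1) hs₀ hr₀
    (hmem₀ ▸ represents_inputConfig r ord _)).frame hs₀.toBounded).mono ?_
  rintro t₁ s₁ ⟨⟨ht₁, hm₁⟩, hf₁⟩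
  have hs₁ := hs₀.frame hf₁ (by decide)
  rw [wp_seq]
  refine ((hT.wp_computeSizes hs₁ hm₁).frame hs₁.toBounded).mono ?_
  rintro t₂ s₂ ⟨⟨ht₂, hm₂⟩, hf₂⟩
  have hs₂ := hs₁.frame hf₂ (by decide)
  have hf₁₂ := hf₁.trans hf₂
  rw [wp_seq]
  refine ((hT.wp_placeAll (Nat.lt_succ_self _) hW hs₂
    ((hf₁₂.reg_eq Reg.width (by decide)).trans hwidth₀)
    ((hf₁₂.reg_eq Reg.root (by decide)).trans hr₀) hm₂).frame hs₂.toBounded).mono ?_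
  rintro t₃ s₃ ⟨⟨ht₃, hm₃⟩, hf₃⟩
  refine (wp_setOutput (hs₂.frame hf₃ (by decide)) hn).mono ?_
  rintro _ s₄ ⟨rfl, (hx : s₄.reg 0 = _), (hy : s₄.reg 1 = _), hmem₄⟩
  refine ⟨by omega, funext fun v => ?_⟩
  have harr {A : Arr} (hA : A ∈ [Arr.lo, .hi, .j, .k, .x, .y]) :
      s₄.mem (addr n A 0 + v) = table G r ord (n ^ 3 + 1) A v := by
    rw [addr, add_zero, hmem₄]
    exact hm₃.arr_eq A v (.inr ⟨hA, hT.mem_searchOrder v⟩)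
  rw [outputDrawing, hx, hy, harr (by simp), harr (by simp)]
  rfl

end Draw

end TreeDrawing

theorem theorem2 :
    ∃ (P : TreeDrawing.Program) (c k : ℕ),
      ∀ (n : ℕ) (G : SimpleGraph (Fin n)) (r : Fin n) (ord : Fin n → List (Fin n)),
        G.IsTree → TreeDrawing.IsEdgeOrder G ord →
        ∃ (t : ℕ) (s : TreeDrawing.Config),
          TreeDrawing.Runs (c * n ^ k) P (TreeDrawing.inputConfig r ord) t s ∧
          t ≤ c * n ∧
          TreeDrawing.IsMonotoneDrawing G (TreeDrawing.outputDrawing n s) ∧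
          TreeDrawing.outputDrawing n s r = 0 ∧
          TreeDrawing.IsNonStrictlySlopeDisjoint G r (TreeDrawing.outputDrawing n s) ∧
          TreeDrawing.IsNearConvexMonotone G r ord (TreeDrawing.outputDrawing n s) ∧
          TreeDrawing.drawnSet G (TreeDrawing.outputDrawing n s) ⊆ TreeDrawing.secondOctant ∧
          TreeDrawing.FitsInGrid (TreeDrawing.outputDrawing n s) (2 * n) := by
  refine ⟨TreeDrawing.drawTree, 400, 6, fun n G r ord hG hord => ?_⟩
  have hT : TreeDrawing.IsOrderedTree G ord := ⟨hG, hord⟩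
  have hN : Fintype.card (Fin n) ^ 3 < n ^ 3 + 1 := by simp
  have hcone := hT.isConeDrawing_treeDrawing (r := r) hN
  obtain ⟨t, s, hruns, ht, hout⟩ := hT.wp_drawTree r
  refine ⟨t, s, hruns, ht, ?_⟩
  rw [hout]
  exact ⟨hcone.isMonotoneDrawing hT, TreeDrawing.treeDrawing_root,
    hcone.isNonStrictlySlopeDisjoint hT, hcone.isNearConvexMonotone hT,
    TreeDrawing.drawnSet_subset_secondOctant (hT.treeDrawing_mem_secondOctant hN),
    by simpa using hT.fitsInGrid_treeDrawing (r := r) hN⟩
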